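/- **Setting.** Fix $T\in(0,\infty)$, integers $d\ge 2$, $m\ge 0$, and a sequence $(\mathbb T_n)$ of finite partitions of $[0,T]$ (each containing $0$ and $T$) with $\mathbb T_1\subset\mathbb T_2\subset\cdots$ and mesh tending to $0$. For $t\in[0,T)$ write $t'_n=\min\{u\in\mathbb T_n:u>t\}$, and $T'_n=T$. Let $U\subset\mathbb R^d$ and $W\subset\mathbb R^m$ be open. $D([0,T],V)$ denotes the right-continuous $V$-valued functions on $[0,T]$ with left limits in $V$; $BV([0,T],V)$ denotes those of bounded variation and $CBV([0,T],V)$ the continuous ones among the latter. $Y^t=Y(\cdot\wedge t)$ is the path stopped at $t$. Functionals are maps $F:[0,T]\times D([0,T],U)\times BV([0,T],W)\to\mathbb R$; $F$ is *non-anticipative* if $F(t,X,A)=F(t,X^t,A^t)$. Two triples are $\eta$-close if $|t-\tilde t|<\eta$, $\sup_u|X^t(u)-\tilde X^{\tilde t}(u)|<\eta$ and $\sup_u|A^t(u)-\tilde A^{\tilde t}(u)|<\eta$ (strict at every $u$). $F$ is *continuous* if for every $(t,X,A)$ and $\varepsilon>0$ there is $\eta>0$ with $|F(t,X,A)-F(\tilde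 t,\tilde X,\tilde A)|<\varepsilon$ for all $\eta$-close $(\tilde t,\tilde X,\tilde A)$; *left-continuous* if this holds for those with $\tilde t<t$; *boundedness-preserving* if for all compact $K\subset U$, $L\subset W$ it is bounded on $[0,T]\times D([0,T],K)\times BV([0,T],L)$. The *vertical* derivatives $\partial_iF(t,X,A)$ are the partial derivatives at $v=0$ of $v\mapsto F(t,X^t+v1_{[t,T]},A)$, and $F$ is vertically differentiable if this map is always (totally) differentiable at $0$. The *horizontal* derivatives, for $t>0$, are $D_0F(t,X,A)=\lim_{h\downarrow0}\frac{F(t,X^{t-h},A^{t-h})-F(t-h,X^{t-h},A^{t-h})}{h}$ and, for $k=1,\dots,m$, a non-anticipative functional $D_kF$ with $$F(t,X^{t-h},A_1^{t-h},\dots,A_k^{t},\dots,A_m^{t-h})-F(t,X^{t-h},A^{t-h})=\big(D_kF(t,X,A)+o(1)\big)\,\big(A_k(t)-A_k(t-h)\big),\quad h\downarrow0,$$ over those $h$ for which the mixed path belongs to $BV([0,T],W)$. $\mathbb C^{1,2}[0,T]$ is the set of continuous non-anticipative $F$ having horizontal derivatives $D_0F,\dots,D_mF$ and being twice vertically differentiable,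 such that $F$, the $D_kF$, the $\partial_iF$ and the $\partial_i\partial_jF$ are left-continuous and boundedness-preserving (for suitable choices of the $D_kF$). For a functional $\Theta$ with values in $\mathbb R^d$ and $X\in C([0,T],U)$ put $$\int_0^t\Theta(s,X,A)\,dX(s):=\lim_{n\to\infty}\sum_{s\in\mathbb T_n,\,s\le t}\Theta(s,X_n^{s-},A)\cdot\big(X(s'_n)-X(s)\big),$$ where $X_n^{s-}(u)=X(u'_n)$ for $u<s$ and $X_n^{s-}(u)=X(s)$ for $u\ge s$. A functional $G\in\mathbb C^{1,2}[0,T]$ is *regular* for $(X,A)$ if $$\Gamma^G(t):=G(0,X,A)-G(t,X,A)+\int_0^t\sum_i\partial_iG(s,X,A)\,dX_i(s),\qquad 0\le t\le T,$$ has finite variation on $[0,T]$. **Market.** Let $S=(S_1,\dots,S_d)$ be continuous on $[0,T]$ with $S_i\ge0$, $S_i(0)>0$ and $\sum_jS_j(t)>0$ for all $t$, and let $\mu_i=S_i/\sum_jS_j$ be the market weights. Assume $\mu$ takes values in $U$ and that for all $i,j$ and $t$ the limit $\langle\mu_i,\mu_j\rangle(t)=\lim_n\sum_{s\in\mathbb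 T_n,s\le t}(\mu_i(s'_n)-\mu_i(s))(\mu_j(s'_n)-\mu_j(s))$ exists, is finite, and is continuous in $t$. Let $A\in CBV([0,T],W)$. A *trading strategy* is $\vartheta(t)=\Theta(t,\mu,A)$ with $\Theta$ a non-anticipative $\mathbb R^d$-valued functional such that, for $V^\vartheta:=\sum_i\vartheta_i\mu_i$, the integral of $\Theta$ exists and $V^\vartheta(t)-V^\vartheta(0)=\int_0^t\Theta(s,\mu,A)\,d\mu(s)$ for all $t$. It is *strong arbitrage relative to the market over* $[0,t]$ if $V^\vartheta(u)\ge0$ for all $u\in[0,t]$ and $V^\vartheta(t)>V^\vartheta(0)$. For a nonnegative $G$ that is regular for $(\mu,A)$, with $G(\cdot,\mu,A)>0$ and $1/G(\cdot,\mu,A)$ bounded, put $K(t)=\exp\big(\int_0^t\frac{d\Gamma^G(s)}{G(s,\mu,A)}\big)$ and $\eta_i=\partial_iG(\cdot,\mu,A)K$, represented by the functional $\partial_iG(t,X,A)K(t)$ with $K$ that fixed function of time. The strategy *multiplicatively generated* by $G$ is $\psi_i=\eta_i-Q^\eta-C(0)$, where $Q^\eta(t)=V^\eta(t)-V^\eta(0)-\int_0^t\eta\,d\mu$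 and $C(0)=\sum_i\partial_iG(0,\mu,A)\mu_i(0)-G(0,\mu,A)$. It is represented by the functional $\partial_iG(t,X,A)K(t)-Q^\eta(t)-C(0)$, in which $Q^\eta$ is likewise a fixed function of time. **Theorem.** Let $G:[0,T]\times D([0,T],U)\times BV([0,T],W)\to[0,\infty)$ be regular for $(\mu,A)$ with $G(0,\mu,A)=1$, and assume one of the following: (i) $G$ is bounded from above; (ii) $A$ takes values in a compact set $L\subset\mathbb R^m$. Let $T_*\in(0,T]$ and $\varepsilon>0$ be such that $$\Gamma^G(T_*)>1+\varepsilon .$$ Then there is a constant $c>0$ (for the given data, depending on $T_*$ and $\varepsilon$) such that $G^{(c)}:=\frac{G+c}{1+c}$ is nonnegative and regular for $(\mu,A)$, with $G^{(c)}(\cdot,\mu,A)>0$, $1/G^{(c)}(\cdot,\mu,A)$ bounded and $\int_0^t\eta\,d\mu$ existing for every $t\in[0,T]$; the $\psi^{(c)}$ multiplicatively generated by $G^{(c)}$ is a trading strategy; and $\psi^{(c)}$ is strong arbitrage relative to the market over $[0,T_*]$. If moreover $\Gamma^G$ is nondecreasing on $[0,T]$, then, with the same $c$, $\psi^{(c)}$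 is strong arbitrage relative to the market over $[0,t]$ for every $t\in[T_*,T]$. -/

import Mathlib

open Filter Topology Set MeasureTheory

noncomputable section

namespace PathwiseSPT

/-! ### Time, paths, functionals -/

/-- The time interval `[0, T]`. -/
abbrev Time (T : ℝ) : Type := ↥(Set.Icc (0 : ℝ) T)

instance instCompactIccTime (T : ℝ) : CompactIccSpace (Time T) :=
  ⟨fun {_ _} => isClosed_Icc.isCompact⟩

/-- `ℝ^d` with its Euclidean norm. -/
abbrev Vec (d : ℕ) : Type := EuclideanSpace ℝ (Fin d)

/-- All functions `[0, T] → ℝ^d`; the path spaces are cut out by the predicates below. -/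
abbrev Path (T : ℝ) (d : ℕ) : Type := Time T → Vec d

/-- Real functionals of `(t, X, A)`.  Only their values at `X ∈ D([0, T], U)` and
`A ∈ BV([0, T], W)` ever matter. -/
abbrev Functional (T : ℝ) (d m : ℕ) : Type := Time T → Path T d → Path T m → ℝ

/-- Functionals of `(t, X, A)` with values in `ℝ^d`. -/
abbrev VecFunctional (T : ℝ) (d m : ℕ) : Type := Time T → Path T d → Path T m → Vec d

variable {T : ℝ} {d m : ℕ}

/-- The initial time. -/
def t₀ (hT : 0 < T) : Time T := ⟨0, le_refl 0, hT.le⟩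

/-- `X ∈ D([0, T], V)`: right continuous, with left limits, all taken in `V`. -/
structure IsCadlag (V : Set (Vec d)) (X : Path T d) : Prop where
  mem : ∀ t, X t ∈ V
  right : ∀ t, ContinuousWithinAt X (Set.Ici t) t
  left : ∀ t, ∃ l ∈ V, Tendsto X (𝓝[<] t) (𝓝 l)

/-- `A ∈ BV([0, T], V)`. -/
structure IsBV (V : Set (Vec d)) (A : Path T d) : Prop where
  cadlag : IsCadlag V A
  bv : BoundedVariationOn A Set.univ

/-- The stopped path `X^t = X(· ∧ t)`. -/
def stopAt (X : Path T d) (t : Time T) : Path T d := fun u => X (min u t)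

/-- The vertical perturbation `X^{t,v} = X^t + v 1_{[t, T]}`. -/
def bump (X : Path T d) (t : Time T) (v : Vec d) : Path T d :=
  fun u => stopAt X t u + if t ≤ u then v else 0

/-- The path whose `k`-th component is that of `A` stopped at `t`, all other components being
stopped at `s`. -/
def stopMixed (A : Path T m) (k : Fin m) (s t : Time T) : Path T m :=
  fun u => WithLp.toLp 2 fun j => if j = k then A (min u t) j else A (min u s) j

/-- `F(t, X, A) = F(t, X^t, A^t)`. -/
def IsNonAnticipative {β : Type} (U : Set (Vec d)) (W : Set (Vec m))
    (F : Time T → Path T d → Path T m → β) : Prop :=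
  ∀ t X A, IsCadlag U X → IsBV W A → F t X A = F t (stopAt X t) (stopAt A t)

/-- `(t, X, A)` and `(t', X', A')` are `η`-close: `|t - t'| < η`, and the stopped paths
`X^t, X'^{t'}` and `A^t, A'^{t'}` are uniformly `η`-close. -/
def Close (η : ℝ) (t : Time T) (X : Path T d) (A : Path T m)
    (t' : Time T) (X' : Path T d) (A' : Path T m) : Prop :=
  |(t : ℝ) - t'| < η ∧ (∀ u, ‖stopAt X t u - stopAt X' t' u‖ < η) ∧
    ∀ u, ‖stopAt A t u - stopAt A' t' u‖ < η

/-- Continuity of a functional in `(t, X, A)`. -/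
def IsContinuousFunctional (U : Set (Vec d)) (W : Set (Vec m)) (F : Functional T d m) : Prop :=
  ∀ ε > 0, ∀ t X A, IsCadlag U X → IsBV W A → ∃ η > 0, ∀ t' X' A', IsCadlag U X' → IsBV W A' →
    Close η t X A t' X' A' → |F t X A - F t' X' A'| < ε

/-- Left-continuity of a functional. -/
def IsLeftContinuous (U : Set (Vec d)) (W : Set (Vec m)) (F : Functional T d m) : Prop :=
  ∀ ε > 0, ∀ t X A, IsCadlag U X → IsBV W A → ∃ η > 0, ∀ t' X' A', IsCadlag U X' → IsBV W A' →
    t' < t → Close η t X A t' X' A' → |F t X A - F t' X' A'| < ε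

/-- Boundedness on paths with values in given compact sets. -/
def IsBoundednessPreserving (U : Set (Vec d)) (W : Set (Vec m)) (F : Functional T d m) : Prop :=
  ∀ K L, IsCompact K → IsCompact L → K ⊆ U → L ⊆ W →
    ∃ C : ℝ, ∀ t X A, IsCadlag K X → IsBV L A → |F t X A| ≤ C

/-! ### Horizontal and vertical derivatives -/

/-- `D₀ = D_0 F`: the horizontal derivative of `F` in time, with `s = t - h ↑ t`. -/
def IsTimeDerivative (U : Set (Vec d)) (W : Set (Vec m)) (F D₀ : Functional T d m) : Prop :=
  ∀ (t : Time T) X A, IsCadlag U X → IsBV W A → 0 < (t : ℝ) →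
    Tendsto (fun s : Time T =>
      (F t (stopAt X s) (stopAt A s) - F s (stopAt X s) (stopAt A s)) / ((t : ℝ) - s))
      (𝓝[<] t) (𝓝 (D₀ t X A))

/-- `D = D_k F`: the horizontal derivative of `F` in the `k`-th component of `A`, with
`s = t - h ↑ t`.  The limit of the difference quotients is written as a first order expansion, so
that times `s` with `A_k(t) = A_k(s)` (where the numerator has to vanish too) impose nothing on the
value of the derivative.  Mixed paths that leave `W` are disregarded. -/
def IsHorizontalDerivative (U : Set (Vec d)) (W : Set (Vec m)) (k : Fin m)
    (F D : Functional T d m) : Prop :=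
  ∀ (t : Time T) X A, IsCadlag U X → IsBV W A → 0 < (t : ℝ) → ∀ ε > 0, ∀ᶠ s in 𝓝[<] t,
    IsBV W (stopMixed A k s t) →
      |F t (stopAt X s) (stopMixed A k s t) - F t (stopAt X s) (stopAt A s)
        - D t X A * (A t k - A s k)| ≤ ε * |A t k - A s k|

/-- The vertical partial derivative `∂_i F`. -/
def vDeriv (F : Functional T d m) (i : Fin d) : Functional T d m :=
  fun t X A => deriv (fun θ : ℝ => F t (bump X t (EuclideanSpace.single i θ)) A) 0

/-- The vertical gradient `∇_X F`. -/
def vGrad (F : Functional T d m) : VecFunctional T d m :=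
  fun t X A => WithLp.toLp 2 fun i => vDeriv F i t X A

/-- `F` is vertically differentiable everywhere. -/
def IsVerticallyDifferentiable (U : Set (Vec d)) (W : Set (Vec m)) (F : Functional T d m) : Prop :=
  ∀ t X A, IsCadlag U X → IsBV W A → DifferentiableAt ℝ (fun v : Vec d => F t (bump X t v) A) 0

/-- Left-continuous and boundedness-preserving. -/
def IsTame (U : Set (Vec d)) (W : Set (Vec m)) (F : Functional T d m) : Prop :=
  IsLeftContinuous U W F ∧ IsBoundednessPreserving U W F

/-- The class `ℂ^{1,2}[0, T]`. -/
structure IsC12 (U : Set (Vec d)) (W : Set (Vec m)) (F : Functional T d m) : Prop where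
  nonAnticipative : IsNonAnticipative U W F
  continuous : IsContinuousFunctional U W F
  tame : IsTame U W F
  timeDerivative : ∃ D₀, IsNonAnticipative U W D₀ ∧ IsTimeDerivative U W F D₀ ∧ IsTame U W D₀
  horizontalDerivative : ∀ k, ∃ D, IsNonAnticipative U W D ∧ IsHorizontalDerivative U W k F D ∧
    IsTame U W D
  vDiff : IsVerticallyDifferentiable U W F
  vDeriv_tame : ∀ i, IsTame U W (vDeriv F i)
  vDiff_vDeriv : ∀ i, IsVerticallyDifferentiable U W (vDeriv F i)
  vDeriv_vDeriv_tame : ∀ i j, IsTame U W (vDeriv (vDeriv F j) i)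

/-! ### Partitions, covariations, the pathwise integral -/

/-- The successor of `t` in the finite set `p` (and `t` itself if there is none). -/
def succ (p : Finset (Time T)) (t : Time T) : Time T :=
  if h : (p.filter fun u => t < u).Nonempty then (p.filter fun u => t < u).min' h else t

/-- A refining sequence of finite partitions of `[0, T]` with mesh tending to `0`. -/
structure IsRefiningPartition (hT : 0 < T) (P : ℕ → Finset (Time T)) : Prop where
  zero_mem : ∀ n, t₀ hT ∈ P n
  last_mem : ∀ n, (⟨T, hT.le, le_refl T⟩ : Time T) ∈ P n
  refining : Monotone P
  mesh : ∀ ε > 0, ∀ᶠ n in atTop, ∀ s ∈ P n, (succ (P n) s : ℝ) - s < ε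

/-- The components of `X` have finite, continuous covariations along `P`. -/
def HasCovariations (P : ℕ → Finset (Time T)) (X : Path T d) : Prop :=
  ∀ i j, ∃ C : Time T → ℝ, Continuous C ∧ ∀ t, Tendsto (fun n =>
    ∑ s ∈ (P n).filter (fun s => s ≤ t),
      (X (succ (P n) s) i - X s i) * (X (succ (P n) s) j - X s j)) atTop (𝓝 (C t))

/-- The left limit `X_n^{s-}` at a partition point `s` of the approximation
`X_n = ∑_{r ∈ p} X(r') 1_{[r, r')}`. -/
def leftApprox (p : Finset (Time T)) (X : Path T d) (s : Time T) : Path T d :=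
  fun u => if u < s then X (succ p u) else X s

/-- `∑_{s ∈ T_n, s ≤ t} Θ(s, X_n^{s-}, A) · (X(s') - X(s))`. -/
def itoSum (P : ℕ → Finset (Time T)) (Θ : VecFunctional T d m) (X : Path T d) (A : Path T m)
    (t : Time T) (n : ℕ) : ℝ :=
  ∑ s ∈ (P n).filter (fun s => s ≤ t),
    ∑ i, Θ s (leftApprox (P n) X s) A i * (X (succ (P n) s) i - X s i)

/-- `∫_0^t Θ(s, X, A) dX(s)` exists and equals `I`. -/
def HasItoIntegral (P : ℕ → Finset (Time T)) (Θ : VecFunctional T d m) (X : Path T d)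
    (A : Path T m) (t : Time T) (I : ℝ) : Prop :=
  Tendsto (itoSum P Θ X A t) atTop (𝓝 I)

/-- The pathwise integral `∫_0^t Θ(s, X, A) dX(s)`. -/
def itoIntegral (P : ℕ → Finset (Time T)) (Θ : VecFunctional T d m) (X : Path T d)
    (A : Path T m) (t : Time T) : ℝ :=
  limUnder atTop (itoSum P Θ X A t)

/-! ### Regular functionals and trading strategies -/

/-- `Γ^G(t) = G(0, X, A) - G(t, X, A) + ∫_0^t ∇_X G(s, X, A) dX(s)`. -/
def gammaFn (hT : 0 < T) (P : ℕ → Finset (Time T)) (G : Functional T d m) (X : Path T d)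
    (A : Path T m) (t : Time T) : ℝ :=
  G (t₀ hT) X A - G t X A + itoIntegral P (vGrad G) X A t

/-- `G` is regular for the pair `(X, A)`. -/
structure IsRegular (hT : 0 < T) (P : ℕ → Finset (Time T)) (U : Set (Vec d)) (W : Set (Vec m))
    (X : Path T d) (A : Path T m) (G : Functional T d m) : Prop where
  c12 : IsC12 U W G
  gamma_bv : BoundedVariationOn (gammaFn hT P G X A) Set.univ

/-- The value process `V^ϑ(t) = ∑ ϑ_i(t) X_i(t)` of `ϑ(t) = Θ(t, X, A)`. -/
def value (Θ : VecFunctional T d m) (X : Path T d) (A : Path T m) (t : Time T) : ℝ :=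
  ∑ i, Θ t X A i * X t i

/-- `ϑ = Θ(·, X, A)` is a (self-financing) trading strategy with respect to `X`. -/
structure IsTradingStrategy (hT : 0 < T) (P : ℕ → Finset (Time T)) (U : Set (Vec d))
    (W : Set (Vec m)) (X : Path T d) (A : Path T m) (Θ : VecFunctional T d m) : Prop where
  nonAnticipative : IsNonAnticipative U W Θ
  selfFinancing : ∀ t, HasItoIntegral P Θ X A t (value Θ X A t - value Θ X A (t₀ hT))

/-- The defect of self-financibility `Q^ϑ` of `ϑ = Θ(·, X, A)`. -/
def defect (hT : 0 < T) (P : ℕ → Finset (Time T)) (Θ : VecFunctional T d m) (X : Path T d)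
    (A : Path T m) (t : Time T) : ℝ :=
  value Θ X A t - value Θ X A (t₀ hT) - itoIntegral P Θ X A t

/-- The defect of balance `C(0)` of `G`. -/
def balanceDefect (hT : 0 < T) (G : Functional T d m) (X : Path T d) (A : Path T m) : ℝ :=
  ∑ i, vDeriv G i (t₀ hT) X A * X (t₀ hT) i - G (t₀ hT) X A

open scoped Classical in
/-- The Lebesgue–Stieltjes integral `∫_0^t f dg` for `g` of bounded variation. -/
def stieltjesIntegral (f g : Time T → ℝ) (t : Time T) : ℝ :=
  if h : BoundedVariationOn g Set.univ then ∫ᵛ s in Set.Iic t, f s ∂•h.vectorMeasure else 0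

/-- `K(t) = exp (∫_0^t dΓ^G(s) / G(s, X, A))`. -/
def expGamma (hT : 0 < T) (P : ℕ → Finset (Time T)) (G : Functional T d m) (X : Path T d)
    (A : Path T m) (t : Time T) : ℝ :=
  Real.exp (stieltjesIntegral (fun s => 1 / G s X A) (gammaFn hT P G X A) t)

/-- The integrand `η_i = ∂_i G(·, X, A) K(·)`, as a functional in which the scalar function `K` of
bounded variation is the one belonging to the given pair `(X, A)`. -/
def etaFunctional (hT : 0 < T) (P : ℕ → Finset (Time T)) (G : Functional T d m) (X : Path T d)
    (A : Path T m) : VecFunctional T d m :=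
  fun t Y B => WithLp.toLp 2 fun i => vDeriv G i t Y B * expGamma hT P G X A t

/-- The strategy `ψ_i = η_i - Q^η - C(0)`, multiplicatively generated by `G` for `(X, A)`. -/
def multStrategy (hT : 0 < T) (P : ℕ → Finset (Time T)) (G : Functional T d m) (X : Path T d)
    (A : Path T m) : VecFunctional T d m :=
  fun t Y B => WithLp.toLp 2 fun i =>
    etaFunctional hT P G X A t Y B i - defect hT P (etaFunctional hT P G X A) X A t
      - balanceDefect hT G X A

/-- The functional `G^{(c)} = (G + c) / (1 + c)`. -/
def shifted (G : Functional T d m) (c : ℝ) : Functional T d m :=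
  fun t Y B => (G t Y B + c) / (1 + c)

/-- `G` generates multiplicatively: it is nonnegative and regular for `(X, A)`, the function
`1 / G(·, X, A)` is bounded, and `η` can be integrated with respect to `X`. -/
structure IsMultGenerator (hT : 0 < T) (P : ℕ → Finset (Time T)) (U : Set (Vec d))
    (W : Set (Vec m)) (X : Path T d) (A : Path T m) (G : Functional T d m) : Prop where
  regular : IsRegular hT P U W X A G
  nonneg : ∀ t Y B, IsCadlag U Y → IsBV W B → 0 ≤ G t Y B
  pos : ∀ t, 0 < G t X A
  inv_bounded : ∃ b : ℝ, ∀ t, 1 / G t X A ≤ b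
  eta_integrable : ∀ t, ∃ I, HasItoIntegral P (etaFunctional hT P G X A) X A t I

/-- The value process `V` makes strong relative arbitrage over the horizon `[0, t]`. -/
def IsStrongArbitrage (hT : 0 < T) (V : Time T → ℝ) (t : Time T) : Prop :=
  (∀ u, u ≤ t → 0 ≤ V u) ∧ V (t₀ hT) < V t

/-! ### The market -/

/-- `S` is a vector of capitalizations: continuous, nonnegative, positive at time `0`, and with
total capitalization that never vanishes. -/
structure IsCapitalization (hT : 0 < T) (S : Path T d) : Prop where
  continuous : Continuous S
  nonneg : ∀ t i, 0 ≤ S t i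
  init_pos : ∀ i, 0 < S (t₀ hT) i
  total_pos : ∀ t, 0 < ∑ i, S t i

/-- The market weights `μ_i = S_i / (S_1 + ⋯ + S_d)`. -/
def marketWeights (S : Path T d) : Path T d :=
  fun t => WithLp.toLp 2 fun i => S t i / ∑ j, S t j

end PathwiseSPT

end

/-! Write `Γ` for `Γ^G` and `K` for the exponential that belongs to `G^{(c)}`. The strategy
generated by `G^{(c)}` has wealth `V = G^{(c)} K` (`value_multStrategy`), and in the exponent the
factors `1 / (1 + c)` cancel, which leaves `∫ dΓ / (G + c)`. Along the given pair `G` is continuous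
in time, hence bounded by some `M`, so `1 / (G + c)` differs from `1 / c` by at most `M / c²`.
Therefore the exponent is at least `Γ(t) / c - R / c²` with `R` independent of `c` and `t`
(`exists_le_stieltjesIntegral`). From `G^{(c)} ≥ c / (1 + c)` and `exp x ≥ 1 + x` it follows that
`V(t) > (1 + 1 / c) · c / (1 + c) = 1 = V(0)` as soon as `Γ(t) - R / c > 1`. A large `c` achieves
this when `Γ(t) > 1 + ε`.

The labour lies in `V = G^{(c)} K`, that is, in the identity `∫ η dμ = G K - G(0)` for a regular `G`
that is positive along the pair (`hasItoIntegral_etaFunctional`). It rests on a pathwise functional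
Itô formula (`hasItoIntegral_vGrad`). Over a partition interval the approximating path first jumps
and then stays frozen while time and `A` move on (`leftApprox_succ`). The jump is treated by a
second order Taylor expansion. The horizontal derivatives describe the motion of one component of
`A` at a time, so `A` is first replaced by paths whose components take turns in moving
(`exists_clocks`), and these then approach `A` (`abs_horizontal_expansion_le`).

Since the derivatives are only left-continuous, an expansion with coefficients frozen at `t` is good
just to the left of `t` and nowhere else. This suffices: a function whose increments are dominated
by those of a continuous `ω`, with arbitrarily small constants to the left of each time, is constant
(`eq_of_abs_sub_le`). Applied to the difference of two ultrafilter limits of partition sums, it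
yields convergence (`exists_tendsto_psum`), in place of weak convergence of quadratic variation
measures. The same principle makes the errors in the product rule for `G K` vanish
(`tendsto_psum_zero`). -/

noncomputable section
namespace PathwiseSPT

/-! ### A one-sided mean value inequality -/

section LeftMonotone

variable {α : Type*} [LinearOrder α] [TopologicalSpace α] [OrderTopology α] [DenselyOrdered α]
  [CompactIccSpace α]

/-- A continuous function which, at each point, is locally dominated by its values to the left
decreases. -/
theorem le_of_eventually_le_left {g : α → ℝ} {a b : α} (hab : a ≤ b)
    (hg : ContinuousOn g (Icc a b))
    (h : ∀ t ∈ Ioc a b, ∀ᶠ r in 𝓝[<] t, g t ≤ g r) : g b ≤ g a := by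
  by_contra! hlt
  have hcl : IsClosed (Icc a b ∩ g ⁻¹' Ici (g b)) :=
    hg.preimage_isClosed_of_isClosed isClosed_Icc isClosed_Ici
  have hco : IsCompact (Icc a b ∩ g ⁻¹' Ici (g b)) :=
    isCompact_Icc.of_isClosed_subset hcl inter_subset_left
  -- `t` is the first time in `[a, b]` at which `g` is at least `g b`. If `g a < g b` then `a < t`,
  -- and the hypothesis at `t` yields an earlier time with the same property.
  obtain ⟨t, ⟨⟨hat, htb⟩, hgt⟩, hmin⟩ := hco.exists_isLeast ⟨b, ⟨hab, le_rfl⟩, le_refl (g b)⟩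
  have hat' : a < t := by
    refine lt_of_le_of_ne hat ?_
    rintro rfl
    exact absurd (mem_Ici.1 hgt) (not_le.2 hlt)
  have : (𝓝[<] t).NeBot := nhdsLT_neBot_of_exists_lt ⟨a, hat'⟩
  obtain ⟨r, hr1, hr2, hr3⟩ := ((h t ⟨hat', htb⟩).and
    ((Ioo_mem_nhdsLT hat'))).exists
  exact absurd (hmin ⟨⟨hr2.le, hr3.le.trans htb⟩, mem_Ici.2 (le_trans (mem_Ici.1 hgt) hr1)⟩)
    (not_le.2 hr3)

/-- A one-sided mean value inequality, relative to a continuous function `ω`. -/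
theorem abs_sub_le_of_eventually_left {φ ω : α → ℝ} {a b : α} (hab : a ≤ b)
    (hφ : ContinuousOn φ (Icc a b)) (hω : ContinuousOn ω (Icc a b))
    (h : ∀ t ∈ Ioc a b, ∀ᶠ r in 𝓝[<] t, |φ t - φ r| ≤ ω t - ω r) :
    |φ b - φ a| ≤ ω b - ω a := by
  have h1 := le_of_eventually_le_left (g := fun t => φ t - ω t) hab (hφ.sub hω) fun t ht => by
    filter_upwards [h t ht] with r hr
    linarith [(abs_le.1 hr).2]
  have h2 := le_of_eventually_le_left (g := fun t => -φ t - ω t) hab (hφ.neg.sub hω)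
    fun t ht => by
      filter_upwards [h t ht] with r hr
      linarith [(abs_le.1 hr).1]
  rw [abs_le]
  constructor <;> linarith

theorem continuous_of_abs_sub_le {β : Type*} [LinearOrder β] [TopologicalSpace β] {φ ω : β → ℝ}
    {C : ℝ} (hω : Continuous ω) (h : ∀ a b, a ≤ b → |φ b - φ a| ≤ C * (ω b - ω a)) :
    Continuous φ := by
  rw [continuous_iff_continuousAt]
  intro t
  have h0 : Tendsto (fun r => |C * (ω r - ω t)|) (𝓝 t) (𝓝 0) := by
    have : ContinuousAt (fun r => |C * (ω r - ω t)|) t := by fun_prop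
    simpa [ContinuousAt] using this
  rw [ContinuousAt, tendsto_iff_dist_tendsto_zero]
  refine squeeze_zero (fun _ => dist_nonneg) (fun r => ?_) h0
  rw [Real.dist_eq]
  rcases le_total r t with hr | hr
  · rw [abs_sub_comm]
    refine (h r t hr).trans ?_
    rw [← abs_neg]
    refine le_trans (le_of_eq (by ring)) (le_abs_self _)
  · exact (h t r hr).trans (le_abs_self _)

end LeftMonotone

/-! ### Partitions -/

variable {T : ℝ} {d m : ℕ}

theorem t₀_le (hT : 0 < T) (t : Time T) : t₀ hT ≤ t := t.2.1

theorem le_succ (p : Finset (Time T)) (t : Time T) : t ≤ succ p t := by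
  unfold succ
  split_ifs with h
  · exact (Finset.mem_filter.1 (Finset.min'_mem _ h)).2.le
  · exact le_rfl

theorem succ_mem {p : Finset (Time T)} {t r : Time T} (hr : r ∈ p) (htr : t < r) :
    succ p t ∈ p ∧ t < succ p t ∧ succ p t ≤ r := by
  have h : (p.filter fun u => t < u).Nonempty := ⟨r, Finset.mem_filter.2 ⟨hr, htr⟩⟩
  have h2 := Finset.mem_filter.1 (Finset.min'_mem _ h)
  unfold succ
  rw [dif_pos h]
  exact ⟨h2.1, h2.2, Finset.min'_le _ _ (Finset.mem_filter.2 ⟨hr, htr⟩)⟩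

theorem succ_eq_self {p : Finset (Time T)} {t : Time T} (h : ∀ r ∈ p, r ≤ t) : succ p t = t := by
  unfold succ
  rw [dif_neg]
  rintro ⟨r, hr⟩
  exact absurd (h r (Finset.mem_filter.1 hr).1) (not_le.2 (Finset.mem_filter.1 hr).2)

theorem succ_mem_of_mem {p : Finset (Time T)} {t : Time T} (ht : t ∈ p) : succ p t ∈ p := by
  by_cases h : ∃ r ∈ p, t < r
  · obtain ⟨r, hr, htr⟩ := h
    exact (succ_mem hr htr).1
  · push Not at h
    rwa [succ_eq_self h]

/-- This makes the successor locally constant between neighbouring partition points, which is what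
the regularity of the step paths rests on. -/
theorem succ_congr {p : Finset (Time T)} {t r : Time T} (hr : r ∈ p) (htr : t < r) {u : Time T}
    (h : ∀ v ∈ p, t < v ↔ u < v) : succ p t = succ p u := by
  have h1 := succ_mem hr htr
  have h2 := succ_mem hr ((h r hr).1 htr)
  exact le_antisymm (succ_mem h2.1 ((h _ h2.1).2 h2.2.1)).2.2
    (succ_mem h1.1 ((h _ h1.1).1 h1.2.1)).2.2

/-- The sum of `f` over the points of `p` up to time `t`. -/
def psum (p : Finset (Time T)) (f : Time T → ℝ) (t : Time T) : ℝ :=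
  ∑ s ∈ p.filter (fun s => s ≤ t), f s

theorem psum_add (p : Finset (Time T)) (f g : Time T → ℝ) (t : Time T) :
    psum p (fun s => f s + g s) t = psum p f t + psum p g t := Finset.sum_add_distrib

theorem psum_sub (p : Finset (Time T)) (f g : Time T → ℝ) (t : Time T) :
    psum p (fun s => f s - g s) t = psum p f t - psum p g t := Finset.sum_sub_distrib _ _

theorem psum_const_mul (p : Finset (Time T)) (c : ℝ) (f : Time T → ℝ) (t : Time T) :
    psum p (fun s => c * f s) t = c * psum p f t := (Finset.mul_sum _ _ _).symm

theorem psum_sum {ι : Type*} (I : Finset ι) (p : Finset (Time T)) (f : ι → Time T → ℝ)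
    (t : Time T) : psum p (fun s => ∑ i ∈ I, f i s) t = ∑ i ∈ I, psum p (f i) t :=
  Finset.sum_comm

theorem psum_congr {p : Finset (Time T)} {f g : Time T → ℝ} {t : Time T}
    (h : ∀ s ∈ p, f s = g s) : psum p f t = psum p g t :=
  Finset.sum_congr rfl fun s hs => h s (Finset.mem_filter.1 hs).1

theorem psum_sub_psum (p : Finset (Time T)) (f : Time T → ℝ) {a b : Time T} (hab : a ≤ b) :
    psum p f b - psum p f a = ∑ s ∈ p.filter (fun s => a < s ∧ s ≤ b), f s := by
  unfold psum
  rw [sub_eq_iff_eq_add, ← Finset.sum_union]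
  · congr 1
    ext s
    simp only [Finset.mem_filter, Finset.mem_union]
    rcases lt_or_ge a s with h | h
    · simp [h, not_le.2 h]
    · simp [h, not_lt.2 h, h.trans hab]
  · rw [Finset.disjoint_filter]
    exact fun s _ h1 h2 => absurd h2 (not_le.2 h1.1)

theorem abs_psum_sub_psum_le {p : Finset (Time T)} {f g : Time T → ℝ} {a b : Time T}
    (hab : a ≤ b) (h : ∀ s ∈ p, a < s → s ≤ b → |f s| ≤ g s) :
    |psum p f b - psum p f a| ≤ psum p g b - psum p g a := by
  rw [psum_sub_psum p f hab, psum_sub_psum p g hab]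
  refine (Finset.abs_sum_le_sum_abs _ _).trans (Finset.sum_le_sum fun s hs => ?_)
  rw [Finset.mem_filter] at hs
  exact h s hs.1 hs.2.1 hs.2.2

theorem abs_psum_le {p : Finset (Time T)} {f g : Time T → ℝ} {t : Time T}
    (h : ∀ s ∈ p, |f s| ≤ g s) : |psum p f t| ≤ psum p g t :=
  (Finset.abs_sum_le_sum_abs _ _).trans
    (Finset.sum_le_sum fun s hs => h s (Finset.mem_filter.1 hs).1)

/-- Increments along the partition telescope. -/
theorem psum_telescope {p : Finset (Time T)} (hT : 0 < T) (h0 : t₀ hT ∈ p)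
    (hl : (⟨T, hT.le, le_refl T⟩ : Time T) ∈ p) (f : Time T → ℝ) (t : Time T) :
    psum p (fun s => f (succ p s) - f s) t = f (succ p t) - f (t₀ hT) := by
  -- Induction on the number of partition points before `q`. The last of them, `r`, has successor
  -- `q` and accounts for one summand.
  have key : ∀ k : ℕ, ∀ q : Time T, q ∈ p → (p.filter fun s => s < q).card = k →
      ∑ s ∈ p.filter (fun s => s < q), (f (succ p s) - f s) = f q - f (t₀ hT) := by
    intro k
    induction k using Nat.strong_induction_on with
    | _ k ih =>
      intro q hq hk
      rcases (t₀_le hT q).eq_or_lt with h | h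
      · rw [← h, Finset.filter_false_of_mem fun s _ => not_lt.2 (t₀_le hT s)]
        simp
      · have hne : (p.filter fun s => s < q).Nonempty := ⟨_, Finset.mem_filter.2 ⟨h0, h⟩⟩
        set r := (p.filter fun s => s < q).max' hne with hr
        have hrm := Finset.mem_filter.1 (Finset.max'_mem _ hne)
        rw [← hr] at hrm
        have hmax : ∀ s ∈ p, s < q → s ≤ r := fun s hs hsq =>
          Finset.le_max' _ _ (Finset.mem_filter.2 ⟨hs, hsq⟩)
        have hsucc : succ p r = q := by
          have h2 := succ_mem hq hrm.2
          refine le_antisymm h2.2.2 ?_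
          by_contra! hlt
          exact absurd (hmax _ h2.1 hlt) (not_le.2 h2.2.1)
        have hsplit : p.filter (fun s => s < q) = insert r (p.filter fun s => s < r) := by
          ext s
          simp only [Finset.mem_filter, Finset.mem_insert]
          constructor
          · rintro ⟨h1, h2⟩
            rcases (hmax s h1 h2).eq_or_lt with h3 | h3
            · exact Or.inl h3
            · exact Or.inr ⟨h1, h3⟩
          · rintro (h1 | ⟨h1, h2⟩)
            · rw [h1]; exact hrm
            · exact ⟨h1, h2.trans hrm.2⟩
        have hcard : (p.filter fun s => s < r).card < k := by
          rw [← hk, hsplit, Finset.card_insert_of_notMem (by simp)]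
          exact Nat.lt_succ_self _
        rw [hsplit, Finset.sum_insert (by simp), ih _ hcard r hrm.1 rfl, hsucc]
        ring
  have hle : ∀ s : Time T, s ≤ (⟨T, hT.le, le_refl T⟩ : Time T) := fun s => s.2.2
  unfold psum
  rcases (hle t).eq_or_lt with h | h
  · have h1 : p.filter (fun s => s ≤ t) = insert t (p.filter fun s => s < t) := by
      ext s
      simp only [Finset.mem_filter, Finset.mem_insert, le_iff_lt_or_eq]
      constructor
      · rintro ⟨h1, h2 | h2⟩
        · exact Or.inr ⟨h1, h2⟩
        · exact Or.inl h2
      · rintro (h1 | ⟨h1, h2⟩)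
        · rw [h1, h]; exact ⟨hl, Or.inr rfl⟩
        · exact ⟨h1, Or.inl h2⟩
    rw [h1, Finset.sum_insert (by simp), key _ t (h ▸ hl) rfl]
    ring
  · have h1 := succ_mem hl h
    rw [← key _ _ h1.1 rfl]
    congr 1
    ext s
    simp only [Finset.mem_filter, and_congr_right_iff]
    intro hs
    constructor
    · exact fun h2 => h2.trans_lt h1.2.1
    · intro h2
      by_contra! h3
      exact absurd (succ_mem hs h3).2.2 (not_le.2 h2)

variable {hT : 0 < T} {P : ℕ → Finset (Time T)}

/-- The mesh condition, at arbitrary times. -/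
theorem IsRefiningPartition.succ_sub_lt (hP : IsRefiningPartition hT P) {ε : ℝ} (hε : 0 < ε) :
    ∀ᶠ n in atTop, ∀ t, (succ (P n) t : ℝ) - t < ε := by
  filter_upwards [hP.mesh ε hε] with n hn t
  have hne : ((P n).filter fun s => s ≤ t).Nonempty :=
    ⟨_, Finset.mem_filter.2 ⟨hP.zero_mem n, t₀_le hT t⟩⟩
  set r := ((P n).filter fun s => s ≤ t).max' hne with hr
  have hrm := Finset.mem_filter.1 (Finset.max'_mem _ hne)
  rw [← hr] at hrm
  by_cases h : ∃ v ∈ P n, t < v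
  · obtain ⟨v, hv, htv⟩ := h
    -- `r` is the last partition point not after `t`, so the gap that follows `t` is at most the one
    -- that follows `r`.
    have : succ (P n) t = succ (P n) r := by
      refine succ_congr hv htv fun u hu => ⟨fun h => hrm.2.trans_lt h, fun h => ?_⟩
      by_contra! h2
      exact absurd (Finset.le_max' _ _ (Finset.mem_filter.2 ⟨hu, h2⟩)) (not_le.2 h)
    rw [this]
    have h3 : (r : ℝ) ≤ t := hrm.2
    linarith [hn r hrm.1]
  · push Not at h
    rw [succ_eq_self h]
    simpa using hε

theorem IsRefiningPartition.tendsto_succ (hP : IsRefiningPartition hT P) (t : Time T) :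
    Tendsto (fun n => succ (P n) t) atTop (𝓝 t) := by
  rw [Metric.tendsto_nhds]
  intro ε hε
  filter_upwards [hP.succ_sub_lt hε] with n hn
  rw [Subtype.dist_eq, Real.dist_eq, 
    abs_of_nonneg (sub_nonneg.2 (Subtype.coe_le_coe.2 (le_succ (P n) t)))]
  exact hn t

theorem IsRefiningPartition.tendsto_psum_telescope (hP : IsRefiningPartition hT P)
    {f : Time T → ℝ} (hf : Continuous f) (t : Time T) :
    Tendsto (fun n => psum (P n) (fun s => f (succ (P n) s) - f s) t) atTop
      (𝓝 (f t - f (t₀ hT))) := by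
  simp_rw [fun n => psum_telescope hT (hP.zero_mem n) (hP.last_mem n) f t]
  exact ((hf.tendsto t).comp (hP.tendsto_succ t)).sub_const _

/-! ### Convergence of sums along partitions -/

/-- Limits of partition sums inherit local estimates of the summands. -/
theorem abs_limit_sub_le (hP : IsRefiningPartition hT P) {δ w ℓ : ℕ → Time T → ℝ}
    {ω H L : Time T → ℝ} (hω : ∀ t, Tendsto (fun n => psum (P n) (w n) t) atTop (𝓝 (ω t)))
    {l : Filter ℕ} [l.NeBot] (hl : l ≤ atTop)
    (hH : ∀ t, Tendsto (fun n => psum (P n) (δ n) t) l (𝓝 (H t)))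
    (hL : ∀ t, Tendsto (fun n => psum (P n) (ℓ n) t) atTop (𝓝 (L t))) {ε : ℝ} {r t : Time T}
    (h : ∀ᶠ n in atTop, ∀ s ∈ P n, r < s → succ (P n) s < t → |δ n s - ℓ n s| ≤ ε * w n s)
    {a b : Time T} (hra : r ≤ a) (hab : a ≤ b) (hbt : b < t) :
    |H b - H a - (L b - L a)| ≤ ε * (ω b - ω a) := by
  have h1 : Tendsto (fun n => |psum (P n) (δ n) b - psum (P n) (δ n) a
      - (psum (P n) (ℓ n) b - psum (P n) (ℓ n) a)|) l (𝓝 |H b - H a - (L b - L a)|) :=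
    (((hH b).sub (hH a)).sub (((hL b).sub (hL a)).mono_left hl)).abs
  have h2 : Tendsto (fun n => ε * (psum (P n) (w n) b - psum (P n) (w n) a)) l
      (𝓝 (ε * (ω b - ω a))) :=
    (((hω b).sub (hω a)).const_mul ε).mono_left hl
  refine le_of_tendsto_of_tendsto h1 h2 (hl ?_)
  -- Once the mesh is below `t - b`, all partition points up to `b` have their successors before
  -- `t`, where the local estimate applies.
  have hbt' : 0 < (t : ℝ) - b := sub_pos.2 hbt
  filter_upwards [h, hP.succ_sub_lt hbt'] with n hn hmesh
  have h3 := abs_psum_sub_psum_le (p := P n) (f := fun s => δ n s - ℓ n s)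
    (g := fun s => ε * w n s) hab fun s hs has hsb => by
      refine hn s hs (hra.trans_lt has) ?_
      have h4 := hmesh s
      have h5 : (s : ℝ) ≤ b := hsb
      exact Subtype.coe_lt_coe.1 (by linarith)
  rw [psum_sub, psum_sub, psum_const_mul, psum_const_mul] at h3
  rw [mul_sub]
  refine le_trans (le_of_eq ?_) h3
  congr 1; ring

/-- The coarse, global counterpart of the preceding estimate. It supplies the continuity of limits
of partition sums. -/
theorem abs_limit_sub_le_of_abs_le {δ w : ℕ → Time T → ℝ} {ω H : Time T → ℝ} {C : ℝ}
    (hω : ∀ t, Tendsto (fun n => psum (P n) (w n) t) atTop (𝓝 (ω t)))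
    (hC : ∀ᶠ n in atTop, ∀ s ∈ P n, |δ n s| ≤ C * w n s)
    {l : Filter ℕ} [l.NeBot] (hl : l ≤ atTop)
    (hH : ∀ t, Tendsto (fun n => psum (P n) (δ n) t) l (𝓝 (H t))) {a b : Time T} (hab : a ≤ b) :
    |H b - H a| ≤ C * (ω b - ω a) := by
  refine le_of_tendsto_of_tendsto ((hH b).sub (hH a)).abs
    ((((hω b).sub (hω a)).const_mul C).mono_left hl) (hl ?_)
  filter_upwards [hC] with n hn
  have h3 := abs_psum_sub_psum_le (p := P n) (f := δ n) (g := fun s => C * w n s) hab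
    fun s hs _ _ => hn s hs
  rw [psum_const_mul, psum_const_mul] at h3
  exact h3.trans_eq (by ring)

/-- A function with increments bounded by those of `ω`, and bounded with arbitrarily small
constants locally to the left, is constant. -/
theorem eq_of_abs_sub_le {φ ω : Time T → ℝ} {C : ℝ} (hω : Continuous ω)
    (hC : ∀ a b, a ≤ b → |φ b - φ a| ≤ C * (ω b - ω a))
    (hloc : ∀ t, t₀ hT < t → ∀ ε > 0, ∃ r < t, ∀ a b, r ≤ a → a ≤ b → b < t →
      |φ b - φ a| ≤ ε * (ω b - ω a)) (t : Time T) : φ t = φ (t₀ hT) := by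
  have hφ : Continuous φ := continuous_of_abs_sub_le hω hC
  have key : ∀ ε > 0, |φ t - φ (t₀ hT)| ≤ ε * ω t - ε * ω (t₀ hT) := by
    intro ε hε
    refine abs_sub_le_of_eventually_left (ω := fun t => ε * ω t) (t₀_le hT t) hφ.continuousOn
      (by fun_prop) fun u hu => ?_
    obtain ⟨r, hr, h⟩ := hloc u hu.1 ε hε
    filter_upwards [Ioo_mem_nhdsLT hr] with a ha
    -- The local estimate stops short of `u`; continuity of `φ` and `ω` extends it to the right end
    -- point.
    have : (𝓝[<] u).NeBot := nhdsLT_neBot_of_exists_lt ⟨r, hr⟩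
    have h1 : Tendsto (fun b => |φ b - φ a|) (𝓝[<] u) (𝓝 |φ u - φ a|) :=
      (((hφ.tendsto u).mono_left nhdsWithin_le_nhds).sub_const _).abs
    have h2 : Tendsto (fun b => ε * ω b - ε * ω a) (𝓝[<] u) (𝓝 (ε * ω u - ε * ω a)) :=
      (((hω.tendsto u).mono_left nhdsWithin_le_nhds).const_mul ε).sub_const _
    refine le_of_tendsto_of_tendsto h1 h2 ?_
    filter_upwards [Ioo_mem_nhdsLT ha.2] with b hb
    exact (h a b ha.1.le hb.1.le hb.2).trans_eq (by ring)
  have h0 : |φ t - φ (t₀ hT)| ≤ 0 := by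
    refine ge_of_tendsto (x := 𝓝[>] (0 : ℝ)) (f := fun ε => ε * ω t - ε * ω (t₀ hT)) ?_ ?_
    · have : ContinuousAt (fun ε : ℝ => ε * ω t - ε * ω (t₀ hT)) 0 := by fun_prop
      simpa [ContinuousAt] using this.tendsto.mono_left nhdsWithin_le_nhds
    · filter_upwards [self_mem_nhdsWithin] with ε hε using key ε hε
  exact sub_eq_zero.1 (abs_nonpos_iff.1 h0)

/-- Partition sums converge when the summands are dominated by weights whose sums converge to a
continuous function, and when, to the left of each time, they are close to summands with
convergent sums. -/
theorem exists_tendsto_psum (hP : IsRefiningPartition hT P) {δ w : ℕ → Time T → ℝ}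
    {ω : Time T → ℝ} (hωc : Continuous ω) (hω0 : ω (t₀ hT) = 0)
    (hω : ∀ t, Tendsto (fun n => psum (P n) (w n) t) atTop (𝓝 (ω t))) {C : ℝ}
    (hC : ∀ᶠ n in atTop, ∀ s ∈ P n, |δ n s| ≤ C * w n s)
    (hloc : ∀ t, t₀ hT < t → ∀ ε > 0, ∃ (ℓ : ℕ → Time T → ℝ) (L : Time T → ℝ),
      (∀ b, Tendsto (fun n => psum (P n) (ℓ n) b) atTop (𝓝 (L b))) ∧ ∃ r < t,
      ∀ᶠ n in atTop, ∀ s ∈ P n, r < s → succ (P n) s < t → |δ n s - ℓ n s| ≤ ε * w n s) :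
    ∃ H : Time T → ℝ, ∀ t, Tendsto (fun n => psum (P n) (δ n) t) atTop (𝓝 (H t)) := by
  -- The sums eventually stay in a compact interval, so they converge along every ultrafilter. What
  -- remains is that the limit does not depend on the ultrafilter.
  have hex : ∀ 𝒰 : Ultrafilter ℕ, (𝒰 : Filter ℕ) ≤ atTop → ∃ H : Time T → ℝ,
      ∀ t, Tendsto (fun n => psum (P n) (δ n) t) 𝒰 (𝓝 (H t)) := by
    intro 𝒰 h𝒰
    have : ∀ t, ∃ x, Tendsto (fun n => psum (P n) (δ n) t) 𝒰 (𝓝 x) := by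
      intro t
      have h1 : ∀ᶠ n in (𝒰 : Filter ℕ), psum (P n) (δ n) t ∈
          Icc (-(C * ω t + 1)) (C * ω t + 1) := by
        have h2 : ∀ᶠ n in atTop, C * psum (P n) (w n) t < C * ω t + 1 :=
          ((hω t).const_mul C).eventually_lt_const (by linarith)
        refine h𝒰 ?_
        filter_upwards [h2, hC] with n hn hn2
        have h3 := abs_psum_le (t := t) hn2
        rw [psum_const_mul] at h3
        exact abs_le.1 (h3.trans hn.le)
      obtain ⟨x, _, hx⟩ := isCompact_Icc.ultrafilter_le_nhds (𝒰.map _) (le_principal_iff.2 h1)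
      exact ⟨x, hx⟩
    choose H hH using this
    exact ⟨H, hH⟩
  have h𝒰0 : ((hyperfilter ℕ : Ultrafilter ℕ) : Filter ℕ) ≤ atTop := Nat.hyperfilter_le_atTop
  obtain ⟨H, hH⟩ := hex _ h𝒰0
  refine ⟨H, fun t => tendsto_iff_ultrafilter _ _ _ |>.2 fun 𝒰 h𝒰 => ?_⟩
  obtain ⟨H', hH'⟩ := hex 𝒰 h𝒰
  suffices heq : H' t - H t = 0 by
    rw [← sub_eq_zero.1 heq]
    exact hH' t
  have hat0 : ∀ (l : Filter ℕ) [l.NeBot] (F : Time T → ℝ), l ≤ atTop →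
      (∀ t, Tendsto (fun n => psum (P n) (δ n) t) l (𝓝 (F t))) → F (t₀ hT) = 0 := by
    intro l _ F hl hF
    have h1 : |F (t₀ hT)| ≤ C * ω (t₀ hT) := by
      refine le_of_tendsto_of_tendsto (hF _).abs (((hω (t₀ hT)).const_mul C).mono_left hl) (hl ?_)
      filter_upwards [hC] with n hn
      have h3 := abs_psum_le (t := t₀ hT) hn
      rwa [psum_const_mul] at h3
    rw [hω0, mul_zero] at h1
    exact abs_nonpos_iff.1 h1
  -- The comparison sums have the same limit `L` along both ultrafilters. It cancels in the
  -- difference of `H'` and `H`, whose increments are therefore locally dominated with the constant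
  -- `ε`; so the difference is constant, and it vanishes at time `0`.
  rw [eq_of_abs_sub_le (hT := hT) (φ := fun t => H' t - H t) (C := 2 * C) hωc ?_ ?_ t,
    hat0 _ H h𝒰0 hH, hat0 _ H' h𝒰 hH', sub_zero]
  · intro a b hab
    have h1 := abs_limit_sub_le_of_abs_le hω hC h𝒰0 hH hab
    have h2 := abs_limit_sub_le_of_abs_le hω hC h𝒰 hH' hab
    rw [abs_le] at *
    constructor <;> linarith [h1.1, h1.2, h2.1, h2.2]
  · intro t ht ε hε
    obtain ⟨ℓ, L, hL, r, hr, h⟩ := hloc t ht (ε / 2) (half_pos hε)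
    refine ⟨r, hr, fun a b hra hab hbt => ?_⟩
    have h1 := abs_limit_sub_le hP hω h𝒰0 hH hL h hra hab hbt
    have h2 := abs_limit_sub_le hP hω h𝒰 hH' hL h hra hab hbt
    rw [abs_le] at *
    constructor <;> linarith [h1.1, h1.2, h2.1, h2.2]

end PathwiseSPT
end

noncomputable section
namespace PathwiseSPT

variable {T : ℝ} {d m : ℕ}

/-! ### Bounded variation on the time interval -/

section Variation

variable {E : Type*} [PseudoMetricSpace E]

theorem boundedVariationOn_of_dist_le {hT : 0 < T} {f : Time T → E} {ω : Time T → ℝ}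
    (h : ∀ u v, u ≤ v → dist (f u) (f v) ≤ ω v - ω u) : BoundedVariationOn f univ := by
  have hmono : Monotone ω := fun u v huv => sub_nonneg.1 (dist_nonneg.trans (h u v huv))
  have hω : BoundedVariationOn ω univ := by
    refine (hmono.monotoneOn univ).boundedVariationOn
      (C := max |ω (t₀ hT)| |ω ⟨T, hT.le, le_rfl⟩|) fun x _ => ?_
    exact abs_le_max_abs_abs (hmono (t₀_le hT x)) (hmono x.2.2)
  refine ne_top_of_le_ne_top hω (iSup_mono fun p => Finset.sum_le_sum fun i _ => ?_)
  have hp := p.2.2.1 (Nat.le_succ i)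
  rw [edist_comm, edist_dist, edist_dist, Real.dist_eq]
  exact ENNReal.ofReal_le_ofReal ((h _ _ hp).trans (le_abs_self _))

/-- The variation of `f` over `[0, t]`. -/
def cumVar (hT : 0 < T) (f : Time T → E) (t : Time T) : ℝ :=
  variationOnFromTo f univ (t₀ hT) t

theorem dist_le_cumVar_sub (hT : 0 < T) {f : Time T → E} (hf : BoundedVariationOn f univ)
    {u v : Time T} (huv : u ≤ v) : dist (f u) (f v) ≤ cumVar hT f v - cumVar hT f u := by
  have h1 := variationOnFromTo.add hf.locallyBoundedVariationOn (mem_univ (t₀ hT)) (mem_univ u)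
    (mem_univ v)
  have h2 : dist (f u) (f v) ≤ variationOnFromTo f univ u v := by
    rw [variationOnFromTo.eq_of_le f univ huv, dist_edist]
    refine ENNReal.toReal_mono (hf.locallyBoundedVariationOn u v (mem_univ _) (mem_univ _)) ?_
    exact eVariationOn.edist_le f ⟨mem_univ _, le_rfl, huv⟩ ⟨mem_univ _, huv, le_rfl⟩
  unfold cumVar
  linarith

theorem cumVar_mono (hT : 0 < T) {f : Time T → E} (hf : BoundedVariationOn f univ) :
    Monotone (cumVar hT f) :=
  fun _ _ h => sub_nonneg.1 (dist_nonneg.trans (dist_le_cumVar_sub hT hf h))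

theorem continuous_cumVar (hT : 0 < T) {f : Time T → E} (hf : BoundedVariationOn f univ)
    (hc : Continuous f) : Continuous (cumVar hT f) := by
  rw [continuous_iff_continuousAt]
  intro t
  rw [continuousAt_iff_continuous_left'_right']
  constructor
  · have h := variationOnFromTo.tendsto_left (mem_univ (t₀ hT)) (mem_univ t)
      hf.locallyBoundedVariationOn
      (l := f t) (by rw [univ_inter]; exact (hc.tendsto t).mono_left nhdsWithin_le_nhds)
    rw [univ_inter, dist_self, sub_zero] at h
    exact h
  · exact (hf.continuousWithinAt_variationOnFromTo_Ici (a := t₀ hT)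
      hc.continuousWithinAt).mono Ioi_subset_Ici_self

end Variation

/-! ### Path spaces -/

theorem IsCadlag.mono {V V' : Set (Vec d)} {X : Path T d} (h : IsCadlag V X) (hV : V ⊆ V') :
    IsCadlag V' X :=
  ⟨fun t => hV (h.mem t), h.right, fun t => (h.left t).imp fun _ hl => ⟨hV hl.1, hl.2⟩⟩

theorem IsBV.mono {V V' : Set (Vec d)} {X : Path T d} (h : IsBV V X) (hV : V ⊆ V') : IsBV V' X :=
  ⟨h.cadlag.mono hV, h.bv⟩

theorem isCadlag_of_continuous {V : Set (Vec d)} {X : Path T d} (hX : Continuous X)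
    (hV : ∀ t, X t ∈ V) : IsCadlag V X :=
  ⟨hV, fun _ => hX.continuousWithinAt, fun t =>
    ⟨X t, hV t, (hX.tendsto t).mono_left nhdsWithin_le_nhds⟩⟩

theorem stopAt_stopAt (X : Path T d) (s t : Time T) :
    stopAt (stopAt X s) t = stopAt X (min s t) := by
  funext u
  simp only [stopAt]
  congr 1
  rw [min_assoc, min_comm t s]

theorem stopAt_stopAt_self (X : Path T d) (t : Time T) : stopAt (stopAt X t) t = stopAt X t := by
  rw [stopAt_stopAt, min_self]

theorem IsCadlag.stopAt {V : Set (Vec d)} {X : Path T d} (h : IsCadlag V X) (t : Time T) :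
    IsCadlag V (stopAt X t) := by
  refine ⟨fun u => h.mem _, fun u => ?_, fun u => ?_⟩
  · refine ContinuousWithinAt.comp (t := Ici (min u t)) (h.right (min u t))
      (by fun_prop : Continuous fun u : Time T => min u t).continuousWithinAt ?_
    intro v hv
    exact min_le_min_right t hv
  · rcases le_or_gt u t with hu | hu
    · obtain ⟨l, hl, hlim⟩ := h.left u
      refine ⟨l, hl, hlim.congr' ?_⟩
      filter_upwards [self_mem_nhdsWithin] with v hv
      simp only [PathwiseSPT.stopAt, min_eq_left ((mem_Iio.1 hv).le.trans hu)]
    · refine ⟨X t, h.mem t, tendsto_const_nhds.congr' ?_⟩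
      filter_upwards [Ioo_mem_nhdsLT hu] with v hv
      simp only [PathwiseSPT.stopAt, min_eq_right hv.1.le]

theorem IsBV.stopAt {V : Set (Vec d)} {X : Path T d} (h : IsBV V X) (t : Time T) :
    IsBV V (stopAt X t) := by
  refine ⟨h.cadlag.stopAt t, ne_top_of_le_ne_top h.bv ?_⟩
  exact eVariationOn.comp_le_of_monotoneOn X (fun u => min u t)
    (fun u _ v _ huv => min_le_min_right t huv) (fun _ _ => mem_univ _)

theorem isCadlag_bump {V V' : Set (Vec d)} {X : Path T d} (h : IsCadlag V X) (hV : V ⊆ V')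
    {t : Time T} {v : Vec d} (hv : X t + v ∈ V') : IsCadlag V' (bump X t v) := by
  have hs := h.stopAt t
  have hge : ∀ u, t ≤ u → bump X t v u = X t + v := fun u hu => by
    simp [bump, PathwiseSPT.stopAt, hu]
  have hlt : ∀ u, u < t → bump X t v u = PathwiseSPT.stopAt X t u := fun u hu => by
    simp [bump, not_le.2 hu]
  refine ⟨fun u => ?_, fun u => ?_, fun u => ?_⟩
  · rcases lt_or_ge u t with hu | hu
    · rw [hlt u hu]; exact hV (hs.mem u)
    · rwa [hge u hu]
  · rcases lt_or_ge u t with hu | hu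
    · refine (hs.right u).congr_of_eventuallyEq ?_ (hlt u hu)
      filter_upwards [mem_nhdsWithin_of_mem_nhds (Iio_mem_nhds hu)] with w hw using hlt w hw
    · refine (continuousWithinAt_const (b := X t + v)).congr (fun w hw => ?_) (hge u hu)
      exact hge w (hu.trans hw)
  · rcases le_or_gt u t with hu | hu
    · obtain ⟨l, hl, hlim⟩ := hs.left u
      refine ⟨l, hV hl, hlim.congr' ?_⟩
      filter_upwards [self_mem_nhdsWithin] with w hw
      exact (hlt w ((mem_Iio.1 hw).trans_le hu)).symm
    · refine ⟨X t + v, hv, tendsto_const_nhds.congr' ?_⟩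
      filter_upwards [Ioo_mem_nhdsLT hu] with w hw
      exact (hge w hw.1.le).symm

theorem bump_bump (X : Path T d) (t : Time T) (v w : Vec d) :
    bump (bump X t v) t w = bump X t (v + w) := by
  funext u
  simp only [bump, stopAt]
  by_cases h : t ≤ u
  · simp [h, add_assoc]
  · simp [h, le_of_not_ge h]

theorem bump_zero (X : Path T d) (t : Time T) : bump X t 0 = stopAt X t := by
  funext u
  simp [bump]

theorem bump_stopAt (X : Path T d) (t : Time T) (v : Vec d) :
    bump (stopAt X t) t v = bump X t v := by
  unfold bump
  rw [stopAt_stopAt_self]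

theorem stopAt_bump (X : Path T d) (t : Time T) (v : Vec d) :
    stopAt (bump X t v) t = bump X t v := by
  rw [← bump_zero, bump_bump, add_zero]

/-- Small vertical perturbations stay in an open set. -/
theorem eventually_isCadlag_bump {U : Set (Vec d)} (hU : IsOpen U) {X : Path T d}
    (h : IsCadlag U X) (t : Time T) : ∀ᶠ v in 𝓝 (0 : Vec d), IsCadlag U (bump X t v) := by
  have : ∀ᶠ v in 𝓝 (0 : Vec d), X t + v ∈ U := by
    have hc : ContinuousAt (fun v : Vec d => X t + v) 0 := by fun_prop
    refine hc.eventually_mem ?_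
    rw [add_zero]
    exact hU.mem_nhds (h.mem t)
  filter_upwards [this] with v hv using isCadlag_bump h subset_rfl hv

/-! ### The step paths of the discrete approximation -/

/-- The left limit `X_n^{s-}` of the discrete approximation, with a jump `v` at `s`. -/
def stepPath (p : Finset (Time T)) (X : Path T d) (s : Time T) (v : Vec d) : Path T d :=
  bump (leftApprox p X s) s v

theorem stepPath_of_lt {p : Finset (Time T)} {X : Path T d} {s u : Time T} {v : Vec d}
    (h : u < s) : stepPath p X s v u = X (succ p u) := by
  simp [stepPath, bump, stopAt, leftApprox, h.le, h, not_le.2 h]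

theorem stepPath_of_le {p : Finset (Time T)} {X : Path T d} {s u : Time T} {v : Vec d}
    (h : s ≤ u) : stepPath p X s v u = X s + v := by
  simp [stepPath, bump, stopAt, leftApprox, h]

theorem stopAt_leftApprox (p : Finset (Time T)) (X : Path T d) (s : Time T) :
    stopAt (leftApprox p X s) s = leftApprox p X s := by
  funext u
  rcases le_total u s with h | h
  · simp [stopAt, h]
  · simp [stopAt, leftApprox, h, not_lt.2 h]

theorem stepPath_zero (p : Finset (Time T)) (X : Path T d) (s : Time T) :
    stepPath p X s 0 = leftApprox p X s := by
  rw [stepPath, bump_zero, stopAt_leftApprox]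

theorem stopAt_stepPath {p : Finset (Time T)} {X : Path T d} {s u : Time T} {v : Vec d}
    (h : s ≤ u) : stopAt (stepPath p X s v) u = stepPath p X s v := by
  rw [stepPath, ← stopAt_bump, stopAt_stopAt, min_eq_left h]

/-- The only change of the approximation between `s` and its successor is the jump at `s` by the
increment of `X`. Hence an increment of a functional along the approximations splits into a vertical
move at time `s` and a horizontal one with the path frozen. -/
theorem leftApprox_succ {p : Finset (Time T)} {X : Path T d} {s : Time T} (hs : s < succ p s) :
    leftApprox p X (succ p s) = stepPath p X s (X (succ p s) - X s) := by
  funext u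
  rcases lt_or_ge u s with h | h
  · rw [stepPath_of_lt h]
    simp [leftApprox, h.trans hs]
  · rw [stepPath_of_le h, add_sub_cancel]
    by_cases h2 : u < succ p s
    · have hex : ∃ r ∈ p, s < r := by
        by_contra! hne
        exact absurd (succ_eq_self hne) hs.ne'
      obtain ⟨r, hr, hsr⟩ := hex
      have h3 := succ_mem hr hsr
      simp only [leftApprox, h2, ↓reduceIte]
      congr 1
      refine (succ_congr h3.1 hs fun w hw => ⟨fun h4 => ?_, fun h4 => h.trans_lt h4⟩).symm
      exact h2.trans_le (succ_mem hw h4).2.2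
    · simp [leftApprox, h2]

theorem isCadlag_stepPath {V : Set (Vec d)} {p : Finset (Time T)} {X : Path T d}
    (hX : ∀ t, X t ∈ V) {s : Time T} (hs : s ∈ p) {v : Vec d} (hv : X s + v ∈ V) :
    IsCadlag V (stepPath p X s v) := by
  suffices h : IsCadlag V (leftApprox p X s) by
    refine isCadlag_bump h subset_rfl ?_
    simpa [leftApprox] using hv
  have hmem : ∀ u, leftApprox p X s u ∈ V := fun u => by
    unfold leftApprox
    split_ifs <;> exact hX _
  have hge : ∀ u, s ≤ u → leftApprox p X s u = X s := fun u hu => by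
    simp [leftApprox, not_lt.2 hu]
  refine ⟨hmem, fun u => ?_, fun u => ?_⟩
  · have h : ∀ᶠ w in 𝓝[≥] u, leftApprox p X s w = leftApprox p X s u := by
      rcases lt_or_ge u s with hu | hu
      · have h1 : ∀ᶠ w in 𝓝[≥] u, ∀ r ∈ p, u < r ↔ w < r := by
          rw [Finset.eventually_all]
          intro r _
          rcases lt_or_ge u r with hr | hr
          · filter_upwards [mem_nhdsWithin_of_mem_nhds (Iio_mem_nhds hr)] with w hw
            simp [hr, mem_Iio.1 hw]
          · filter_upwards [self_mem_nhdsWithin] with w hw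
            simp [not_lt.2 hr, not_lt.2 (hr.trans hw)]
        filter_upwards [h1, mem_nhdsWithin_of_mem_nhds (Iio_mem_nhds hu)] with w hw hws
        simp only [leftApprox, hu, mem_Iio.1 hws, ↓reduceIte]
        rw [succ_congr hs hu hw]
      · filter_upwards [self_mem_nhdsWithin] with w hw
        rw [hge w (hu.trans hw), hge u hu]
    exact tendsto_const_nhds.congr' (h.mono fun w hw => hw.symm)
  · rcases le_or_gt u s with hu | hu
    · rcases eq_or_neBot (𝓝[<] u) with hbot | hne
      · exact ⟨X s, hX s, by rw [hbot]; exact tendsto_bot⟩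
      have h1 : ∀ᶠ w in 𝓝[<] u, ∀ r ∈ p, u ≤ r ↔ w < r := by
        rw [Finset.eventually_all]
        intro r _
        rcases le_or_gt u r with hr | hr
        · filter_upwards [self_mem_nhdsWithin] with w hw
          simp [hr, (mem_Iio.1 hw).trans_le hr]
        · filter_upwards [Ioo_mem_nhdsLT hr] with w hw
          simp [not_le.2 hr, not_lt.2 hw.1.le]
      obtain ⟨w₀, hw₀, hw₀u⟩ := (h1.and self_mem_nhdsWithin).exists
      refine ⟨X (succ p w₀), hX _, tendsto_const_nhds.congr' ?_⟩
      filter_upwards [h1, self_mem_nhdsWithin] with w hw hwu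
      have hws : w < s := (mem_Iio.1 hwu).trans_le hu
      simp only [leftApprox, hws, ↓reduceIte]
      rw [succ_congr hs ((mem_Iio.1 hw₀u).trans_le hu) fun r hr => (hw₀ r hr).symm.trans (hw r hr)]
    · refine ⟨X s, hX s, tendsto_const_nhds.congr' ?_⟩
      filter_upwards [Ioo_mem_nhdsLT hu] with w hw
      exact (hge w hw.1.le).symm

/-! ### Uniform closeness -/

theorem exists_norm_sub_lt {X : Path T d} (hX : Continuous X) {η : ℝ} (hη : 0 < η) :
    ∃ ρ > 0, ∀ u v : Time T, |(u : ℝ) - v| < ρ → ‖X u - X v‖ < η := by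
  have h := CompactSpace.uniformContinuous_of_continuous hX
  obtain ⟨ρ, hρ, h⟩ := Metric.uniformContinuous_iff.1 h η hη
  exact ⟨ρ, hρ, fun u v huv => by
    rw [← dist_eq_norm]
    exact h (by rwa [Subtype.dist_eq, Real.dist_eq])⟩

theorem abs_min_sub_min_le (u s t : Time T) :
    |((min u t : Time T) : ℝ) - (min u s : Time T)| ≤ |(t : ℝ) - s| := by
  have h : ∀ a b : Time T, ((min a b : Time T) : ℝ) = min (a : ℝ) b := fun a b => by
    rcases le_total a b with h | h
    · rw [min_eq_left h, min_eq_left (Subtype.coe_le_coe.2 h)]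
    · rw [min_eq_right h, min_eq_right (Subtype.coe_le_coe.2 h)]
  rw [h, h]
  refine (abs_min_sub_min_le_max _ _ _ _).trans ?_
  simp

theorem exists_stopAt_close {A : Path T m} (hA : Continuous A) {η : ℝ} (hη : 0 < η) :
    ∃ ρ > 0, ∀ s t : Time T, |(t : ℝ) - s| < ρ → ∀ u, ‖stopAt A t u - stopAt A s u‖ < η := by
  obtain ⟨ρ, hρ, h⟩ := exists_norm_sub_lt hA hη
  exact ⟨ρ, hρ, fun s t hst u => h _ _ ((abs_min_sub_min_le u s t).trans_lt hst)⟩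

variable {hT : 0 < T} {P : ℕ → Finset (Time T)}

/-- Uniform continuity of `X`: the mesh and the difference of the times displace its argument only
slightly, and half of `η` is kept for the jump. Fractional jumps `θ` are included because the Taylor
expansion runs through them. -/
theorem exists_stepPath_close (hP : IsRefiningPartition hT P) {X : Path T d} (hX : Continuous X)
    {η : ℝ} (hη : 0 < η) : ∃ ρ > 0, ∀ᶠ n in atTop, ∀ s t : Time T, |(t : ℝ) - s| < ρ →
      ∀ θ ∈ Icc (0 : ℝ) 1, ∀ u,
        ‖stopAt X t u - stepPath (P n) X s (θ • (X (succ (P n) s) - X s)) u‖ < η := by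
  obtain ⟨ρ, hρ, h⟩ := exists_norm_sub_lt hX (half_pos hη)
  refine ⟨ρ / 2, half_pos hρ, ?_⟩
  filter_upwards [hP.succ_sub_lt (half_pos hρ)] with n hn s t hst θ hθ u
  have hss := le_succ (P n) s
  rcases lt_or_ge u s with hu | hu
  · rw [stepPath_of_lt hu]
    refine (h _ _ ?_).trans (half_lt_self hη)
    have h1 := abs_min_sub_min_le u s t
    rw [min_eq_left hu.le] at h1
    have h2 : (u : ℝ) ≤ succ (P n) u := le_succ (P n) u
    have h3 := hn u
    rw [abs_lt] at *
    rw [abs_le] at h1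
    constructor <;> linarith [h1.1, h1.2, hst.1, hst.2, neg_abs_le ((t : ℝ) - s),
      abs_lt.2 hst]
  · rw [stepPath_of_le hu]
    have h1 := abs_min_sub_min_le u s t
    rw [min_eq_right hu] at h1
    have h2 : ‖X (min u t) - X s‖ < η / 2 := h _ _ (by linarith)
    have h3 : ‖X (succ (P n) s) - X s‖ < η / 2 := by
      refine h _ _ ?_
      rw [abs_of_nonneg (sub_nonneg.2 (Subtype.coe_le_coe.2 hss))]
      linarith [hn s]
    have h4 : ‖θ • (X (succ (P n) s) - X s)‖ ≤ ‖X (succ (P n) s) - X s‖ := by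
      rw [norm_smul, Real.norm_of_nonneg hθ.1]
      exact mul_le_of_le_one_left (norm_nonneg _) hθ.2
    calc ‖stopAt X t u - (X s + θ • (X (succ (P n) s) - X s))‖
        = ‖(X (min u t) - X s) - θ • (X (succ (P n) s) - X s)‖ := by
          rw [stopAt]; congr 1; abel
      _ ≤ _ := norm_sub_le _ _
      _ < η := by linarith

/-- The step paths eventually stay in a compact neighbourhood of the range of `X`. -/
theorem eventually_isCadlag_stepPath (hP : IsRefiningPartition hT P) {X : Path T d}
    (hX : Continuous X) {r : ℝ} (hr : 0 < r) : ∀ᶠ n in atTop, ∀ s ∈ P n, ∀ θ ∈ Icc (0 : ℝ) 1,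
      IsCadlag (Metric.cthickening r (range X))
        (stepPath (P n) X s (θ • (X (succ (P n) s) - X s))) := by
  obtain ⟨ρ, hρ, h⟩ := exists_stepPath_close hP hX hr
  filter_upwards [h] with n hn s hs θ hθ
  refine isCadlag_stepPath (fun t => Metric.self_subset_cthickening _ (mem_range_self t)) hs ?_
  have h1 := hn s s (by simpa using hρ) θ hθ s
  rw [stepPath_of_le le_rfl, ← dist_eq_norm, dist_comm] at h1
  exact Metric.mem_cthickening_of_dist_le _ (X s) _ _ (mem_range_self s)
    (by simpa [stopAt] using h1.le)

theorem exists_cthickening_range_subset {U : Set (Vec d)} (hU : IsOpen U) {X : Path T d}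
    (hX : Continuous X) (hXU : ∀ t, X t ∈ U) :
    ∃ r > 0, IsCompact (Metric.cthickening r (range X)) ∧ Metric.cthickening r (range X) ⊆ U := by
  have hc : IsCompact (range X) := isCompact_range hX
  obtain ⟨r, hr, h⟩ := hc.exists_cthickening_subset_open hU (range_subset_iff.2 hXU)
  exact ⟨r, hr, hc.cthickening, h⟩

end PathwiseSPT
end

noncomputable section
namespace PathwiseSPT

variable {T : ℝ} {d m : ℕ}

/-! ### Second order expansion in the vertical direction -/

/-- The mean value inequality is applied twice, to `h'` minus a linear and to `h` minus a quadratic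
function. No integral remainder occurs, so nothing is asked of the dependence of `h''` on `θ` beyond
the bound. -/
theorem abs_taylor_two_le {h h' h'' : ℝ → ℝ} {L ε : ℝ}
    (hh : ∀ θ ∈ Icc (0 : ℝ) 1, HasDerivAt h (h' θ) θ)
    (hh' : ∀ θ ∈ Icc (0 : ℝ) 1, HasDerivAt h' (h'' θ) θ)
    (hb : ∀ θ ∈ Icc (0 : ℝ) 1, |h'' θ - L| ≤ ε) :
    |h 1 - h 0 - h' 0 - L / 2| ≤ ε := by
  have h1 : ∀ θ ∈ Icc (0 : ℝ) 1, |h' θ - h' 0 - L * θ| ≤ ε := by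
    intro θ hθ
    have := norm_image_sub_le_of_norm_deriv_le_segment' (f := fun θ => h' θ - L * θ)
      (f' := fun θ => h'' θ - L) (C := ε) (a := 0) (b := 1)
      (fun x hx => ((hh' x hx).sub (((hasDerivAt_id x).const_mul L).congr_deriv
        (mul_one L))).hasDerivWithinAt)
      (fun x hx => hb x ⟨hx.1, hx.2.le⟩) θ hθ
    rw [Real.norm_eq_abs] at this
    have h0 : 0 ≤ ε := (abs_nonneg _).trans (hb θ hθ)
    calc |h' θ - h' 0 - L * θ| = |h' θ - L * θ - (h' 0 - L * 0)| := by congr 1; ring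
      _ ≤ ε * (θ - 0) := this
      _ ≤ ε := by nlinarith [hθ.2]
  have := norm_image_sub_le_of_norm_deriv_le_segment_01'
    (f := fun θ => h θ - h' 0 * θ - L / 2 * θ ^ 2)
    (f' := fun θ => h' θ - h' 0 - L * θ) (C := ε)
    (fun x hx => by
      have h2 := ((hh x hx).sub ((hasDerivAt_id x).const_mul (h' 0))).sub
        ((hasDerivAt_pow 2 x).const_mul (L / 2))
      refine (h2.congr_deriv ?_).hasDerivWithinAt
      simp
      ring)
    (fun x hx => h1 x ⟨hx.1, hx.2.le⟩)
  rw [Real.norm_eq_abs] at this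
  refine le_trans (le_of_eq ?_) this
  congr 1
  ring

/-- Differentiability at `0` holds at every admissible path, and bumps at the same time add up.
Taking `bump X t (θ • v)` as base path thus gives the derivative at `θ`, and total differentiability
expresses it through the partial derivatives. -/
theorem IsVerticallyDifferentiable.hasDerivAt {U : Set (Vec d)} {W : Set (Vec m)}
    {F : Functional T d m} (hF : IsVerticallyDifferentiable U W F) {t : Time T} {X : Path T d}
    {A : Path T m} (hA : IsBV W A) (v : Vec d) {θ : ℝ} (hX : IsCadlag U (bump X t (θ • v))) :
    HasDerivAt (fun θ : ℝ => F t (bump X t (θ • v)) A)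
      (∑ i, vDeriv F i t (bump X t (θ • v)) A * v i) θ := by
  set Y := bump X t (θ • v) with hY
  have hd : HasFDerivAt (fun w : Vec d => F t (bump Y t w) A)
      (fderiv ℝ (fun w : Vec d => F t (bump Y t w) A) 0) 0 := (hF t Y A hX hA).hasFDerivAt
  set L := fderiv ℝ (fun w : Vec d => F t (bump Y t w) A) 0
  have hline : ∀ w : Vec d, HasDerivAt (fun τ : ℝ => F t (bump Y t (τ • w)) A) (L w) 0 := by
    intro w
    have h1 : HasDerivAt (fun τ : ℝ => τ • w) w 0 := by
      simpa using (hasDerivAt_id (0 : ℝ)).smul_const w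
    exact HasFDerivAt.comp_hasDerivAt_of_eq (0 : ℝ) hd h1 (by simp)
  have hpart : ∀ i, L (EuclideanSpace.single i 1) = vDeriv F i t Y A := by
    intro i
    rw [vDeriv, ← (hline (EuclideanSpace.single i 1)).deriv]
    congr 1
    funext τ
    congr 2
    ext j
    simp
  have hL : L v = ∑ i, vDeriv F i t Y A * v i := by
    have hv : v = ∑ i, v i • EuclideanSpace.single i (1 : ℝ) := by
      ext j
      simp [Pi.single_apply]
    conv_lhs => rw [hv]
    rw [map_sum]
    refine Finset.sum_congr rfl fun i _ => ?_
    rw [map_smul, hpart, smul_eq_mul, mul_comm]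
  rw [← hL]
  have h2 := HasDerivAt.comp_sub_const θ θ (f := fun τ : ℝ => F t (bump Y t (τ • v)) A)
    (by rw [sub_self]; exact hline v)
  refine h2.congr_of_eventuallyEq (Eventually.of_forall fun τ => ?_)
  simp only [hY, bump_bump, ← add_smul, add_sub_cancel]

/-- Second order expansion of a functional in the vertical direction. -/
theorem abs_vertical_expansion_le {U : Set (Vec d)} {W : Set (Vec m)} {F : Functional T d m}
    (hF : IsVerticallyDifferentiable U W F)
    (hF' : ∀ i, IsVerticallyDifferentiable U W (vDeriv F i)) {t : Time T} {X : Path T d}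
    {A : Path T m} (hA : IsBV W A) {v : Vec d}
    (hX : ∀ θ ∈ Icc (0 : ℝ) 1, IsCadlag U (bump X t (θ • v))) {c : Fin d → Fin d → ℝ} {ε : ℝ}
    (hc : ∀ θ ∈ Icc (0 : ℝ) 1, ∀ i j,
      |vDeriv (vDeriv F j) i t (bump X t (θ • v)) A - c i j| ≤ ε) :
    |F t (bump X t v) A - F t (bump X t 0) A - ∑ i, vDeriv F i t (bump X t 0) A * v i
      - ∑ i, ∑ j, c i j / 2 * (v i * v j)| ≤ ε * (d * ∑ i, v i ^ 2) := by
  have hT := abs_taylor_two_le (h := fun θ : ℝ => F t (bump X t (θ • v)) A)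
    (h' := fun θ => ∑ j, vDeriv F j t (bump X t (θ • v)) A * v j)
    (h'' := fun θ => ∑ j, (∑ i, vDeriv (vDeriv F j) i t (bump X t (θ • v)) A * v i) * v j)
    (L := ∑ j, (∑ i, c i j * v i) * v j) (ε := ε * (d * ∑ i, v i ^ 2))
    (fun θ hθ => hF.hasDerivAt hA v (hX θ hθ))
    (fun θ hθ => HasDerivAt.fun_sum fun j _ => ((hF' j).hasDerivAt hA v (hX θ hθ)).mul_const _)
    (fun θ hθ => by
      rw [← Finset.sum_sub_distrib]
      simp_rw [← sub_mul, ← Finset.sum_sub_distrib, ← sub_mul]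
      -- `hc` forces `ε` to be nonnegative only if there is an index.
      have hε : 0 ≤ ε ∨ d = 0 := by
        rcases Nat.eq_zero_or_pos d with h | h
        · exact Or.inr h
        · exact Or.inl ((abs_nonneg _).trans (hc θ hθ ⟨0, h⟩ ⟨0, h⟩))
      rcases hε with hε | rfl
      swap
      · simp
      calc _ ≤ ∑ j, ∑ i, ε * (|v i| * |v j|) := by
            refine (Finset.abs_sum_le_sum_abs _ _).trans (Finset.sum_le_sum fun j _ => ?_)
            rw [Finset.sum_mul]
            refine (Finset.abs_sum_le_sum_abs _ _).trans (Finset.sum_le_sum fun i _ => ?_)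
            rw [abs_mul, abs_mul, mul_assoc]
            exact mul_le_mul_of_nonneg_right (hc θ hθ i j) (by positivity)
        _ = ε * (∑ i, |v i|) ^ 2 := by
            rw [sq, Finset.sum_mul_sum, Finset.sum_comm, Finset.mul_sum]
            simp_rw [Finset.mul_sum]
        _ ≤ ε * (d * ∑ i, v i ^ 2) := by
            -- The factor `d` comes from the Cauchy–Schwarz inequality.
            refine mul_le_mul_of_nonneg_left ?_ hε
            have := sq_sum_le_card_mul_sum_sq (s := (Finset.univ : Finset (Fin d)))
              (f := fun i => |v i|)
            simpa using this)
  simp only [one_smul, zero_smul] at hT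
  refine le_trans (le_of_eq ?_) hT
  congr 2
  rw [Finset.sum_comm, Finset.sum_div]
  refine Finset.sum_congr rfl fun j _ => ?_
  rw [Finset.sum_mul, Finset.sum_div]
  exact Finset.sum_congr rfl fun i _ => by ring

end PathwiseSPT
end

noncomputable section
namespace PathwiseSPT

variable {T : ℝ} {d m : ℕ}

/-! ### Clocks that advance one at a time -/

/-- The function that increases from `0` to `1` on `[0, 1]` and is constant elsewhere. -/
def ramp (x : ℝ) : ℝ := max 0 (min 1 x)

theorem ramp_of_nonpos {x : ℝ} (h : x ≤ 0) : ramp x = 0 :=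
  max_eq_left ((min_le_right _ _).trans h)

theorem ramp_of_one_le {x : ℝ} (h : 1 ≤ x) : ramp x = 1 := by
  rw [ramp, min_eq_left h, max_eq_right zero_le_one]

/-- The `j`-th of `M` clocks: on each of the intervals `[i, i + 1]`, `i < N`, it moves from `i` to
`i + 1`, and does so during `[i + j / M, i + (j + 1) / M]`. -/
def clock (N M j : ℕ) (x : ℝ) : ℝ := ∑ i ∈ Finset.range N, ramp (M * (x - i) - j)

theorem clock_mono (N M j : ℕ) : Monotone (clock N M j) := fun x y h =>
  Finset.sum_le_sum fun i _ => max_le_max le_rfl (min_le_min le_rfl (by gcongr))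

theorem continuous_clock (N M j : ℕ) : Continuous (clock N M j) := by
  unfold clock ramp
  fun_prop

theorem clock_nonneg (N M j : ℕ) (x : ℝ) : 0 ≤ clock N M j x :=
  Finset.sum_nonneg fun _ _ => le_max_left _ _

theorem clock_le (N M j : ℕ) (x : ℝ) : clock N M j x ≤ N := by
  refine (Finset.sum_le_card_nsmul _ _ 1 fun i _ => ?_).trans_eq (by simp)
  exact max_le zero_le_one (min_le_left _ _)

theorem clock_natCast {N M j : ℕ} (hj : j < M) {n : ℕ} (hn : n ≤ N) : clock N M j n = n := by
  have h : ∀ i ∈ Finset.range N, ramp (M * ((n : ℝ) - i) - j) = if i < n then 1 else 0 := by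
    intro i _
    have hj' : (j : ℝ) + 1 ≤ M := by exact_mod_cast hj
    split_ifs with hi
    · have : (i : ℝ) + 1 ≤ n := by exact_mod_cast hi
      exact ramp_of_one_le (by nlinarith [(Nat.cast_nonneg j : (0 : ℝ) ≤ j)])
    · have : (n : ℝ) ≤ i := by exact_mod_cast not_lt.1 hi
      exact ramp_of_nonpos (by nlinarith [(Nat.cast_nonneg j : (0 : ℝ) ≤ j)])
  rw [clock, Finset.sum_congr rfl h, Finset.sum_ite, Finset.sum_const_zero, add_zero,
    Finset.sum_const, nsmul_one]
  congr 1
  have : (Finset.range N).filter (fun i => i < n) = Finset.range n := by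
    ext i
    simp only [Finset.mem_filter, Finset.mem_range]
    omega
  rw [this, Finset.card_range]

/-- Clocks are monotone and exact at integers, so in between they are off by at most one. -/
theorem abs_clock_sub_le {N M j : ℕ} (hj : j < M) {x : ℝ} (h0 : 0 ≤ x) (hN : x ≤ N) :
    |clock N M j x - x| ≤ 1 := by
  have h1 := Nat.floor_le h0
  have h2 := Nat.lt_floor_add_one x
  have h3 : ⌊x⌋₊ ≤ N := Nat.floor_le_of_le hN
  have h4 : (⌊x⌋₊ : ℝ) ≤ clock N M j x := by
    rw [← clock_natCast hj h3]
    exact clock_mono N M j h1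
  have h5 : clock N M j x ≤ ⌊x⌋₊ + 1 := by
    rcases h3.eq_or_lt with h | h
    · rw [h]
      exact (clock_le N M j x).trans (by linarith)
    · have := clock_natCast hj (Nat.succ_le_of_lt h)
      rw [Nat.cast_succ] at this
      rw [← this]
      exact clock_mono N M j h2.le
  rw [abs_le]
  constructor <;> linarith

/-- In units of `1 / M` the clocks take turns: the `i`-th ramp of clock `j` moves only in the slot
numbered `M * i + j`. If `M * x` lies in `(l, l + 1]`, then only the clock `l % M` can move just
before `x`. -/
theorem exists_clock_eq {N M : ℕ} (hM : 0 < M) {x : ℝ} (hx : 0 < x) : ∃ k : ℕ, ∃ y₀ < x,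
    ∀ y, y₀ < y → y ≤ x → ∀ j, j < M → j ≠ k → clock N M j y = clock N M j x := by
  have hM' : (0 : ℝ) < M := by exact_mod_cast hM
  have hpos : 0 < (M : ℝ) * x := by positivity
  obtain ⟨l, hl⟩ : ∃ l : ℕ, ⌈(M : ℝ) * x⌉₊ = l + 1 :=
    Nat.exists_eq_succ_of_ne_zero (Nat.ceil_pos.2 hpos).ne'
  have h1 : (M : ℝ) * x ≤ l + 1 := by
    have := Nat.le_ceil ((M : ℝ) * x)
    rwa [hl, Nat.cast_succ] at this
  have h2 : (l : ℝ) < M * x := by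
    have := Nat.ceil_lt_add_one hpos.le
    rw [hl, Nat.cast_succ] at this
    linarith
  refine ⟨l % M, l / M, by rwa [div_lt_iff₀ hM', mul_comm], fun y hy hyx j hj hjl => ?_⟩
  rw [div_lt_iff₀ hM', mul_comm] at hy
  have hyx' : (M : ℝ) * y ≤ M * x := by gcongr
  refine Finset.sum_congr rfl fun i _ => ?_
  have hne : M * i + j ≠ l := by
    intro h
    apply hjl
    rw [← h, Nat.mul_add_mod, Nat.mod_eq_of_lt hj]
  rcases lt_or_gt_of_ne hne with h | h
  · have h3 : (M : ℝ) * i + j + 1 ≤ l := by exact_mod_cast h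
    rw [ramp_of_one_le (by linarith), ramp_of_one_le (by linarith)]
  · have h3 : (l : ℝ) + 1 ≤ M * i + j := by exact_mod_cast h
    rw [ramp_of_nonpos (by linarith), ramp_of_nonpos (by linarith)]

/-- There are time changes uniformly close to the identity such that, to the left of each time, at
most one of them moves. -/
theorem exists_clocks (hT : 0 < T) (m : ℕ) {ρ : ℝ} (hρ : 0 < ρ) :
    ∃ τ : Fin m → Time T → Time T, (∀ k, Monotone (τ k)) ∧ (∀ k, Continuous (τ k)) ∧
      (∀ k (u : Time T), |(u : ℝ) - τ k u| < ρ) ∧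
      ∀ u, t₀ hT < u → ∃ k : ℕ, ∀ᶠ r in 𝓝[<] u, ∀ j : Fin m, (j : ℕ) ≠ k → τ j r = τ j u := by
  -- A full turn of all clocks takes time `T / N < ρ`. There are `m + 1` clocks, so that there is
  -- one even for `m = 0`; the extra clock drives no component.
  obtain ⟨N, hN⟩ := exists_nat_gt (T / ρ)
  have hN0 : (0 : ℝ) < N := (div_pos hT hρ).trans hN
  have hmem : ∀ (k : Fin m) (u : Time T),
      clock N (m + 1) k (u * (N / T)) * (T / N) ∈ Icc (0 : ℝ) T := by
    intro k u
    refine ⟨mul_nonneg (clock_nonneg _ _ _ _) (by positivity), ?_⟩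
    calc _ ≤ (N : ℝ) * (T / N) := by gcongr; exact clock_le _ _ _ _
      _ = T := by field_simp
  refine ⟨fun k u => ⟨_, hmem k u⟩, fun k u v huv => ?_, fun k => ?_, fun k u => ?_,
    fun u hu => ?_⟩
  · have : (u : ℝ) ≤ v := huv
    refine Subtype.mk_le_mk.2 ?_
    gcongr
    exact clock_mono _ _ _ (by gcongr)
  · refine Continuous.subtype_mk ?_ _
    exact ((continuous_clock _ _ _).comp (by fun_prop)).mul continuous_const
  · have h1 : 0 ≤ (u : ℝ) * (N / T) := mul_nonneg u.2.1 (by positivity)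
    have h2 : (u : ℝ) * (N / T) ≤ N := by
      calc (u : ℝ) * (N / T) ≤ T * (N / T) := by gcongr; exact u.2.2
        _ = N := by field_simp
    have h3 := abs_clock_sub_le (j := k) (M := m + 1) (by omega) h1 h2
    have h4 : (u : ℝ) = u * (N / T) * (T / N) := by field_simp
    calc |(u : ℝ) - clock N (m + 1) k (u * (N / T)) * (T / N)|
        = |clock N (m + 1) k (u * (N / T)) - u * (N / T)| * (T / N) := by
          rw [← abs_of_pos (div_pos hT hN0), ← abs_mul, abs_sub_comm,
            abs_of_pos (div_pos hT hN0), sub_mul, ← h4]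
      _ ≤ 1 * (T / N) := by gcongr
      _ < ρ := by rwa [one_mul, div_lt_iff₀ hN0, mul_comm, ← div_lt_iff₀ hρ]
  · have hu' : 0 < (u : ℝ) * (N / T) := mul_pos hu (by positivity)
    obtain ⟨k, y₀, hy₀, h⟩ := exists_clock_eq (N := N) (M := m + 1) (by omega) hu'
    refine ⟨k, ?_⟩
    have hc : ContinuousAt (fun r : Time T => (r : ℝ) * (N / T)) u := by fun_prop
    filter_upwards [self_mem_nhdsWithin,
      mem_nhdsWithin_of_mem_nhds (hc.eventually_const_lt hy₀)] with r hr hr2 j hj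
    refine Subtype.ext ?_
    have hru : (r : ℝ) ≤ u := (mem_Iio.1 hr).le
    simp only
    rw [h _ hr2 (by gcongr) j (by omega) hj]

/-! ### Increments in the horizontal direction -/

theorem norm_le_sum_abs (x : Vec d) : ‖x‖ ≤ ∑ i, |x i| := by
  have hx : x = ∑ i, x i • EuclideanSpace.single i (1 : ℝ) := by
    ext j
    simp [Pi.single_apply]
  conv_lhs => rw [hx]
  refine (norm_sum_le _ _).trans (Finset.sum_le_sum fun i _ => ?_)
  simp [norm_smul]

theorem abs_apply_sub_le (x y : Vec d) (i : Fin d) : |x i - y i| ≤ ‖x - y‖ := by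
  simpa using PiLp.norm_apply_le (x - y) i

/-- The path whose components run according to the clocks `τ`. -/
def timeChange (A : Path T m) (τ : Fin m → Time T → Time T) : Path T m :=
  fun u => WithLp.toLp 2 fun k => A (τ k u) k

theorem continuous_timeChange {A : Path T m} (hA : Continuous A) {τ : Fin m → Time T → Time T}
    (hτ : ∀ k, Continuous (τ k)) : Continuous (timeChange A τ) := by
  refine (PiLp.continuous_toLp 2 _).comp (continuous_pi fun k => ?_)
  exact (EuclideanSpace.proj k).continuous.comp (hA.comp (hτ k))

theorem abs_timeChange_sub_le (hT : 0 < T) {A : Path T m} (hA : BoundedVariationOn A univ)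
    {τ : Fin m → Time T → Time T} (hτ : ∀ k, Monotone (τ k)) {u v : Time T} (huv : u ≤ v)
    (k : Fin m) : |timeChange A τ v k - timeChange A τ u k| ≤
      cumVar hT A (τ k v) - cumVar hT A (τ k u) := by
  refine (abs_apply_sub_le (A (τ k v)) (A (τ k u)) k).trans ?_
  rw [← dist_eq_norm, dist_comm]
  exact dist_le_cumVar_sub hT hA (hτ k huv)

theorem boundedVariationOn_timeChange (hT : 0 < T) {A : Path T m}
    (hA : BoundedVariationOn A univ) {τ : Fin m → Time T → Time T} (hτ : ∀ k, Monotone (τ k)) :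
    BoundedVariationOn (timeChange A τ) univ := by
  refine boundedVariationOn_of_dist_le (hT := hT) (ω := fun u => ∑ k, cumVar hT A (τ k u))
    fun u v huv => ?_
  rw [dist_comm, dist_eq_norm, ← Finset.sum_sub_distrib]
  refine (norm_le_sum_abs _).trans (Finset.sum_le_sum fun k _ => ?_)
  exact abs_timeChange_sub_le hT hA hτ huv k

theorem exists_norm_sub_timeChange_lt {A : Path T m} (hA : Continuous A) {η : ℝ} (hη : 0 < η) :
    ∃ ρ > 0, ∀ τ : Fin m → Time T → Time T, (∀ k (u : Time T), |(u : ℝ) - τ k u| < ρ) →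
      ∀ u, ‖A u - timeChange A τ u‖ < η := by
  obtain ⟨ρ, hρ, h⟩ := exists_norm_sub_lt hA (div_pos hη (Nat.cast_add_one_pos m))
  refine ⟨ρ, hρ, fun τ hτ u => ?_⟩
  calc ‖A u - timeChange A τ u‖ ≤ ∑ k, |(A u - timeChange A τ u) k| := norm_le_sum_abs _
    _ ≤ ∑ _k : Fin m, η / (m + 1) := Finset.sum_le_sum fun k _ =>
        (abs_apply_sub_le (A u) (A (τ k u)) k).trans (h _ _ (hτ k u)).le
    _ = m * (η / (m + 1)) := by simp
    _ < η := by
      rw [mul_div_assoc', div_lt_iff₀ (Nat.cast_add_one_pos m)]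
      linarith

/-- With `Y` frozen after `s`, only time and the continuous path `B` vary. This provides the
continuity needed by the one-sided mean value inequality. -/
theorem continuousOn_of_stopped {U : Set (Vec d)} {W : Set (Vec m)} {G : Functional T d m}
    (hG : IsContinuousFunctional U W G) {Y : Path T d} (hY : IsCadlag U Y) {B : Path T m}
    (hB : IsBV W B) (hBc : Continuous B) {s s' : Time T}
    (hYs : ∀ u, s ≤ u → stopAt Y u = Y) : ContinuousOn (fun u => G u Y B) (Icc s s') := by
  intro u hu
  rw [ContinuousWithinAt, Metric.tendsto_nhds]
  intro ε hε
  obtain ⟨η, hη, h⟩ := hG ε hε u Y B hY hB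
  obtain ⟨ρ, hρ, h2⟩ := exists_stopAt_close hBc hη
  have hball : ∀ᶠ v in 𝓝[Icc s s'] u, dist v u < min η ρ :=
    mem_nhdsWithin_of_mem_nhds (Metric.ball_mem_nhds u (lt_min hη hρ))
  filter_upwards [hball, self_mem_nhdsWithin] with v hv hvs
  rw [Subtype.dist_eq, dist_comm, Real.dist_eq] at hv
  rw [dist_comm, Real.dist_eq]
  refine h v Y B hY hB ⟨hv.trans_le (min_le_left _ _), fun w => ?_,
    h2 v u (hv.trans_le (min_le_right _ _))⟩
  rw [hYs u hu.1, hYs v hvs.1, sub_self, norm_zero]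
  exact hη

section Horizontal

variable {U : Set (Vec d)} {W : Set (Vec m)} {G D₀ : Functional T d m} {D : Fin m → Functional T d m}

/-- Increments of a functional along paths, one component of which moves at a time. -/
theorem abs_horizontal_timeChange_le (hT : 0 < T) (hGn : IsNonAnticipative U W G)
    (hGc : IsContinuousFunctional U W G) (hD₀ : IsTimeDerivative U W G D₀)
    (hD : ∀ k, IsHorizontalDerivative U W k G (D k)) {Y : Path T d} (hY : IsCadlag U Y)
    {A : Path T m} (hAc : Continuous A) (hA : BoundedVariationOn A univ)
    {τ : Fin m → Time T → Time T} (hτ : ∀ k, Monotone (τ k)) (hτc : ∀ k, Continuous (τ k))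
    (hτ1 : ∀ u, t₀ hT < u → ∃ k : ℕ, ∀ᶠ r in 𝓝[<] u, ∀ j : Fin m, (j : ℕ) ≠ k → τ j r = τ j u)
    (hB : IsBV W (timeChange A τ)) {s s' : Time T} (hss : s ≤ s')
    (hYs : ∀ u, s ≤ u → stopAt Y u = Y) {ε : ℝ} (hε : 0 < ε) {c₀ : ℝ} {c : Fin m → ℝ}
    (hc₀ : ∀ u, s < u → u ≤ s' → |D₀ u Y (timeChange A τ) - c₀| ≤ ε)
    (hc : ∀ u, s < u → u ≤ s' → ∀ k, |D k u Y (timeChange A τ) - c k| ≤ ε) :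
    |G s' Y (timeChange A τ) - G s Y (timeChange A τ) - c₀ * ((s' : ℝ) - s)
        - ∑ k, c k * (timeChange A τ s' k - timeChange A τ s k)|
      ≤ 2 * ε * (((s' : ℝ) - s) + ∑ k, (cumVar hT A (τ k s') - cumVar hT A (τ k s))) := by
  set B := timeChange A τ with hBdef
  have hBc : Continuous B := continuous_timeChange hAc hτc
  have hBk : ∀ k, Continuous fun u => B u k := fun k => by
    have h := (EuclideanSpace.proj (𝕜 := ℝ) k).continuous.comp hBc
    exact h
  have hV := continuous_cumVar hT hA hAc
  -- With the linear terms subtracted from `G`, it is enough to estimate increments immediately to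
  -- the left of each `u`, where at most one component of `B` moves.
  have key := abs_sub_le_of_eventually_left
    (φ := fun u : Time T => G u Y B - c₀ * u - ∑ k, c k * B u k)
    (ω := fun u : Time T => 2 * ε * ((u : ℝ) + ∑ k, cumVar hT A (τ k u))) hss
    (((continuousOn_of_stopped hGc hY hB hBc hYs).sub
      (by fun_prop : Continuous fun u : Time T => c₀ * (u : ℝ)).continuousOn).sub
      (continuous_finsetSum _ fun k _ => (hBk k).const_mul (c k)).continuousOn)
    (continuous_const.mul (continuous_subtype_val.add
      (continuous_finsetSum _ fun k _ => hV.comp (hτc k)))).continuousOn ?_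
  · refine (le_of_eq ?_).trans (key.trans_eq ?_)
    · congr 1
      simp only [mul_sub, Finset.sum_sub_distrib]
      ring
    · simp only [Finset.sum_sub_distrib]
      ring
  intro u hu
  have hu0 : t₀ hT < u := (t₀_le hT s).trans_lt hu.1
  obtain ⟨k, hk⟩ := hτ1 u hu0
  have htime := hD₀ u Y B hY hB hu0
  have htime' : ∀ᶠ r in 𝓝[<] u, dist ((G u (stopAt Y r) (stopAt B r) -
      G r (stopAt Y r) (stopAt B r)) / ((u : ℝ) - r)) (D₀ u Y B) < ε :=
    (Metric.tendsto_nhds.1 htime) ε hε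
  have hhor : ∀ᶠ r in 𝓝[<] u, ∀ K : Fin m, IsBV W (stopMixed B K r u) →
      |G u (stopAt Y r) (stopMixed B K r u) - G u (stopAt Y r) (stopAt B r)
        - D K u Y B * (B u K - B r K)| ≤ ε * |B u K - B r K| := by
    rw [eventually_all]
    exact fun K => hD K u Y B hY hB hu0 ε hε
  filter_upwards [hk, htime', hhor, Ioo_mem_nhdsLT hu.1] with r hkr h1 h2 hr
  have hru : 0 < (u : ℝ) - r := sub_pos.2 hr.2
  have hYr : stopAt Y r = Y := hYs r hr.1.le
  rw [hYr] at h1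
  simp only [hYr] at h2
  have e1 : G r Y B = G r Y (stopAt B r) := by
    have := hGn r Y B hY hB
    rwa [hYr] at this
  have e2 : G u Y B = G u Y (stopAt B u) := by
    have := hGn u Y B hY hB
    rwa [hYs u hu.1.le] at this
  -- Time moves first, with `B` stopped at `r`. One `ε` comes from the difference quotient, the
  -- other from replacing `D₀` by `c₀`.
  have t1 : |G u Y (stopAt B r) - G r Y B - c₀ * ((u : ℝ) - r)| ≤ 2 * ε * ((u : ℝ) - r) := by
    rw [Real.dist_eq, ← e1] at h1
    have h3 := abs_lt.1 h1
    have h4 := abs_le.1 (hc₀ u hu.1 hu.2)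
    have h5 : G u Y (stopAt B r) - G r Y B
        = (G u Y (stopAt B r) - G r Y B) / ((u : ℝ) - r) * ((u : ℝ) - r) := by
      field_simp
    rw [h5, ← sub_mul, abs_mul, abs_of_pos hru]
    refine mul_le_mul_of_nonneg_right ?_ hru.le
    rw [abs_le]
    constructor <;> linarith [h3.1, h3.2, h4.1, h4.2]
  have hmono : ∀ j, cumVar hT A (τ j r) ≤ cumVar hT A (τ j u) := fun j =>
    cumVar_mono hT hA (hτ j hr.2.le)
  have hfix : ∀ j : Fin m, (j : ℕ) ≠ k → ∀ v, r ≤ v → v ≤ u → B v j = B r j := by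
    intro j hj v hrv hvu
    have h3 : τ j v = τ j r := le_antisymm ((hτ j hvu).trans_eq (hkr j hj).symm) (hτ j hrv)
    simp [hBdef, timeChange, h3]
  have t2 : |G u Y B - G u Y (stopAt B r) - ∑ j, c j * (B u j - B r j)| ≤
      2 * ε * ∑ j, (cumVar hT A (τ j u) - cumVar hT A (τ j r)) := by
    -- If the active clock drives a component, the mixed path in the definition of the horizontal
    -- derivative is just `B` stopped at `u`. Otherwise the extra clock is running and `B` stands
    -- still.
    by_cases hkm : k < m
    · set K : Fin m := ⟨k, hkm⟩
      have hne : ∀ j : Fin m, j ≠ K → (j : ℕ) ≠ k := fun j hj h => hj (Fin.ext h)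
      have e3 : stopMixed B K r u = stopAt B u := by
        funext v
        ext j
        by_cases hj : j = K
        · simp [stopMixed, stopAt, hj]
        · have hjk := hne j hj
          simp only [stopMixed, stopAt, hj, ↓reduceIte]
          rcases le_total v r with hv | hv
          · rw [min_eq_left hv, min_eq_left (hv.trans hr.2.le)]
          · rw [min_eq_right hv, hfix j hjk (min v u) (le_min hv hr.2.le) (min_le_right _ _)]
      have h3 := h2 K (by rw [e3]; exact hB.stopAt u)
      rw [e3, ← e2] at h3
      have e4 : ∑ j, c j * (B u j - B r j) = c K * (B u K - B r K) := by
        refine Finset.sum_eq_single K (fun j _ hj => ?_) (by simp)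
        rw [hfix j (hne j hj) u hr.2.le le_rfl, sub_self, mul_zero]
      have h4 := abs_timeChange_sub_le hT hA hτ hr.2.le K
      rw [← hBdef] at h4
      have h5 : |G u Y B - G u Y (stopAt B r) - c K * (B u K - B r K)| ≤
          2 * ε * |B u K - B r K| := by
        have h6 : |(D K u Y B - c K) * (B u K - B r K)| ≤ ε * |B u K - B r K| := by
          rw [abs_mul]
          exact mul_le_mul_of_nonneg_right (hc u hu.1 hu.2 K) (abs_nonneg _)
        calc _ = |(G u Y B - G u Y (stopAt B r) - D K u Y B * (B u K - B r K))
              + (D K u Y B - c K) * (B u K - B r K)| := by congr 1; ring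
          _ ≤ _ := abs_add_le _ _
          _ ≤ _ := by linarith
      rw [e4]
      refine h5.trans (mul_le_mul_of_nonneg_left (h4.trans ?_) (by positivity))
      exact Finset.single_le_sum (f := fun j => cumVar hT A (τ j u) - cumVar hT A (τ j r))
        (fun j _ => sub_nonneg.2 (hmono j)) (Finset.mem_univ K)
    · have hall : ∀ j : Fin m, (j : ℕ) ≠ k := fun j h => hkm (h ▸ j.2)
      have e3 : stopAt B u = stopAt B r := by
        funext v
        ext j
        simp only [stopAt]
        rcases le_total v r with hv | hv
        · rw [min_eq_left hv, min_eq_left (hv.trans hr.2.le)]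
        · rw [min_eq_right hv, hfix j (hall j) (min v u) (le_min hv hr.2.le) (min_le_right _ _)]
      have e4 : ∑ j, c j * (B u j - B r j) = 0 := by
        refine Finset.sum_eq_zero fun j _ => ?_
        rw [hfix j (hall j) u hr.2.le le_rfl, sub_self, mul_zero]
      rw [e4, e2, e3, sub_self, sub_zero, abs_zero]
      exact mul_nonneg (by positivity) (Finset.sum_nonneg fun j _ => sub_nonneg.2 (hmono j))
  calc _ = |(G u Y (stopAt B r) - G r Y B - c₀ * ((u : ℝ) - r))
        + (G u Y B - G u Y (stopAt B r) - ∑ j, c j * (B u j - B r j))| := by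
        congr 1
        simp only [mul_sub, Finset.sum_sub_distrib]
        ring
    _ ≤ _ := abs_add_le _ _
    _ ≤ _ := add_le_add t1 t2
    _ = _ := by
        simp only [Finset.sum_sub_distrib]
        ring

/-- First order expansion of a functional in the horizontal direction. -/
theorem abs_horizontal_expansion_le (hT : 0 < T) (hGn : IsNonAnticipative U W G)
    (hGc : IsContinuousFunctional U W G) (hD₀ : IsTimeDerivative U W G D₀)
    (hD : ∀ k, IsHorizontalDerivative U W k G (D k)) {Y : Path T d} (hY : IsCadlag U Y)
    {A : Path T m} (hAc : Continuous A) (hA : IsBV W A) {η : ℝ} (hη : 0 < η)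
    (hηW : Metric.cthickening η (range A) ⊆ W) {s s' : Time T} (hss : s ≤ s')
    (hYs : ∀ u, s ≤ u → stopAt Y u = Y) {ε : ℝ} (hε : 0 < ε) {c₀ : ℝ} {c : Fin m → ℝ}
    (hc : ∀ u, s < u → u ≤ s' → ∀ B, Continuous B → IsBV (Metric.cthickening η (range A)) B →
      (∀ v, ‖A v - B v‖ < η) → |D₀ u Y B - c₀| ≤ ε ∧ ∀ k, |D k u Y B - c k| ≤ ε) :
    |G s' Y A - G s Y A - c₀ * ((s' : ℝ) - s) - ∑ k, c k * (A s' k - A s k)|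
      ≤ 2 * ε * (((s' : ℝ) - s) + m * (cumVar hT A s' - cumVar hT A s)) := by
  -- As the clocks approach the identity, `G`, the components of `A` and the variation all converge,
  -- so the estimate for components that move in turn passes to `A`.
  choose τ hτ hτc hτρ hτ1 using fun n : ℕ =>
    exists_clocks hT m (ρ := 1 / ((n : ℝ) + 1)) Nat.one_div_pos_of_nat
  have hV := continuous_cumVar hT hA.bv hAc
  have hunif : ∀ η' > 0, ∀ᶠ n in atTop, ∀ u, ‖A u - timeChange A (τ n) u‖ < η' := by
    intro η' hη'
    obtain ⟨ρ, hρ, h⟩ := exists_norm_sub_timeChange_lt hAc hη'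
    filter_upwards [tendsto_one_div_add_atTop_nhds_zero_nat.eventually_lt_const hρ] with n hn
    exact h (τ n) fun k u => (hτρ n k u).trans hn
  have hBV : ∀ᶠ n in atTop, IsBV (Metric.cthickening η (range A)) (timeChange A (τ n)) := by
    filter_upwards [hunif η hη] with n hn
    refine ⟨isCadlag_of_continuous (continuous_timeChange hAc (hτc n)) fun u => ?_,
      boundedVariationOn_timeChange hT hA.bv (hτ n)⟩
    refine Metric.mem_cthickening_of_dist_le _ (A u) _ _ (mem_range_self u) ?_
    rw [dist_comm, dist_eq_norm]
    exact (hn u).le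
  have hτlim : ∀ k u, Tendsto (fun n => τ n k u) atTop (𝓝 u) := by
    intro k u
    rw [tendsto_iff_dist_tendsto_zero]
    refine squeeze_zero (fun _ => dist_nonneg) (fun n => ?_)
      tendsto_one_div_add_atTop_nhds_zero_nat
    rw [dist_comm, Subtype.dist_eq, Real.dist_eq]
    exact (hτρ n k u).le
  have hGlim : ∀ u, s ≤ u → Tendsto (fun n => G u Y (timeChange A (τ n))) atTop
      (𝓝 (G u Y A)) := by
    intro u hu
    rw [Metric.tendsto_nhds]
    intro ε' hε'
    obtain ⟨η', hη', h⟩ := hGc ε' hε' u Y A hY hA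
    filter_upwards [hunif η' hη', hBV] with n hn hbv
    rw [dist_comm, Real.dist_eq]
    exact h u Y _ hY (hbv.mono hηW) ⟨by simpa using hη', fun v => by simpa using hη',
      fun v => hn _⟩
  have hAlim : ∀ k u, Tendsto (fun n => timeChange A (τ n) u k) atTop (𝓝 (A u k)) := by
    intro k u
    have : Continuous fun v => A v k := (EuclideanSpace.proj (𝕜 := ℝ) k).continuous.comp hAc
    exact (this.tendsto u).comp (hτlim k u)
  have hVlim : ∀ k u, Tendsto (fun n => cumVar hT A (τ n k u)) atTop (𝓝 (cumVar hT A u)) :=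
    fun k u => (hV.tendsto u).comp (hτlim k u)
  have l1 : Tendsto (fun n => |G s' Y (timeChange A (τ n)) - G s Y (timeChange A (τ n))
      - c₀ * ((s' : ℝ) - s) - ∑ k, c k * (timeChange A (τ n) s' k - timeChange A (τ n) s k)|)
      atTop (𝓝 |G s' Y A - G s Y A - c₀ * ((s' : ℝ) - s) - ∑ k, c k * (A s' k - A s k)|) :=
    ((((hGlim s' hss).sub (hGlim s le_rfl)).sub_const _).sub (tendsto_finsetSum _ fun k _ =>
      ((hAlim k s').sub (hAlim k s)).const_mul (c k))).abs
  have l2 : Tendsto (fun n => 2 * ε * (((s' : ℝ) - s) +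
      ∑ k, (cumVar hT A (τ n k s') - cumVar hT A (τ n k s)))) atTop
      (𝓝 (2 * ε * (((s' : ℝ) - s) + ∑ _k : Fin m, (cumVar hT A s' - cumVar hT A s)))) :=
    ((tendsto_finsetSum _ fun k _ => (hVlim k s').sub (hVlim k s)).const_add _).const_mul _
  have hfin := le_of_tendsto_of_tendsto l1 l2 (by
    filter_upwards [hBV, hunif η hη] with n hbv hn
    have h := fun u hsu hus => hc u hsu hus _ (continuous_timeChange hAc (hτc n)) hbv hn
    exact abs_horizontal_timeChange_le hT hGn hGc hD₀ hD hY hAc hA.bv (hτ n) (hτc n) (hτ1 n)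
      (hbv.mono hηW) hss hYs hε (fun u h1 h2 => (h u h1 h2).1) (fun u h1 h2 => (h u h1 h2).2))
  rwa [Finset.sum_const, Finset.card_univ, Fintype.card_fin, nsmul_eq_mul] at hfin

end Horizontal

end PathwiseSPT
end

noncomputable section
namespace PathwiseSPT

variable {T : ℝ} {d m : ℕ}

/-! ### The pathwise Itô formula -/

theorem Close.mono {η η' : ℝ} (h : η ≤ η') {t t' : Time T} {X X' : Path T d} {A A' : Path T m}
    (hc : Close η t X A t' X' A') : Close η' t X A t' X' A' :=
  ⟨hc.1.trans_le h, fun u => (hc.2.1 u).trans_le h, fun u => (hc.2.2 u).trans_le h⟩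

/-- In this form one `η` can be chosen for finitely many functionals at once. -/
theorem IsLeftContinuous.eventually {U : Set (Vec d)} {W : Set (Vec m)} {F : Functional T d m}
    (hF : IsLeftContinuous U W F) {ε : ℝ} (hε : 0 < ε) {t : Time T} {X : Path T d}
    {A : Path T m} (hX : IsCadlag U X) (hA : IsBV W A) :
    ∀ᶠ η in 𝓝[>] (0 : ℝ), ∀ t' X' A', IsCadlag U X' → IsBV W A' → t' < t →
      Close η t X A t' X' A' → |F t X A - F t' X' A'| < ε := by
  obtain ⟨η₀, hη₀, h⟩ := hF ε hε t X A hX hA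
  filter_upwards [Ioo_mem_nhdsGT hη₀] with η hη t' X' A' hX' hA' ht hc
  exact h t' X' A' hX' hA' ht (hc.mono hη.2.le)

theorem psum_t₀ {hT : 0 < T} {p : Finset (Time T)} (h0 : t₀ hT ∈ p) (f : Time T → ℝ) :
    psum p f (t₀ hT) = f (t₀ hT) := by
  have : p.filter (fun s => s ≤ t₀ hT) = {t₀ hT} := by
    ext s
    simp only [Finset.mem_filter, Finset.mem_singleton]
    exact ⟨fun h => le_antisymm h.2 (t₀_le hT s), fun h => by rw [h]; exact ⟨h0, le_rfl⟩⟩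
  rw [psum, this, Finset.sum_singleton]

/-- The increment over a partition interval of the values of `G` along the discrete
approximations, minus the corresponding summand of the Itô integral of the vertical gradient. -/
def itoRemainder (P : ℕ → Finset (Time T)) (G : Functional T d m) (X : Path T d) (A : Path T m)
    (n : ℕ) (s : Time T) : ℝ :=
  G (succ (P n) s) (leftApprox (P n) X (succ (P n) s)) A - G s (leftApprox (P n) X s) A
    - ∑ i, vDeriv G i s (leftApprox (P n) X s) A * (X (succ (P n) s) i - X s i)

/-- The quantity that controls the remainder of the Itô formula over a partition interval. -/
def itoWeight (hT : 0 < T) (P : ℕ → Finset (Time T)) (X : Path T d) (A : Path T m) (n : ℕ)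
    (s : Time T) : ℝ :=
  ((succ (P n) s : ℝ) - s) + m * (cumVar hT A (succ (P n) s) - cumVar hT A s)
    + ∑ i, (X (succ (P n) s) i - X s i) ^ 2

section Ito

variable {hT : 0 < T} {P : ℕ → Finset (Time T)} {U : Set (Vec d)} {W : Set (Vec m)}
  {X : Path T d} {A : Path T m} {G D₀ : Functional T d m} {D : Fin m → Functional T d m}

theorem itoWeight_nonneg (hA : BoundedVariationOn A univ) (n : ℕ) (s : Time T) :
    0 ≤ itoWeight hT P X A n s := by
  have h1 : (s : ℝ) ≤ succ (P n) s := le_succ (P n) s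
  have h2 := cumVar_mono hT hA (le_succ (P n) s)
  refine add_nonneg (add_nonneg (sub_nonneg.2 h1) ?_) (Finset.sum_nonneg fun i _ => sq_nonneg _)
  exact mul_nonneg (Nat.cast_nonneg m) (sub_nonneg.2 h2)

/-- Time and variation telescope, and the squares converge to the diagonal covariations. At time `0`
a single square remains, and it tends to zero because `X` is continuous. -/
theorem exists_tendsto_psum_itoWeight (hP : IsRefiningPartition hT P) (hX : Continuous X)
    (hcov : HasCovariations P X) (hAc : Continuous A) (hA : BoundedVariationOn A univ) :
    ∃ ω : Time T → ℝ, Continuous ω ∧ ω (t₀ hT) = 0 ∧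
      ∀ t, Tendsto (fun n => psum (P n) (itoWeight hT P X A n) t) atTop (𝓝 (ω t)) := by
  choose C hC hlim using hcov
  have hV := continuous_cumVar hT hA hAc
  have hlim' : ∀ t, Tendsto (fun n => psum (P n) (itoWeight hT P X A n) t) atTop
      (𝓝 (((t : ℝ) - (t₀ hT : Time T)) + m * (cumVar hT A t - cumVar hT A (t₀ hT))
        + ∑ i, C i i t)) := by
    intro t
    unfold itoWeight
    simp_rw [psum_add, psum_const_mul, psum_sum]
    refine ((hP.tendsto_psum_telescope continuous_subtype_val t).add
      ((hP.tendsto_psum_telescope hV t).const_mul _)).add (tendsto_finsetSum _ fun i _ => ?_)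
    simp_rw [sq]
    exact hlim i i t
  refine ⟨_, ?_, ?_, hlim'⟩
  · exact ((continuous_subtype_val.sub continuous_const).add
      (continuous_const.mul (hV.sub continuous_const))).add
      (continuous_finsetSum _ fun i _ => hC i i)
  · have h0 : ∀ i, C i i (t₀ hT) = 0 := by
      intro i
      refine tendsto_nhds_unique (hlim i i (t₀ hT)) ?_
      have hXi : Continuous fun u => X u i := by
        have h := (EuclideanSpace.proj (𝕜 := ℝ) i).continuous.comp hX
        exact h
      have h1 : Tendsto (fun n => X (succ (P n) (t₀ hT)) i - X (t₀ hT) i) atTop (𝓝 0) := by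
        have := ((hXi.tendsto _).comp (hP.tendsto_succ (t₀ hT))).sub_const (X (t₀ hT) i)
        rwa [sub_self] at this
      have h2 := h1.mul h1
      rw [mul_zero] at h2
      refine h2.congr fun n => ?_
      exact (psum_t₀ (hP.zero_mem n)
        fun s => (X (succ (P n) s) i - X s i) * (X (succ (P n) s) i - X s i)).symm
    simp [h0]

/-- Expansion of the remainder on a single partition interval. -/
theorem abs_itoRemainder_sub_le (hG : IsC12 U W G) (hD₀ : IsTimeDerivative U W G D₀)
    (hD : ∀ k, IsHorizontalDerivative U W k G (D k)) (hAc : Continuous A) (hA : IsBV W A) {η : ℝ}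
    (hη : 0 < η) (hηW : Metric.cthickening η (range A) ⊆ W) {n : ℕ} {s : Time T}
    (hstep : ∀ θ ∈ Icc (0 : ℝ) 1,
      IsCadlag U (stepPath (P n) X s (θ • (X (succ (P n) s) - X s))))
    {ε : ℝ} (hε : 0 < ε) {c₀ : ℝ} {c : Fin m → ℝ} {c₂ : Fin d → Fin d → ℝ}
    (hc : ∀ u, s < u → u ≤ succ (P n) s → ∀ B, Continuous B →
      IsBV (Metric.cthickening η (range A)) B → (∀ v, ‖A v - B v‖ < η) →
      |D₀ u (stepPath (P n) X s (X (succ (P n) s) - X s)) B - c₀| ≤ ε ∧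
        ∀ k, |D k u (stepPath (P n) X s (X (succ (P n) s) - X s)) B - c k| ≤ ε)
    (hc₂ : ∀ θ ∈ Icc (0 : ℝ) 1, ∀ i j, |vDeriv (vDeriv G j) i s
      (stepPath (P n) X s (θ • (X (succ (P n) s) - X s))) A - c₂ i j| ≤ ε) :
    |itoRemainder P G X A n s - (c₀ * ((succ (P n) s : ℝ) - s)
        + ∑ k, c k * (A (succ (P n) s) k - A s k)
        + ∑ i, ∑ j, c₂ i j / 2 *
          ((X (succ (P n) s) i - X s i) * (X (succ (P n) s) j - X s j)))|
      ≤ (2 + d) * ε * itoWeight hT P X A n s := by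
  have hw := itoWeight_nonneg (hT := hT) (P := P) (X := X) hA.bv n s
  -- If no partition point follows `s`, the interval degenerates and the remainder vanishes.
  rcases (le_succ (P n) s).eq_or_lt with heq | hlt
  · have : 0 ≤ (2 + d) * ε * itoWeight hT P X A n s := by positivity
    simpa [itoRemainder, ← heq] using this
  set s' := succ (P n) s with hs'
  set v := X s' - X s with hv
  have hvi : ∀ i, v i = X s' i - X s i := fun i => by simp [hv]
  set Y := stepPath (P n) X s v with hYdef
  have hYU : IsCadlag U Y := by simpa using hstep 1 (by simp)
  have h1 := abs_horizontal_expansion_le hT hG.nonAnticipative hG.continuous hD₀ hD hYU hAc hA hη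
    hηW hlt.le (fun u hu => stopAt_stepPath hu) hε hc
  have h2 := abs_vertical_expansion_le hG.vDiff hG.vDiff_vDeriv hA (X := leftApprox (P n) X s)
    hstep hc₂
  rw [← stepPath, ← stepPath, stepPath_zero] at h2
  simp only [hvi] at h2
  unfold itoRemainder itoWeight
  -- Now the increment is the sum of the horizontal move `h1`, made after the jump, and the vertical
  -- move `h2`, made at time `s`.
  rw [← hs', leftApprox_succ (hs' ▸ hlt), ← hs', ← hv, ← hYdef]
  set Q := ∑ i, (X s' i - X s i) ^ 2 with hQ
  have hQ0 : 0 ≤ Q := Finset.sum_nonneg fun i _ => sq_nonneg _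
  have hV0 : 0 ≤ ((s' : ℝ) - s) + m * (cumVar hT A s' - cumVar hT A s) :=
    add_nonneg (sub_nonneg.2 hlt.le) (mul_nonneg (Nat.cast_nonneg m)
      (sub_nonneg.2 (cumVar_mono hT hA.bv hlt.le)))
  set R := ((s' : ℝ) - s) + m * (cumVar hT A s' - cumVar hT A s)
  calc _ ≤ 2 * ε * R + ε * (d * Q) := by
        refine le_trans (le_of_eq ?_) ((abs_add_le _ _).trans (add_le_add h1 h2))
        congr 1
        ring
    _ ≤ (2 + d) * ε * (R + Q) := by
        have : 0 ≤ d * ε * R := by positivity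
        have : 0 ≤ 2 * ε * Q := by positivity
        nlinarith

/-- The remainder of the Itô formula is controlled by the weights. -/
theorem exists_abs_itoRemainder_le (hP : IsRefiningPartition hT P) (hU : IsOpen U)
    (hW : IsOpen W) (hX : Continuous X) (hXU : ∀ t, X t ∈ U) (hAc : Continuous A)
    (hA : IsBV W A) (hG : IsC12 U W G) :
    ∃ C : ℝ, 0 ≤ C ∧
      ∀ᶠ n in atTop, ∀ s ∈ P n, |itoRemainder P G X A n s| ≤ C * itoWeight hT P X A n s := by
  obtain ⟨r, hr, hKc, hKU⟩ := exists_cthickening_range_subset hU hX hXU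
  obtain ⟨η, hη, hLc, hLW⟩ := exists_cthickening_range_subset hW hAc hA.cadlag.mem
  obtain ⟨D₀, -, hD₀, hD₀t⟩ := hG.timeDerivative
  choose D hDn hD hDt using hG.horizontalDerivative
  obtain ⟨C₀, hC₀⟩ := hD₀t.2 _ _ hKc hLc hKU hLW
  choose C₁ hC₁ using fun k => (hDt k).2 _ _ hKc hLc hKU hLW
  choose C₂ hC₂ using fun i j => (hG.vDeriv_vDeriv_tame i j).2 _ _ hKc hLc hKU hLW
  obtain ⟨M₁, hM₁⟩ := (Set.finite_range C₁).bddAbove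
  obtain ⟨M₂, hM₂⟩ := (Set.finite_range fun q : Fin d × Fin d => C₂ q.1 q.2).bddAbove
  -- This `ε` is not small: it bounds all derivatives on the compact neighbourhoods, and the
  -- expansion is used with zero coefficients.
  set ε := max 1 (max C₀ (max M₁ M₂)) with hεdef
  have hε : 0 < ε := lt_max_of_lt_left one_pos
  have hε0 : C₀ ≤ ε := (le_max_left _ _).trans (le_max_right _ _)
  have hε1 : ∀ k, C₁ k ≤ ε := fun k => (hM₁ (mem_range_self k)).trans
    ((le_max_left _ _).trans ((le_max_right _ _).trans (le_max_right _ _)))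
  have hε2 : ∀ i j, C₂ i j ≤ ε := fun i j => (hM₂ (mem_range_self (i, j))).trans
    ((le_max_right _ _).trans ((le_max_right _ _).trans (le_max_right _ _)))
  have hAL : IsBV (Metric.cthickening η (range A)) A :=
    ⟨isCadlag_of_continuous hAc fun t =>
      Metric.self_subset_cthickening _ (mem_range_self t), hA.bv⟩
  refine ⟨(2 + d) * ε, by positivity, ?_⟩
  filter_upwards [eventually_isCadlag_stepPath hP hX hr] with n hn s hs
  have hn' := hn s hs
  have h := abs_itoRemainder_sub_le (hT := hT) (P := P) (n := n) (s := s) (c₀ := 0)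
    (c := fun _ => 0) (c₂ := fun _ _ => 0) hG hD₀ hD hAc hA hη hLW
    (fun θ hθ => (hn' θ hθ).mono hKU) hε
    (fun u _ _ B _ hB _ => by
      have h1 := hn' 1 (by simp)
      rw [one_smul] at h1
      exact ⟨by simpa using (hC₀ u _ B h1 hB).trans hε0,
        fun k => by simpa using (hC₁ k u _ B h1 hB).trans (hε1 k)⟩)
    (fun θ hθ i j => by simpa using (hC₂ i j s _ A (hn' θ hθ) hAL).trans (hε2 i j))
  simpa using h

/-- The sums of the remainders of the Itô formula converge. -/
theorem exists_tendsto_psum_itoRemainder (hP : IsRefiningPartition hT P) (hU : IsOpen U)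
    (hW : IsOpen W) (hX : Continuous X) (hXU : ∀ t, X t ∈ U) (hcov : HasCovariations P X)
    (hAc : Continuous A) (hA : IsBV W A) (hG : IsC12 U W G) :
    ∃ H : Time T → ℝ, ∀ t,
      Tendsto (fun n => psum (P n) (itoRemainder P G X A n) t) atTop (𝓝 (H t)) := by
  obtain ⟨ω, hωc, hω0, hω⟩ := exists_tendsto_psum_itoWeight hP hX hcov hAc hA.bv
  obtain ⟨C, -, hC⟩ := exists_abs_itoRemainder_le hP hU hW hX hXU hAc hA hG
  refine exists_tendsto_psum hP hωc hω0 hω hC fun t ht ε₁ hε₁ => ?_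
  obtain ⟨r, hr, hKc, hKU⟩ := exists_cthickening_range_subset hU hX hXU
  obtain ⟨η₁, hη₁, hLc, hLW⟩ := exists_cthickening_range_subset hW hAc hA.cadlag.mem
  obtain ⟨D₀, -, hD₀, hD₀t⟩ := hG.timeDerivative
  choose D hDn hD hDt using hG.horizontalDerivative
  choose Q hQ hQlim using hcov
  have hXc : IsCadlag U X := isCadlag_of_continuous hX hXU
  set ε := ε₁ / (2 + d) with hεdef
  have hd2 : (0 : ℝ) < 2 + d := by positivity
  have hε : 0 < ε := div_pos hε₁ hd2
  obtain ⟨η, ⟨⟨hη0, hη1, hη2⟩, hη⟩⟩ := (((hD₀t.1.eventually hε hXc hA).and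
    ((eventually_all.2 fun k => (hDt k).1.eventually hε hXc hA (t := t)).and
      (eventually_all.2 fun i => eventually_all.2 fun j =>
        (hG.vDeriv_vDeriv_tame i j).1.eventually hε hXc hA (t := t)))).and
    self_mem_nhdsWithin).exists
  have hη : 0 < η := hη
  obtain ⟨ρ₁, hρ₁, hstep⟩ := exists_stepPath_close hP hX hη
  obtain ⟨ρ₂, hρ₂, hAclose⟩ := exists_stopAt_close hAc (half_pos hη)
  -- One half of `η` pays for the change of `A` between `u` and `t`, the other for replacing `A` by
  -- `B`; `η₁` keeps `B` inside `W`.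
  set ζ := min (η / 2) η₁ with hζ
  have hζ0 : 0 < ζ := lt_min (half_pos hη) hη₁
  have hζW : Metric.cthickening ζ (range A) ⊆ W :=
    (Metric.cthickening_mono (min_le_right _ _) _).trans hLW
  -- The comparison summands carry the derivatives frozen at `(t, X, A)`; their sums converge by
  -- telescoping and by the existence of covariations.
  refine ⟨fun n s => D₀ t X A * ((succ (P n) s : ℝ) - s)
    + ∑ k, D k t X A * (A (succ (P n) s) k - A s k)
    + ∑ i, ∑ j, vDeriv (vDeriv G j) i t X A / 2 *
      ((X (succ (P n) s) i - X s i) * (X (succ (P n) s) j - X s j)),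
    fun b => D₀ t X A * ((b : ℝ) - (t₀ hT : Time T))
    + ∑ k, D k t X A * (A b k - A (t₀ hT) k)
    + ∑ i, ∑ j, vDeriv (vDeriv G j) i t X A / 2 * Q i j b, fun b => ?_, ?_⟩
  · simp_rw [psum_add, psum_sum, psum_const_mul]
    refine (((hP.tendsto_psum_telescope continuous_subtype_val b).const_mul _).add
      (tendsto_finsetSum _ fun k _ => Tendsto.const_mul _ ?_)).add
      (tendsto_finsetSum _ fun i _ => tendsto_finsetSum _ fun j _ =>
        (hQlim i j b).const_mul _)
    have hAk : Continuous fun u => A u k := by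
      have h := (EuclideanSpace.proj (𝕜 := ℝ) k).continuous.comp hAc
      exact h
    exact hP.tendsto_psum_telescope hAk b
  have hne : (𝓝[<] t).NeBot := nhdsLT_neBot_of_exists_lt ⟨_, ht⟩
  have hρ : 0 < min η (min ρ₁ ρ₂) := lt_min hη (lt_min hρ₁ hρ₂)
  have hball : ∀ᶠ r in 𝓝[<] t, r ∈ Metric.ball t (min η (min ρ₁ ρ₂)) :=
    mem_nhdsWithin_of_mem_nhds (Metric.ball_mem_nhds t hρ)
  obtain ⟨r₀, hr₀, hr₀t⟩ := (hball.and self_mem_nhdsWithin).exists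
  have hr₀t : r₀ < t := hr₀t
  rw [Metric.mem_ball, dist_comm, Subtype.dist_eq, Real.dist_eq,
    abs_of_pos (sub_pos.2 (Subtype.coe_lt_coe.2 hr₀t))] at hr₀
  have hclose : ∀ u : Time T, r₀ < u → u < t → |(t : ℝ) - u| < min η (min ρ₁ ρ₂) := by
    intro u h1 h2
    have h1' : (r₀ : ℝ) < u := h1
    rw [abs_of_pos (sub_pos.2 (Subtype.coe_lt_coe.2 h2))]
    linarith
  refine ⟨r₀, hr₀t, ?_⟩
  filter_upwards [eventually_isCadlag_stepPath hP hX hr, hstep] with n hn hstepn s hs hrs hst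
  have hn' := hn s hs
  have hss := le_succ (P n) s
  have hts := hclose s hrs (hss.trans_lt hst)
  have hts1 : |(t : ℝ) - s| < ρ₁ := hts.trans_le ((min_le_right _ _).trans (min_le_left _ _))
  have h := abs_itoRemainder_sub_le (hT := hT) (P := P) (n := n) (s := s) (c₀ := D₀ t X A)
    (c := fun k => D k t X A) (c₂ := fun i j => vDeriv (vDeriv G j) i t X A)
    hG hD₀ hD hAc hA hζ0 hζW (fun θ hθ => (hn' θ hθ).mono hKU) hε ?_ ?_
  · refine h.trans_eq ?_
    rw [hεdef]
    field_simp
  · intro u hsu hus B hBc hB hAB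
    -- Left-continuity speaks only of times strictly before `t`; this is why the local estimates
    -- concern partition intervals that end before `t`.
    have hut : u < t := hus.trans_lt hst
    have htu := hclose u (hrs.trans hsu) hut
    have h1 := hn' 1 (by simp)
    rw [one_smul] at h1
    have hcl : Close η t X A u (stepPath (P n) X s (X (succ (P n) s) - X s)) B := by
      refine ⟨htu.trans_le (min_le_left _ _), fun v => ?_, fun v => ?_⟩
      · rw [stopAt_stepPath hsu.le]
        have := hstepn s t hts1 1 (by simp) v
        rwa [one_smul] at this
      · have h2 := hAclose u t
          (htu.trans_le ((min_le_right _ _).trans (min_le_right _ _))) v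
        have h3 := (hAB (min v u)).trans_le (min_le_left _ _)
        calc ‖stopAt A t v - stopAt B u v‖
            = ‖(stopAt A t v - stopAt A u v) + (A (min v u) - B (min v u))‖ := by
              simp only [stopAt]; congr 1; abel
          _ ≤ _ := norm_add_le _ _
          _ < η := by linarith
    constructor
    · rw [abs_sub_comm]
      exact (hη0 u _ B (h1.mono hKU) (hB.mono hζW) hut hcl).le
    · intro k
      rw [abs_sub_comm]
      exact (hη1 k u _ B (h1.mono hKU) (hB.mono hζW) hut hcl).le
  · intro θ hθ i j
    rw [abs_sub_comm]
    refine (hη2 i j s _ A ((hn' θ hθ).mono hKU) hA (hss.trans_lt hst)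
      ⟨hts.trans_le (min_le_left _ _), fun v => ?_, fun v => ?_⟩).le
    · rw [stopAt_stepPath le_rfl]
      exact hstepn s t hts1 θ hθ v
    · exact (hAclose s t (hts.trans_le ((min_le_right _ _).trans (min_le_right _ _))) v).trans
        (half_lt_self hη)

/-- Values of a continuous functional along the discrete approximations converge locally
uniformly. -/
theorem exists_abs_sub_leftApprox_lt (hP : IsRefiningPartition hT P) (hX : Continuous X)
    (hXU : ∀ t, X t ∈ U) (hAc : Continuous A) (hA : IsBV W A)
    (hG : IsContinuousFunctional U W G) (t : Time T) {ε : ℝ} (hε : 0 < ε) :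
    ∃ ρ > 0, ∀ᶠ n in atTop, ∀ s ∈ P n, |(t : ℝ) - s| < ρ →
      |G t X A - G s (leftApprox (P n) X s) A| < ε := by
  have hXc : IsCadlag U X := isCadlag_of_continuous hX hXU
  obtain ⟨η, hη, h⟩ := hG ε hε t X A hXc hA
  obtain ⟨ρ₁, hρ₁, hstep⟩ := exists_stepPath_close hP hX hη
  obtain ⟨ρ₂, hρ₂, hAclose⟩ := exists_stopAt_close hAc hη
  refine ⟨min η (min ρ₁ ρ₂), lt_min hη (lt_min hρ₁ hρ₂), ?_⟩
  filter_upwards [hstep] with n hn s hs hts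
  have hcad : IsCadlag U (leftApprox (P n) X s) := by
    rw [← stepPath_zero]
    exact isCadlag_stepPath hXU hs (by simpa using hXU s)
  refine h s _ A hcad hA ⟨hts.trans_le (min_le_left _ _), fun v => ?_, fun v => ?_⟩
  · have := hn s t (hts.trans_le ((min_le_right _ _).trans (min_le_left _ _))) 0 (by simp) v
    rw [zero_smul, stepPath_zero] at this
    rwa [stopAt_leftApprox]
  · exact hAclose s t (hts.trans_le ((min_le_right _ _).trans (min_le_right _ _))) v

theorem continuous_functional (hX : Continuous X) (hXU : ∀ t, X t ∈ U) (hAc : Continuous A)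
    (hA : IsBV W A) (hG : IsContinuousFunctional U W G) : Continuous fun t => G t X A := by
  have hXc : IsCadlag U X := isCadlag_of_continuous hX hXU
  rw [continuous_iff_continuousAt]
  intro t
  rw [ContinuousAt, Metric.tendsto_nhds]
  intro ε hε
  obtain ⟨η, hη, h⟩ := hG ε hε t X A hXc hA
  obtain ⟨ρ₁, hρ₁, h₁⟩ := exists_stopAt_close hX hη
  obtain ⟨ρ₂, hρ₂, h₂⟩ := exists_stopAt_close hAc hη
  filter_upwards [Metric.ball_mem_nhds t (lt_min hη (lt_min hρ₁ hρ₂))] with s hs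
  rw [Metric.mem_ball, dist_comm, Subtype.dist_eq, Real.dist_eq] at hs
  rw [dist_comm, Real.dist_eq]
  exact h s X A hXc hA ⟨hs.trans_le (min_le_left _ _),
    h₁ s t (hs.trans_le ((min_le_right _ _).trans (min_le_left _ _))),
    h₂ s t (hs.trans_le ((min_le_right _ _).trans (min_le_right _ _)))⟩

theorem tendsto_leftApprox_succ (hP : IsRefiningPartition hT P) (hX : Continuous X)
    (hXU : ∀ t, X t ∈ U) (hAc : Continuous A) (hA : IsBV W A)
    (hG : IsContinuousFunctional U W G) (t : Time T) :
    Tendsto (fun n => G (succ (P n) t) (leftApprox (P n) X (succ (P n) t)) A) atTop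
      (𝓝 (G t X A)) := by
  rw [Metric.tendsto_nhds]
  intro ε hε
  obtain ⟨ρ, hρ, h⟩ := exists_abs_sub_leftApprox_lt hP hX hXU hAc hA hG t hε
  filter_upwards [h, hP.succ_sub_lt hρ] with n hn hmesh
  rw [dist_comm, Real.dist_eq]
  refine hn _ ?_ ?_
  · have hle : t ≤ (⟨T, hT.le, le_rfl⟩ : Time T) := t.2.2
    rcases hle.eq_or_lt with h | h
    · exact succ_mem_of_mem (h ▸ hP.last_mem n)
    · exact (succ_mem (hP.last_mem n) h).1
  · rw [abs_sub_comm, abs_of_nonneg (sub_nonneg.2 (Subtype.coe_le_coe.2 (le_succ (P n) t)))]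
    exact hmesh t

theorem tendsto_leftApprox_zero (hP : IsRefiningPartition hT P) (hX : Continuous X)
    (hXU : ∀ t, X t ∈ U) (hAc : Continuous A) (hA : IsBV W A)
    (hG : IsContinuousFunctional U W G) :
    Tendsto (fun n => G (t₀ hT) (leftApprox (P n) X (t₀ hT)) A) atTop
      (𝓝 (G (t₀ hT) X A)) := by
  rw [Metric.tendsto_nhds]
  intro ε hε
  obtain ⟨ρ, hρ, h⟩ := exists_abs_sub_leftApprox_lt hP hX hXU hAc hA hG (t₀ hT) hε
  filter_upwards [h] with n hn
  rw [dist_comm, Real.dist_eq]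
  exact hn _ (hP.zero_mem n) (by simpa using hρ)

/-- The values of `G` along the approximations telescope, so the Itô sums converge once the sums of
remainders do. -/
theorem itoSum_vGrad_eq (hP : IsRefiningPartition hT P) (n : ℕ) (t : Time T) :
    itoSum P (vGrad G) X A t n =
      G (succ (P n) t) (leftApprox (P n) X (succ (P n) t)) A
        - G (t₀ hT) (leftApprox (P n) X (t₀ hT)) A
        - psum (P n) (itoRemainder P G X A n) t := by
  rw [← psum_telescope hT (hP.zero_mem n) (hP.last_mem n)
    (fun s => G s (leftApprox (P n) X s) A) t, ← psum_sub]
  refine psum_congr fun s _ => ?_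
  simp [itoRemainder, vGrad]

/-- The pathwise Itô integral of the vertical gradient exists, and the remainders of the Itô
formula sum up to `-Γ^G`. -/
theorem hasItoIntegral_vGrad (hP : IsRefiningPartition hT P) (hU : IsOpen U)
    (hW : IsOpen W) (hX : Continuous X) (hXU : ∀ t, X t ∈ U) (hcov : HasCovariations P X)
    (hAc : Continuous A) (hA : IsBV W A) (hG : IsC12 U W G) (t : Time T) :
    HasItoIntegral P (vGrad G) X A t (itoIntegral P (vGrad G) X A t) ∧
      Tendsto (fun n => psum (P n) (itoRemainder P G X A n) t) atTop
        (𝓝 (-gammaFn hT P G X A t)) := by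
  obtain ⟨H, hH⟩ := exists_tendsto_psum_itoRemainder hP hU hW hX hXU hcov hAc hA hG
  have h1 : Tendsto (itoSum P (vGrad G) X A t) atTop (𝓝 (G t X A - G (t₀ hT) X A - H t)) := by
    rw [funext fun n => itoSum_vGrad_eq (G := G) (X := X) (A := A) hP n t]
    exact ((tendsto_leftApprox_succ hP hX hXU hAc hA hG.continuous t).sub
      (tendsto_leftApprox_zero hP hX hXU hAc hA hG.continuous)).sub (hH t)
  have h2 : itoIntegral P (vGrad G) X A t = G t X A - G (t₀ hT) X A - H t := h1.limUnder_eq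
  refine ⟨by rw [h2]; exact h1, ?_⟩
  have h3 : -gammaFn hT P G X A t = H t := by
    rw [gammaFn, h2]
    ring
  rw [h3]
  exact hH t

/-- `-Γ^G` is a limit of sums dominated by the weights, so its increments are bounded by a multiple
of those of `ω`. -/
theorem continuous_gammaFn (hP : IsRefiningPartition hT P) (hU : IsOpen U)
    (hW : IsOpen W) (hX : Continuous X) (hXU : ∀ t, X t ∈ U) (hcov : HasCovariations P X)
    (hAc : Continuous A) (hA : IsBV W A) (hG : IsC12 U W G) :
    Continuous (gammaFn hT P G X A) := by
  obtain ⟨ω, hωc, hω0, hω⟩ := exists_tendsto_psum_itoWeight hP hX hcov hAc hA.bv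
  obtain ⟨C, -, hC⟩ := exists_abs_itoRemainder_le hP hU hW hX hXU hAc hA hG
  have h : Continuous fun t => -gammaFn hT P G X A t :=
    continuous_of_abs_sub_le hωc fun a b hab => abs_limit_sub_le_of_abs_le hω hC le_rfl
      (fun t => (hasItoIntegral_vGrad hP hU hW hX hXU hcov hAc hA hG t).2) hab
  exact (continuous_neg.comp h).congr fun t => neg_neg _

theorem gammaFn_zero (hP : IsRefiningPartition hT P) (hU : IsOpen U)
    (hW : IsOpen W) (hX : Continuous X) (hXU : ∀ t, X t ∈ U) (hcov : HasCovariations P X)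
    (hAc : Continuous A) (hA : IsBV W A) (hG : IsC12 U W G) :
    gammaFn hT P G X A (t₀ hT) = 0 := by
  obtain ⟨ω, hωc, hω0, hω⟩ := exists_tendsto_psum_itoWeight hP hX hcov hAc hA.bv
  obtain ⟨C, -, hC⟩ := exists_abs_itoRemainder_le hP hU hW hX hXU hAc hA hG
  have h1 := (hasItoIntegral_vGrad hP hU hW hX hXU hcov hAc hA hG (t₀ hT)).2.abs
  have h2 : |(-gammaFn hT P G X A (t₀ hT))| ≤ C * ω (t₀ hT) := by
    refine le_of_tendsto_of_tendsto h1 ((hω (t₀ hT)).const_mul C) ?_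
    filter_upwards [hC] with n hn
    rw [← psum_const_mul]
    exact abs_psum_le hn
  rw [hω0, mul_zero] at h2
  exact neg_eq_zero.1 (abs_nonpos_iff.1 h2)

end Ito

end PathwiseSPT
end

noncomputable section
namespace PathwiseSPT

variable {T : ℝ}

/-! ### Lebesgue–Stieltjes integrals -/

/-- The real function `t ↦ ν [0, t]` of a measure without atoms is continuous. -/
theorem continuous_measureReal_Iic (ν : Measure (Time T)) [IsFiniteMeasure ν]
    (hν : ∀ t, ν {t} = 0) : Continuous fun t => ν.real (Iic t) := by
  have h1 : (fun t => ν.real (Iic t)) = fun t => ∫ s, (Iic t).indicator (fun _ => (1 : ℝ)) s ∂ν := by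
    funext t
    rw [integral_indicator_const _ measurableSet_Iic]
    simp
  rw [h1, continuous_iff_continuousAt]
  intro t
  refine continuousAt_of_dominated (bound := fun _ => 1) ?_ ?_ (integrable_const _) ?_
  · exact Eventually.of_forall fun u =>
      ((measurable_const (a := (1 : ℝ))).indicator measurableSet_Iic).aestronglyMeasurable
  · refine Eventually.of_forall fun u => Eventually.of_forall fun s => ?_
    by_cases hs : s ≤ u <;> simp [indicator, hs]
  · have h2 : ∀ᵐ s ∂ν, s ≠ t := by
      rw [ae_iff]
      simpa using hν t
    filter_upwards [h2] with s hs
    rcases lt_or_gt_of_ne hs with h | h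
    · refine continuousAt_const.congr (f := fun _ => (1 : ℝ)) ?_
      filter_upwards [Ioi_mem_nhds h] with u hu
      exact (indicator_of_mem (mem_Iic.2 (mem_Ioi.1 hu).le) (fun _ => (1 : ℝ))).symm
    · refine continuousAt_const.congr (f := fun _ => (0 : ℝ)) ?_
      filter_upwards [Iio_mem_nhds h] with u hu
      exact (indicator_of_notMem (fun h' => absurd (mem_Iic.1 h') (not_le.2 hu))
        (fun _ => (1 : ℝ))).symm

theorem stieltjesIntegral_eq {f g : Time T → ℝ} (h : BoundedVariationOn g univ) (t : Time T) :
    stieltjesIntegral f g t = ∫ᵛ s in Iic t, f s ∂•h.vectorMeasure := by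
  rw [stieltjesIntegral, dif_pos h]

/-- The integral with respect to a continuous function of bounded variation is controlled by a
continuous increasing function. -/
theorem exists_stieltjesIntegral_bound (hT : 0 < T) {g : Time T → ℝ}
    (hg : BoundedVariationOn g univ) (hgc : Continuous g) :
    ∃ v : Time T → ℝ, Continuous v ∧ Monotone v ∧ v (t₀ hT) = 0 ∧
      (∀ a b, a ≤ b → |g b - g a| ≤ v b - v a) ∧
      ∀ f : Time T → ℝ, Continuous f → stieltjesIntegral f g (t₀ hT) = 0 ∧
        ∀ a b c ε, a ≤ b → (∀ s, a ≤ s → s ≤ b → |f s - c| ≤ ε) →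
          |stieltjesIntegral f g b - stieltjesIntegral f g a - c * (g b - g a)| ≤
            ε * (v b - v a) := by
  set κ := hg.vectorMeasure with hκ
  set ν := κ.variation with hν
  have hfin : IsFiniteMeasure ν := by
    rw [hν, ← SignedMeasure.totalVariation_eq_variation]
    infer_instance
  -- The mass of a point is the jump of `g` there. In particular time `0` contributes nothing to
  -- integrals over `[0, t]`.
  have hatom : ∀ t, ν {t} = 0 := by
    intro t
    rw [hν, VectorMeasure.variation_apply_eq_zero (measurableSet_singleton t)]
    intro s hs _
    rcases subset_singleton_iff_eq.1 hs with h | h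
    · rw [h, VectorMeasure.empty]
    · rw [h, hκ, hg.vectorMeasure_singleton, hgc.continuousWithinAt.rightLim_eq,
        hgc.continuousWithinAt.leftLim_eq, sub_self]
  have hIoc : ∀ a b, a ≤ b → ν.real (Ioc a b) = ν.real (Iic b) - ν.real (Iic a) := by
    intro a b hab
    rw [← Iic_sdiff_Iic, measureReal_sdiff (Iic_subset_Iic.2 hab) measurableSet_Iic]
  have hκIoc : ∀ a b, a ≤ b → κ (Ioc a b) = g b - g a := by
    intro a b hab
    rw [hκ, hg.vectorMeasure_Ioc hab, hgc.continuousWithinAt.rightLim_eq, hgc.continuousWithinAt.rightLim_eq]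
  have hIic0 : Iic (t₀ hT) = {t₀ hT} := by
    ext s
    exact ⟨fun h => le_antisymm h (t₀_le hT s), fun h => le_of_eq h⟩
  refine ⟨fun t => ν.real (Iic t), continuous_measureReal_Iic ν hatom, fun a b hab =>
    measureReal_mono (Iic_subset_Iic.2 hab), ?_, fun a b hab => ?_, fun f hf => ⟨?_, ?_⟩⟩
  · simp only [hIic0]
    rw [Measure.real, hatom, ENNReal.toReal_zero]
  · rw [← hIoc a b hab, ← hκIoc a b hab, ← Real.norm_eq_abs]
    exact VectorMeasure.norm_measure_le_variation (measure_ne_top ν _)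
  · rw [stieltjesIntegral_eq hg, hIic0]
    exact VectorMeasure.setIntegral_of_variation_apply_eq_zero f (hatom _)
  · intro a b c ε hab hb
    have hint : ∀ h : Time T → ℝ, Continuous h → κ.Integrable h := fun h hh =>
      hh.integrable_of_hasCompactSupport (HasCompactSupport.of_compactSpace h)
    have hsplit : stieltjesIntegral f g b - stieltjesIntegral f g a =
        ∫ᵛ s in Ioc a b, f s ∂•κ := by
      rw [stieltjesIntegral_eq hg, stieltjesIntegral_eq hg, ← Iic_union_Ioc_eq_Iic hab,
        VectorMeasure.setIntegral_union (Iic_disjoint_Ioc le_rfl) measurableSet_Iic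
          measurableSet_Ioc (hint f hf).restrict (hint f hf).restrict, add_sub_cancel_left]
    have hconst : c * (g b - g a) = ∫ᵛ _ in Ioc a b, c ∂•κ := by
      rw [VectorMeasure.setIntegral_const, hκIoc a b hab]
      rfl
    rw [hsplit, hconst, ← VectorMeasure.integral_fun_sub (hint f hf).restrict
      (hint _ continuous_const).restrict, ← hIoc a b hab, ← Real.norm_eq_abs]
    refine (VectorMeasure.norm_setIntegral_le_of_norm_le_const (C := ε)
      fun s hs => hb s hs.1.le hs.2).trans ?_
    rcases hab.eq_or_lt with h | h
    · simp [h]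
    have hε : 0 ≤ ε := (abs_nonneg _).trans (hb a le_rfl hab)
    refine mul_le_mul_of_nonneg_right ?_ measureReal_nonneg
    exact mul_le_of_le_one_right hε ContinuousLinearMap.opNorm_lsmul_le

/-- A constant factor may be moved from the integrator to the integrand. -/
theorem stieltjesIntegral_smul_eq (hT : 0 < T) {g : Time T → ℝ}
    (hg : BoundedVariationOn g univ) (hgc : Continuous g) {f : Time T → ℝ} (hf : Continuous f)
    {c : ℝ} (hcg : BoundedVariationOn (fun t => c * g t) univ) (t : Time T) :
    stieltjesIntegral f (fun t => c * g t) t = stieltjesIntegral (fun t => c * f t) g t := by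
  have hcgc : Continuous fun t => c * g t := by fun_prop
  have hcf : Continuous fun t => c * f t := by fun_prop
  obtain ⟨v₁, hv₁, -, -, hg₁, h₁⟩ := exists_stieltjesIntegral_bound hT hg hgc
  obtain ⟨v₂, hv₂, -, -, hg₂, h₂⟩ := exists_stieltjesIntegral_bound hT hcg hcgc
  have hloc : ∀ t : Time T, ∀ ε > 0, ∀ᶠ r in 𝓝 t, |f r - f t| < ε := fun t ε hε => by
    have := Metric.tendsto_nhds.1 (hf.tendsto t) ε hε
    simpa only [Real.dist_eq] using this
  obtain ⟨M, hM⟩ := isCompact_univ.exists_bound_of_continuousOn hf.continuousOn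
  obtain ⟨M', hM'⟩ := isCompact_univ.exists_bound_of_continuousOn hcf.continuousOn
  -- Where `f` is close to `k`, both integrals are close to `c * k` times the increment of `g`.
  -- Taking `k = 0` gives the global bound, `k = f t` the local one.
  have hconst : ∀ a b, a ≤ b → ∀ k ε, 0 ≤ ε → (∀ s, a ≤ s → s ≤ b → |f s - k| ≤ ε) →
      |(stieltjesIntegral f (fun t => c * g t) b - stieltjesIntegral (fun t => c * f t) g b)
        - (stieltjesIntegral f (fun t => c * g t) a - stieltjesIntegral (fun t => c * f t) g a)| ≤
      ε * ((v₂ b + |c| * v₁ b) - (v₂ a + |c| * v₁ a)) := by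
    intro a b hab k ε _ h
    have e1 := (h₂ f hf).2 a b k ε hab h
    have e2 := (h₁ _ hcf).2 a b (c * k) (|c| * ε) hab fun s hs hs' => by
      rw [← mul_sub, abs_mul]
      exact mul_le_mul_of_nonneg_left (h s hs hs') (abs_nonneg _)
    rw [abs_le] at *
    constructor <;> linarith [e1.1, e1.2, e2.1, e2.2]
  have key := eq_of_abs_sub_le (hT := hT) (φ := fun t => stieltjesIntegral f (fun t => c * g t) t
    - stieltjesIntegral (fun t => c * f t) g t) (ω := fun t => v₂ t + |c| * v₁ t) (C := M)
    (by fun_prop) (fun a b hab => hconst a b hab 0 M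
      ((norm_nonneg _).trans (hM a (mem_univ a))) fun s _ _ => by
        simpa using hM s (mem_univ s)) (fun t ht ε hε => by
      have hne : (𝓝[<] t).NeBot := nhdsLT_neBot_of_exists_lt ⟨_, ht⟩
      obtain ⟨r, hr, h⟩ := (mem_nhdsLT_iff_exists_Ioo_subset' ht).1
        (mem_nhdsWithin_of_mem_nhds (hloc t ε hε))
      obtain ⟨r', hr', hr't⟩ := exists_between (mem_Iio.1 hr)
      refine ⟨r', hr't, fun a b ha hab hb => hconst a b hab (f t) ε hε.le fun s hs hs' => ?_⟩
      have := h (a := s) ⟨hr'.trans_le (ha.trans hs), hs'.trans_lt hb⟩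
      exact (le_of_lt this)) t
  simp only [(h₁ _ hcf).1, (h₂ f hf).1, sub_self] at key
  exact sub_eq_zero.1 key

end PathwiseSPT
end

noncomputable section
namespace PathwiseSPT

variable {T : ℝ} {d m : ℕ}

/-! ### The integral that defines the multiplicatively generated strategy -/

/-- Partition sums vanish in the limit when, to the left of each time, the summands are close to
summands whose sums vanish in the limit. -/
theorem tendsto_psum_zero {hT : 0 < T} {P : ℕ → Finset (Time T)} (hP : IsRefiningPartition hT P)
    {δ w : ℕ → Time T → ℝ} {ω : Time T → ℝ} (hωc : Continuous ω) (hω0 : ω (t₀ hT) = 0)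
    (hω : ∀ t, Tendsto (fun n => psum (P n) (w n) t) atTop (𝓝 (ω t))) {C : ℝ}
    (hC : ∀ᶠ n in atTop, ∀ s ∈ P n, |δ n s| ≤ C * w n s)
    (hloc : ∀ t, t₀ hT < t → ∀ ε > 0, ∃ ℓ : ℕ → Time T → ℝ,
      (∀ b, Tendsto (fun n => psum (P n) (ℓ n) b) atTop (𝓝 0)) ∧ ∃ r < t,
      ∀ᶠ n in atTop, ∀ s ∈ P n, r < s → succ (P n) s < t → |δ n s - ℓ n s| ≤ ε * w n s)
    (t : Time T) : Tendsto (fun n => psum (P n) (δ n) t) atTop (𝓝 0) := by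
  obtain ⟨H, hH⟩ := exists_tendsto_psum hP hωc hω0 hω hC fun t ht ε hε => by
    obtain ⟨ℓ, hℓ, h⟩ := hloc t ht ε hε
    exact ⟨ℓ, fun _ => 0, hℓ, h⟩
  have h0 : H (t₀ hT) = 0 := by
    have h1 : |H (t₀ hT)| ≤ C * ω (t₀ hT) := by
      refine le_of_tendsto_of_tendsto (hH _).abs ((hω (t₀ hT)).const_mul C) ?_
      filter_upwards [hC] with n hn
      rw [← psum_const_mul]
      exact abs_psum_le hn
    rw [hω0, mul_zero] at h1
    exact abs_nonpos_iff.1 h1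
  -- The comparison sums vanish in the limit, so the local estimates bound the increments of `H`
  -- itself.
  have h1 : H t = 0 := by
    rw [eq_of_abs_sub_le (hT := hT) (C := C) hωc
      (fun a b hab => abs_limit_sub_le_of_abs_le hω hC le_rfl hH hab) ?_ t, h0]
    intro t ht ε hε
    obtain ⟨ℓ, hℓ, r, hr, h⟩ := hloc t ht ε hε
    refine ⟨r, hr, fun a b hra hab hbt => ?_⟩
    simpa using abs_limit_sub_le hP hω le_rfl hH (L := fun _ => 0) hℓ h hra hab hbt
  rw [← h1]
  exact hH t

theorem abs_exp_sub_exp_le {x y B : ℝ} (hx : x ≤ B) (hy : y ≤ B) :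
    |Real.exp x - Real.exp y| ≤ Real.exp B * |x - y| := by
  have key : ∀ x y : ℝ, x ≤ B → Real.exp x - Real.exp y ≤ Real.exp B * |x - y| := by
    intro x y hx
    have h1 := Real.add_one_le_exp (y - x)
    have h2 : Real.exp y = Real.exp x * Real.exp (y - x) := by
      rw [← Real.exp_add]
      congr 1
      ring
    have h3 : Real.exp x ≤ Real.exp B := Real.exp_le_exp.2 hx
    calc Real.exp x - Real.exp y ≤ Real.exp x * (x - y) := by
          rw [h2]
          nlinarith [Real.exp_pos x]
      _ ≤ Real.exp x * |x - y| := by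
          gcongr
          exact le_abs_self _
      _ ≤ Real.exp B * |x - y| := by gcongr
  rw [abs_le]
  have h1 := key x y hx
  have h2 := key y x hy
  rw [abs_sub_comm] at h2
  constructor <;> linarith

section Eta

variable {hT : 0 < T} {P : ℕ → Finset (Time T)} {U : Set (Vec d)} {W : Set (Vec m)}
  {X : Path T d} {A : Path T m} {G : Functional T d m}

/-- Discrete product rule, with `G` taken at the right and `K` at the left end of each interval. The
subtracted sum is the one that has to vanish in the limit. -/
theorem itoSum_etaFunctional_eq (hP : IsRefiningPartition hT P) (n : ℕ) (t : Time T) :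
    itoSum P (etaFunctional hT P G X A) X A t n =
      expGamma hT P G X A (succ (P n) t) *
          G (succ (P n) t) (leftApprox (P n) X (succ (P n) t)) A
        - expGamma hT P G X A (t₀ hT) * G (t₀ hT) (leftApprox (P n) X (t₀ hT)) A
        - psum (P n) (fun s => G (succ (P n) s) (leftApprox (P n) X (succ (P n) s)) A *
            (expGamma hT P G X A (succ (P n) s) - expGamma hT P G X A s)
          + expGamma hT P G X A s * itoRemainder P G X A n s) t := by
  rw [← psum_telescope hT (hP.zero_mem n) (hP.last_mem n)
    (fun s => expGamma hT P G X A s * G s (leftApprox (P n) X s) A) t, ← psum_sub]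
  refine psum_congr fun s _ => ?_
  have h : ∑ i, etaFunctional hT P G X A s (leftApprox (P n) X s) A i *
      (X (succ (P n) s) i - X s i) = expGamma hT P G X A s *
        ∑ i, vDeriv G i s (leftApprox (P n) X s) A * (X (succ (P n) s) i - X s i) := by
    rw [Finset.mul_sum]
    refine Finset.sum_congr rfl fun i _ => ?_
    simp only [etaFunctional]
    ring
  rw [h, itoRemainder]
  ring

theorem expGamma_zero (hP : IsRefiningPartition hT P) (hU : IsOpen U) (hW : IsOpen W)
    (hX : Continuous X) (hXU : ∀ t, X t ∈ U) (hcov : HasCovariations P X) (hAc : Continuous A)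
    (hA : IsBV W A) (hG : IsRegular hT P U W X A G) (hpos : ∀ t, 0 < G t X A) :
    expGamma hT P G X A (t₀ hT) = 1 := by
  obtain ⟨v, -, -, -, -, hv⟩ := exists_stieltjesIntegral_bound hT hG.gamma_bv
    (continuous_gammaFn hP hU hW hX hXU hcov hAc hA hG.c12)
  have hgc := continuous_functional hX hXU hAc hA hG.c12.continuous
  have hfc : Continuous fun s => 1 / G s X A := continuous_const.div hgc fun t => (hpos t).ne'
  rw [expGamma, (hv _ hfc).1, Real.exp_zero]

/-- The integrand `η` is integrable, and its integral is `G K - G(0)`. -/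
theorem hasItoIntegral_etaFunctional (hP : IsRefiningPartition hT P) (hU : IsOpen U)
    (hW : IsOpen W) (hX : Continuous X) (hXU : ∀ t, X t ∈ U) (hcov : HasCovariations P X)
    (hAc : Continuous A) (hA : IsBV W A) (hG : IsRegular hT P U W X A G)
    (hpos : ∀ t, 0 < G t X A) (t : Time T) :
    HasItoIntegral P (etaFunctional hT P G X A) X A t
      (expGamma hT P G X A t * G t X A - G (t₀ hT) X A) := by
  have hgc := continuous_functional hX hXU hAc hA hG.c12.continuous
  have hfc : Continuous fun s => 1 / G s X A := continuous_const.div hgc fun t => (hpos t).ne'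
  have hΓc := continuous_gammaFn hP hU hW hX hXU hcov hAc hA hG.c12
  have hΓ0 := gammaFn_zero hP hU hW hX hXU hcov hAc hA hG.c12
  have hIto := fun t => (hasItoIntegral_vGrad hP hU hW hX hXU hcov hAc hA hG.c12 t).2
  obtain ⟨v, hvc, hvm, hv0, hvΓ, hvf⟩ := exists_stieltjesIntegral_bound hT hG.gamma_bv hΓc
  replace hvf := (hvf _ hfc).2
  set Γ := gammaFn hT P G X A with hΓdef
  set k := stieltjesIntegral (fun s => 1 / G s X A) Γ with hkdef
  set K := expGamma hT P G X A with hKdef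
  have hKk : ∀ s, K s = Real.exp (k s) := fun s => rfl
  obtain ⟨M, hM⟩ := isCompact_univ.exists_bound_of_continuousOn hfc.continuousOn
  have hM0 : 0 ≤ M := (norm_nonneg _).trans (hM (t₀ hT) (mem_univ _))
  have hkv : ∀ a b, a ≤ b → |k b - k a| ≤ M * (v b - v a) := fun a b hab => by
    simpa using hvf a b 0 M hab fun s _ _ => by simpa using hM s (mem_univ s)
  have hkc : Continuous k := continuous_of_abs_sub_le hvc hkv
  have hKc : Continuous K := Real.continuous_exp.comp hkc
  obtain ⟨B, hB⟩ := isCompact_univ.exists_bound_of_continuousOn hkc.continuousOn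
  have hkB : ∀ s, k s ≤ B := fun s => (le_abs_self _).trans (hB s (mem_univ s))
  have hKB : ∀ s, K s ≤ Real.exp B := fun s => Real.exp_le_exp.2 (hkB s)
  have hKpos : ∀ s, 0 < K s := fun s => Real.exp_pos _
  have hKv : ∀ a b, a ≤ b → |K b - K a| ≤ Real.exp B * M * (v b - v a) := fun a b hab => by
    rw [mul_assoc]
    exact (abs_exp_sub_exp_le (hkB b) (hkB a)).trans
      (mul_le_mul_of_nonneg_left (hkv a b hab) (Real.exp_pos B).le)
  obtain ⟨Cg, hCg⟩ := hG.c12.tame.2 (range X) (range A) (isCompact_range hX)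
    (isCompact_range hAc) (range_subset_iff.2 hXU) (range_subset_iff.2 hA.cadlag.mem)
  have hAr : IsBV (range A) A := ⟨isCadlag_of_continuous hAc mem_range_self, hA.bv⟩
  have hgCg : ∀ s, |G s X A| ≤ Cg := fun s =>
    hCg s X A (isCadlag_of_continuous hX mem_range_self) hAr
  have hCg0 : 0 ≤ Cg := (abs_nonneg _).trans (hgCg (t₀ hT))
  have hGn : ∀ n, ∀ s ∈ P n, |G s (leftApprox (P n) X s) A| ≤ Cg := by
    intro n s hs
    refine hCg s _ A ?_ hAr
    rw [← stepPath_zero]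
    exact isCadlag_stepPath mem_range_self hs (by simp)
  obtain ⟨ω, hωc, hω0, hω⟩ := exists_tendsto_psum_itoWeight hP hX hcov hAc hA.bv
  obtain ⟨C, hC0, hC⟩ := exists_abs_itoRemainder_le hP hU hW hX hXU hAc hA hG.c12
  have hwn := fun n s => itoWeight_nonneg (hT := hT) (P := P) (X := X) hA.bv n s
  have herr : Tendsto (fun n => psum (P n)
      (fun s => G (succ (P n) s) (leftApprox (P n) X (succ (P n) s)) A *
        (K (succ (P n) s) - K s) + K s * itoRemainder P G X A n s) t) atTop (𝓝 0) := by
    refine tendsto_psum_zero hP (ω := fun t => ω t + (v t - v (t₀ hT)))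
      (w := fun n s => itoWeight hT P X A n s + (v (succ (P n) s) - v s))
      (C := Cg * (Real.exp B * M) + Real.exp B * C) (hωc.add (hvc.sub continuous_const))
      (by simp [hω0])
      (fun t => ?_) ?_ ?_ t
    · simp_rw [psum_add]
      exact (hω t).add (hP.tendsto_psum_telescope hvc t)
    · filter_upwards [hC] with n hn s hs
      have hv' := sub_nonneg.2 (hvm (le_succ (P n) s))
      have e1 : |G (succ (P n) s) (leftApprox (P n) X (succ (P n) s)) A *
          (K (succ (P n) s) - K s)| ≤ Cg * (Real.exp B * M * (v (succ (P n) s) - v s)) := by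
        rw [abs_mul]
        exact mul_le_mul (hGn n _ (succ_mem_of_mem hs)) (hKv _ _ (le_succ (P n) s))
          (abs_nonneg _) hCg0
      have e2 : |K s * itoRemainder P G X A n s| ≤
          Real.exp B * (C * itoWeight hT P X A n s) := by
        rw [abs_mul, abs_of_pos (hKpos s)]
        exact mul_le_mul (hKB s) (hn s hs) (abs_nonneg _) (Real.exp_pos B).le
      refine (abs_add_le _ _).trans ((add_le_add e1 e2).trans ?_)
      have e3 : 0 ≤ Cg * (Real.exp B * M) * itoWeight hT P X A n s :=
        mul_nonneg (mul_nonneg hCg0 (mul_nonneg (Real.exp_pos B).le hM0)) (hwn n s)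
      have e4 : 0 ≤ Real.exp B * C * (v (succ (P n) s) - v s) :=
        mul_nonneg (mul_nonneg (Real.exp_pos B).le hC0) hv'
      nlinarith
    · intro t ht ε₁ hε₁
      -- `Z` collects the constants of the four error terms `c1` to `c4` below.
      set Z := C + Real.exp B * M + Cg * M + Cg * Real.exp B + 1 with hZ
      have hBpos := Real.exp_pos B
      have hZ0 : 0 < Z := by positivity
      set ε := ε₁ / Z with hεdef
      have hε : 0 < ε := div_pos hε₁ hZ0
      -- Formally `G dK = K dΓ`. The sums of these comparison terms tend to zero, because the
      -- increments of `Γ` add up to `Γ` and the remainders to `-Γ`.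
      refine ⟨fun n s => K t * ((Γ (succ (P n) s) - Γ s) + itoRemainder P G X A n s),
        fun b => ?_, ?_⟩
      · simp_rw [psum_const_mul, psum_add]
        have h := ((hP.tendsto_psum_telescope hΓc b).add (hIto b)).const_mul (K t)
        rw [hΓ0, sub_zero, add_neg_cancel, mul_zero] at h
        exact h
      -- Strict differentiability is needed since neither end of the partition interval is `t`.
      have hstrict := ((Real.hasStrictDerivAt_exp (k t)).isLittleO).def hε
      obtain ⟨ρ, hρ, hGρ⟩ := exists_abs_sub_leftApprox_lt hP hX hXU hAc hA hG.c12.continuous t hε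
      have hne : (𝓝[<] t).NeBot := nhdsLT_neBot_of_exists_lt ⟨_, ht⟩
      have hev : ∀ᶠ q : Time T × Time T in 𝓝 t ×ˢ 𝓝 t,
          ‖Real.exp (k q.2) - Real.exp (k q.1) - (k q.2 - k q.1) • Real.exp (k t)‖ ≤
            ε * ‖k q.2 - k q.1‖ := by
        have h1 : Tendsto (fun q : Time T × Time T => (k q.2, k q.1)) (𝓝 t ×ˢ 𝓝 t)
            (𝓝 (k t, k t)) := by
          rw [← nhds_prod_eq]
          exact ((hkc.comp continuous_snd).prodMk (hkc.comp continuous_fst)).tendsto _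
        refine (h1.eventually hstrict).mono fun q hq => ?_
        simpa using hq
      obtain ⟨N, hN, hNN⟩ := mem_prod_self_iff.1 hev
      have hKt : ∀ᶠ s in 𝓝 t, |K s - K t| < ε := by
        simpa only [Real.dist_eq] using Metric.tendsto_nhds.1 (hKc.tendsto t) ε hε
      have hft : ∀ᶠ s in 𝓝 t, |1 / G s X A - 1 / G t X A| < ε := by
        simpa only [Real.dist_eq] using Metric.tendsto_nhds.1 (hfc.tendsto t) ε hε
      have hρt : ∀ᶠ s : Time T in 𝓝 t, |(t : ℝ) - s| < ρ := by
        filter_upwards [Metric.ball_mem_nhds t hρ] with s hs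
        rwa [Metric.mem_ball, dist_comm, Subtype.dist_eq, Real.dist_eq] at hs
      obtain ⟨r, hr, hrt⟩ := (mem_nhdsLT_iff_exists_Ioo_subset' ht).1
        (mem_nhdsWithin_of_mem_nhds
          (inter_mem hN (hKt.and (hft.and hρt))))
      refine ⟨r, hr, ?_⟩
      filter_upwards [hC, hGρ] with n hn hGn' s hs hrs hst
      have hss := le_succ (P n) s
      have hs1 := hrt ⟨hrs, hss.trans_lt hst⟩
      have hs2 := hrt ⟨hrs.trans_le hss, hst⟩
      set s' := succ (P n) s with hs'
      have hv' : 0 ≤ v s' - v s := sub_nonneg.2 (hvm hss)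
      set g' := G s' (leftApprox (P n) X s') A with hg'
      have b1 : |g' - G t X A| ≤ ε := by
        rw [abs_sub_comm]
        exact (hGn' s' (succ_mem_of_mem hs) hs2.2.2.2).le
      have b2 : |(K s' - K s) - K t * (k s' - k s)| ≤ ε * |k s' - k s| := by
        have := hNN (mk_mem_prod hs1.1 hs2.1)
        simp only [mem_ofPred_eq] at this
        rw [Real.norm_eq_abs, Real.norm_eq_abs, smul_eq_mul, mul_comm (k s' - k s)] at this
        exact this
      have b3 : |(k s' - k s) - 1 / G t X A * (Γ s' - Γ s)| ≤ ε * (v s' - v s) :=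
        hvf s s' _ ε hss fun u hsu hus =>
          (hrt (⟨hrs.trans_le hsu, hus.trans_lt hst⟩ : u ∈ Ioo r t)).2.2.1.le
      have b4 := hkv s s' hss
      have b5 := hKv s s' hss
      have b6 := hn s hs
      have c1 : |(K s - K t) * itoRemainder P G X A n s| ≤
          ε * (C * itoWeight hT P X A n s) := by
        rw [abs_mul]
        exact mul_le_mul hs1.2.1.le b6 (abs_nonneg _) hε.le
      have c2 : |(g' - G t X A) * (K s' - K s)| ≤ ε * (Real.exp B * M * (v s' - v s)) := by
        rw [abs_mul]
        exact mul_le_mul b1 b5 (abs_nonneg _) hε.le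
      have c3 : |G t X A * ((K s' - K s) - K t * (k s' - k s))| ≤
          Cg * (ε * (M * (v s' - v s))) := by
        rw [abs_mul]
        exact mul_le_mul (hgCg t) (b2.trans (mul_le_mul_of_nonneg_left b4 hε.le))
          (abs_nonneg _) hCg0
      have c4 : |G t X A * K t * ((k s' - k s) - 1 / G t X A * (Γ s' - Γ s))| ≤
          Cg * Real.exp B * (ε * (v s' - v s)) := by
        rw [abs_mul, abs_mul, abs_of_pos (hKpos t)]
        exact mul_le_mul (mul_le_mul (hgCg t) (hKB t) (hKpos t).le hCg0) b3 (abs_nonneg _)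
          (mul_nonneg hCg0 hBpos.le)
      have hgt := (hpos t).ne'
      -- Four replacements: `K s` by `K t`, the value `g'` by `G t X A`, the increment of `K` by its
      -- linearisation, and the increment of `k` by that of `Γ` divided by `G t X A`.
      calc _ = |(K s - K t) * itoRemainder P G X A n s + (g' - G t X A) * (K s' - K s)
            + G t X A * ((K s' - K s) - K t * (k s' - k s))
            + G t X A * K t * ((k s' - k s) - 1 / G t X A * (Γ s' - Γ s))| := by
            congr 1
            field_simp
            ring
        _ ≤ ε * (C * itoWeight hT P X A n s) + ε * (Real.exp B * M * (v s' - v s))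
            + Cg * (ε * (M * (v s' - v s))) + Cg * Real.exp B * (ε * (v s' - v s)) :=
            (abs_add_le _ _).trans (add_le_add ((abs_add_le _ _).trans
              (add_le_add ((abs_add_le _ _).trans (add_le_add c1 c2)) c3)) c4)
        _ ≤ ε * Z * (itoWeight hT P X A n s + (v s' - v s)) := by
            have hw := hwn n s
            have f1 : 0 ≤ ε * (Real.exp B * M + Cg * M + Cg * Real.exp B + 1) *
              itoWeight hT P X A n s := by positivity
            have f2 : 0 ≤ ε * (C + 1) * (v s' - v s) := by positivity
            rw [hZ]
            linarith
        _ = ε₁ * (itoWeight hT P X A n s + (v s' - v s)) := by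
            rw [hεdef]
            field_simp
  have hK0 : K (t₀ hT) = 1 := expGamma_zero hP hU hW hX hXU hcov hAc hA hG hpos
  have hmain := ((((hKc.tendsto t).comp (hP.tendsto_succ t)).mul
    (tendsto_leftApprox_succ hP hX hXU hAc hA hG.c12.continuous t)).sub
    ((tendsto_leftApprox_zero hP hX hXU hAc hA hG.c12.continuous).const_mul
      (K (t₀ hT)))).sub herr
  rw [hK0, one_mul, sub_zero] at hmain
  exact hmain.congr fun n => (by
    rw [itoSum_etaFunctional_eq hP n t, ← hKdef, hK0, one_mul]
    rfl)

end Eta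

end PathwiseSPT
end

noncomputable section
namespace PathwiseSPT

variable {T : ℝ} {d m : ℕ}

/-! ### Affine transformations of functionals -/

/-- The functional `a F + b`. -/
def affine (a b : ℝ) (F : Functional T d m) : Functional T d m := fun t Y B => a * F t Y B + b

theorem shifted_eq_affine (G : Functional T d m) {c : ℝ} (hc : 0 < c) :
    shifted G c = affine (1 / (1 + c)) (c / (1 + c)) G := by
  funext t Y B
  have : 1 + c ≠ 0 := by positivity
  simp only [shifted, affine]
  field_simp

section Affine

variable {U : Set (Vec d)} {W : Set (Vec m)} {F D : Functional T d m} (a b : ℝ)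

theorem abs_mul_lt_of_lt {x ε : ℝ} (hε : 0 < ε) (hx : |x| < ε / (|a| + 1)) : |a * x| < ε := by
  have ha : 0 < |a| + 1 := by positivity
  rw [lt_div_iff₀ ha] at hx
  rw [abs_mul]
  rcases (abs_nonneg x).eq_or_lt with h | h
  · rw [← h, mul_zero]
    exact hε
  · nlinarith

theorem affine_sub_affine (t t' : Time T) (X X' : Path T d) (A A' : Path T m) :
    affine a b F t X A - affine a b F t' X' A' = a * (F t X A - F t' X' A') := by
  simp only [affine]
  ring

theorem vDeriv_affine (i : Fin d) : vDeriv (affine a b F) i = affine a 0 (vDeriv F i) := by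
  funext t X A
  simp only [vDeriv, affine, deriv_add_const, add_zero]
  exact deriv_const_mul_field a

theorem IsNonAnticipative.affine (h : IsNonAnticipative U W F) :
    IsNonAnticipative U W (affine a b F) := fun t X A hX hA => by
  simp only [PathwiseSPT.affine]
  rw [h t X A hX hA]

theorem IsContinuousFunctional.affine (h : IsContinuousFunctional U W F) :
    IsContinuousFunctional U W (affine a b F) := fun ε hε t X A hX hA => by
  obtain ⟨η, hη, h1⟩ := h (ε / (|a| + 1)) (by positivity) t X A hX hA
  refine ⟨η, hη, fun t' X' A' hX' hA' hc => ?_⟩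
  rw [affine_sub_affine]
  exact abs_mul_lt_of_lt a hε (h1 t' X' A' hX' hA' hc)

theorem IsTame.affine (h : IsTame U W F) : IsTame U W (affine a b F) := by
  refine ⟨fun ε hε t X A hX hA => ?_, fun K L hK hL hKU hLW => ?_⟩
  · obtain ⟨η, hη, h1⟩ := h.1 (ε / (|a| + 1)) (by positivity) t X A hX hA
    refine ⟨η, hη, fun t' X' A' hX' hA' ht hc => ?_⟩
    rw [affine_sub_affine]
    exact abs_mul_lt_of_lt a hε (h1 t' X' A' hX' hA' ht hc)
  · obtain ⟨C, hC⟩ := h.2 K L hK hL hKU hLW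
    refine ⟨|a| * C + |b|, fun t X A hX hA => (abs_add_le _ _).trans ?_⟩
    rw [abs_mul]
    gcongr
    exact hC t X A hX hA

theorem IsTimeDerivative.affine (h : IsTimeDerivative U W F D) :
    IsTimeDerivative U W (affine a b F) (affine a 0 D) := fun t X A hX hA ht => by
  have h1 := (h t X A hX hA ht).const_mul a
  simp only [PathwiseSPT.affine, add_zero]
  refine h1.congr fun s => ?_
  rw [mul_div_assoc']
  congr 1
  ring

theorem IsHorizontalDerivative.affine {k : Fin m} (h : IsHorizontalDerivative U W k F D) :
    IsHorizontalDerivative U W k (affine a b F) (affine a 0 D) :=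
  fun t X A hX hA ht ε hε => by
  have ha : 0 < |a| + 1 := by positivity
  filter_upwards [h t X A hX hA ht (ε / (|a| + 1)) (by positivity)] with s hs hBV
  have h1 := hs hBV
  rw [affine_sub_affine]
  simp only [PathwiseSPT.affine, add_zero]
  rw [mul_assoc, ← mul_sub, abs_mul]
  calc _ ≤ |a| * (ε / (|a| + 1) * |A t k - A s k|) := by gcongr
    _ = |a| / (|a| + 1) * (ε * |A t k - A s k|) := by ring
    _ ≤ 1 * (ε * |A t k - A s k|) := by
        gcongr
        rw [div_le_one ha]
        linarith
    _ = _ := one_mul _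

theorem IsVerticallyDifferentiable.affine (h : IsVerticallyDifferentiable U W F) :
    IsVerticallyDifferentiable U W (affine a b F) := fun t X A hX hA =>
  ((h t X A hX hA).const_mul a).add_const b

theorem IsC12.affine (h : IsC12 U W F) : IsC12 U W (affine a b F) where
  nonAnticipative := h.nonAnticipative.affine a b
  continuous := h.continuous.affine a b
  tame := h.tame.affine a b
  timeDerivative := by
    obtain ⟨D₀, h1, h2, h3⟩ := h.timeDerivative
    exact ⟨_, h1.affine a 0, h2.affine a b, h3.affine a 0⟩
  horizontalDerivative := fun k => by
    obtain ⟨D, h1, h2, h3⟩ := h.horizontalDerivative k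
    exact ⟨_, h1.affine a 0, h2.affine a b, h3.affine a 0⟩
  vDiff := h.vDiff.affine a b
  vDeriv_tame := fun i => by
    rw [vDeriv_affine]
    exact (h.vDeriv_tame i).affine a 0
  vDiff_vDeriv := fun i => by
    rw [vDeriv_affine]
    exact (h.vDiff_vDeriv i).affine a 0
  vDeriv_vDeriv_tame := fun i j => by
    rw [vDeriv_affine, vDeriv_affine]
    exact (h.vDeriv_vDeriv_tame i j).affine a 0

end Affine

section Strategy

variable {hT : 0 < T} {P : ℕ → Finset (Time T)} {U : Set (Vec d)} {W : Set (Vec m)}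
  {X : Path T d} {A : Path T m} {G : Functional T d m}

/-- The integral is a `limUnder`, so its linearity depends on the existence of the integral for `G`.
The constant `b` drops out of the gradient and of the difference of values. -/
theorem gammaFn_affine (hP : IsRefiningPartition hT P) (hU : IsOpen U)
    (hW : IsOpen W) (hX : Continuous X) (hXU : ∀ t, X t ∈ U) (hcov : HasCovariations P X)
    (hAc : Continuous A) (hA : IsBV W A) (hG : IsC12 U W G) (a b : ℝ) :
    gammaFn hT P (affine a b G) X A = fun t => a * gammaFn hT P G X A t := by
  funext t
  have h1 := (hasItoIntegral_vGrad hP hU hW hX hXU hcov hAc hA hG t).1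
  have h2 : Tendsto (itoSum P (vGrad (affine a b G)) X A t) atTop
      (𝓝 (a * itoIntegral P (vGrad G) X A t)) := by
    refine (h1.const_mul a).congr fun n => ?_
    simp only [itoSum, Finset.mul_sum, vGrad, vDeriv_affine, affine]
    exact Finset.sum_congr rfl fun s _ => Finset.sum_congr rfl fun i _ => by ring
  have h3 : itoIntegral P (vGrad (affine a b G)) X A t = a * itoIntegral P (vGrad G) X A t :=
    h2.limUnder_eq
  simp only [gammaFn, h3, affine]
  ring

theorem IsRegular.affine (hP : IsRefiningPartition hT P) (hU : IsOpen U)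
    (hW : IsOpen W) (hX : Continuous X) (hXU : ∀ t, X t ∈ U) (hcov : HasCovariations P X)
    (hAc : Continuous A) (hA : IsBV W A) (hG : IsRegular hT P U W X A G) (a b : ℝ) :
    IsRegular hT P U W X A (affine a b G) := by
  refine ⟨hG.c12.affine a b, ?_⟩
  rw [gammaFn_affine hP hU hW hX hXU hcov hAc hA hG.c12]
  refine boundedVariationOn_of_dist_le (hT := hT)
    (ω := fun t => |a| * cumVar hT (gammaFn hT P G X A) t) fun u v huv => ?_
  rw [Real.dist_eq, ← mul_sub, abs_mul, ← mul_sub, ← Real.dist_eq]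
  exact mul_le_mul_of_nonneg_left (dist_le_cumVar_sub hT hG.gamma_bv huv) (abs_nonneg a)

/-! ### Multiplicatively generated strategies -/

/-- Non-anticipativity is known only at admissible paths. As `U` is open, small bumps remain
admissible, and the derivative depends on nothing else. -/
theorem IsNonAnticipative.vDeriv (hU : IsOpen U) (h : IsNonAnticipative U W G) (i : Fin d) :
    IsNonAnticipative U W (vDeriv G i) := by
  intro t Y B hY hB
  have hev : ∀ᶠ θ : ℝ in 𝓝 0, IsCadlag U (bump Y t (EuclideanSpace.single i θ)) := by
    have hc : Tendsto (fun θ : ℝ => EuclideanSpace.single i θ) (𝓝 0) (𝓝 (0 : Vec d)) := by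
      have h1 : Continuous fun θ : ℝ => θ • EuclideanSpace.single i (1 : ℝ) := by fun_prop
      have h2 := h1.tendsto 0
      rw [zero_smul] at h2
      refine h2.congr fun θ => ?_
      ext j
      simp
    exact hc.eventually (eventually_isCadlag_bump hU hY t)
  refine Filter.EventuallyEq.deriv_eq ?_
  filter_upwards [hev] with θ hθ
  rw [h t _ B hθ hB, stopAt_bump, bump_stopAt]

theorem isNonAnticipative_multStrategy (hU : IsOpen U) (h : IsNonAnticipative U W G) :
    IsNonAnticipative U W (multStrategy hT P G X A) := by
  intro t Y B hY hB
  unfold multStrategy etaFunctional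
  congr 1
  funext i
  simp only
  rw [h.vDeriv hU i t Y B hY hB]

/-- The components of `X` sum to one, so their increments sum to zero, and terms common to all
components of the strategy drop out. -/
theorem itoSum_multStrategy_eq (hsum : ∀ t, ∑ i, X t i = 1) (t : Time T) (n : ℕ) :
    itoSum P (multStrategy hT P G X A) X A t n = itoSum P (etaFunctional hT P G X A) X A t n := by
  refine Finset.sum_congr rfl fun s _ => ?_
  have h : ∑ i, (X (succ (P n) s) i - X s i) = 0 := by
    rw [Finset.sum_sub_distrib, hsum, hsum, sub_self]
  simp only [multStrategy, sub_mul, Finset.sum_sub_distrib, ← Finset.mul_sum, h, mul_zero,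
    sub_zero]

/-- The value of the strategy multiplicatively generated by `G` is `G K`. -/
theorem value_multStrategy (hP : IsRefiningPartition hT P) (hU : IsOpen U)
    (hW : IsOpen W) (hX : Continuous X) (hXU : ∀ t, X t ∈ U) (hcov : HasCovariations P X)
    (hAc : Continuous A) (hA : IsBV W A) (hG : IsRegular hT P U W X A G)
    (hpos : ∀ t, 0 < G t X A) (hsum : ∀ t, ∑ i, X t i = 1) (t : Time T) :
    value (multStrategy hT P G X A) X A t = expGamma hT P G X A t * G t X A := by
  have h1 : itoIntegral P (etaFunctional hT P G X A) X A t =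
      expGamma hT P G X A t * G t X A - G (t₀ hT) X A :=
    (hasItoIntegral_etaFunctional hP hU hW hX hXU hcov hAc hA hG hpos t).limUnder_eq
  have h2 : value (multStrategy hT P G X A) X A t = value (etaFunctional hT P G X A) X A t
      - defect hT P (etaFunctional hT P G X A) X A t - balanceDefect hT G X A := by
    simp only [value, multStrategy, sub_mul, Finset.sum_sub_distrib, ← Finset.mul_sum, hsum,
      mul_one]
  have h3 : value (etaFunctional hT P G X A) X A (t₀ hT) =
      ∑ i, vDeriv G i (t₀ hT) X A * X (t₀ hT) i := by
    simp only [value, etaFunctional, expGamma_zero hP hU hW hX hXU hcov hAc hA hG hpos, mul_one]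
  rw [h2, defect, h1, h3, balanceDefect]
  ring

theorem isTradingStrategy_multStrategy (hP : IsRefiningPartition hT P) (hU : IsOpen U)
    (hW : IsOpen W) (hX : Continuous X) (hXU : ∀ t, X t ∈ U) (hcov : HasCovariations P X)
    (hAc : Continuous A) (hA : IsBV W A) (hG : IsRegular hT P U W X A G)
    (hpos : ∀ t, 0 < G t X A) (hsum : ∀ t, ∑ i, X t i = 1) :
    IsTradingStrategy hT P U W X A (multStrategy hT P G X A) := by
  refine ⟨isNonAnticipative_multStrategy hU hG.c12.nonAnticipative, fun t => ?_⟩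
  rw [value_multStrategy hP hU hW hX hXU hcov hAc hA hG hpos hsum,
    value_multStrategy hP hU hW hX hXU hcov hAc hA hG hpos hsum,
    expGamma_zero hP hU hW hX hXU hcov hAc hA hG hpos, one_mul]
  exact (hasItoIntegral_etaFunctional hP hU hW hX hXU hcov hAc hA hG hpos t).congr fun n =>
    (itoSum_multStrategy_eq hsum t n).symm

/-! ### Market weights -/

theorem IsCapitalization.continuous_marketWeights {S : Path T d} (hS : IsCapitalization hT S) :
    Continuous (marketWeights S) := by
  have h : ∀ i, Continuous fun t => S t i := fun i => by
    have h := (EuclideanSpace.proj (𝕜 := ℝ) i).continuous.comp hS.continuous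
    exact h
  refine (PiLp.continuous_toLp 2 _).comp (continuous_pi fun i => ?_)
  exact (h i).div (continuous_finsetSum _ fun j _ => h j) fun t => (hS.total_pos t).ne'

theorem IsCapitalization.sum_marketWeights {S : Path T d} (hS : IsCapitalization hT S)
    (t : Time T) : ∑ i, marketWeights S t i = 1 := by
  simp only [marketWeights]
  rw [← Finset.sum_div, div_self (hS.total_pos t).ne']

/-! ### The exponential of the shifted functional -/

/-- A lower bound for the exponent of the wealth generated by `(G + c) / (1 + c)`. -/
theorem exists_le_stieltjesIntegral (hP : IsRefiningPartition hT P) (hU : IsOpen U)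
    (hW : IsOpen W) (hX : Continuous X) (hXU : ∀ t, X t ∈ U) (hcov : HasCovariations P X)
    (hAc : Continuous A) (hA : IsBV W A) (hG : IsRegular hT P U W X A G)
    (hnonneg : ∀ t, 0 ≤ G t X A) :
    ∃ R : ℝ, 0 ≤ R ∧ ∀ c > 0, ∀ t, gammaFn hT P G X A t / c - R / (c * c) ≤
      stieltjesIntegral (fun s => 1 / shifted G c s X A)
        (gammaFn hT P (shifted G c) X A) t := by
  have hgc := continuous_functional hX hXU hAc hA hG.c12.continuous
  have hΓc := continuous_gammaFn hP hU hW hX hXU hcov hAc hA hG.c12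
  have hΓ0 := gammaFn_zero hP hU hW hX hXU hcov hAc hA hG.c12
  obtain ⟨v, hvc, hvm, hv0, hvΓ, hvf⟩ := exists_stieltjesIntegral_bound hT hG.gamma_bv hΓc
  obtain ⟨M, hM⟩ := isCompact_univ.exists_bound_of_continuousOn hgc.continuousOn
  have hM0 : 0 ≤ M := (norm_nonneg _).trans (hM (t₀ hT) (mem_univ _))
  have hMG : ∀ s, G s X A ≤ M := fun s => (le_abs_self _).trans (hM s (mem_univ s))
  set last : Time T := ⟨T, hT.le, le_rfl⟩
  have hvlast : ∀ t, v t ≤ v last := fun t => hvm t.2.2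
  have hv0' : 0 ≤ v last := hv0 ▸ hvlast (t₀ hT)
  -- `M` bounds `G` along the pair on the whole time interval, and `v` controls integrals against
  -- `Γ`; neither involves `c`.
  refine ⟨M * v last, mul_nonneg hM0 hv0', fun c hc t => ?_⟩
  have hc1 : 0 < 1 + c := by positivity
  have hGc : ∀ s, 0 < G s X A + c := fun s => by linarith [hnonneg s]
  have hreg := hG.affine hP hU hW hX hXU hcov hAc hA (1 / (1 + c)) (c / (1 + c))
  have hbv := hreg.gamma_bv
  rw [gammaFn_affine hP hU hW hX hXU hcov hAc hA hG.c12] at hbv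
  have hscont : Continuous fun s => 1 / shifted G c s X A := by
    refine continuous_const.div ((hgc.add continuous_const).div_const _) fun s => ?_
    exact (div_pos (hGc s) hc1).ne'
  have heq : stieltjesIntegral (fun s => 1 / shifted G c s X A)
      (gammaFn hT P (shifted G c) X A) t =
      stieltjesIntegral (fun s => 1 / (G s X A + c)) (gammaFn hT P G X A) t := by
    have h1 : gammaFn hT P (shifted G c) X A = fun t => 1 / (1 + c) * gammaFn hT P G X A t := by
      rw [shifted_eq_affine G hc]
      exact gammaFn_affine hP hU hW hX hXU hcov hAc hA hG.c12 _ _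
    rw [h1, stieltjesIntegral_smul_eq hT hG.gamma_bv hΓc hscont hbv]
    congr 1
    funext s
    have := (hGc s).ne'
    simp only [shifted]
    field_simp
  rw [heq]
  have hfc : Continuous fun s => 1 / (G s X A + c) :=
    continuous_const.div (hgc.add continuous_const) fun s => (hGc s).ne'
  -- As `0 ≤ G ≤ M` along the pair, the integrand lies within `M / (c * c)` of `1 / c`.
  have h2 := (hvf _ hfc).2 (t₀ hT) t (1 / c) (M / (c * c)) (t₀_le hT t) fun s _ _ => by
    have e1 : 1 / (G s X A + c) - 1 / c = -(G s X A / ((G s X A + c) * c)) := by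
      have := (hGc s).ne'
      field_simp
      ring
    rw [e1, abs_neg, abs_of_nonneg (div_nonneg (hnonneg s) (mul_pos (hGc s) hc).le)]
    refine div_le_div₀ hM0 (hMG s) (mul_pos hc hc) ?_
    exact mul_le_mul_of_nonneg_right (by linarith [hnonneg s]) hc.le
  rw [(hvf _ hfc).1, hΓ0, hv0, sub_zero, sub_zero, sub_zero] at h2
  have h3 := (abs_le.1 h2).1
  have h4 : M / (c * c) * v t ≤ M / (c * c) * v last :=
    mul_le_mul_of_nonneg_left (hvlast t) (by positivity)
  have h5 : M / (c * c) * v last = M * v last / (c * c) := by ring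
  have h6 : 1 / c * gammaFn hT P G X A t = gammaFn hT P G X A t / c := by ring
  linarith

end Strategy

end PathwiseSPT
end

/-! ### The choice of the shift and the arbitrage -/

theorem mainTheorem3 {T : ℝ} (hT : 0 < T) {d m : ℕ} (hd : 2 ≤ d)
    (P : ℕ → Finset (PathwiseSPT.Time T)) (hP : PathwiseSPT.IsRefiningPartition hT P)
    (U : Set (PathwiseSPT.Vec d)) (hU : IsOpen U)
    (W : Set (PathwiseSPT.Vec m)) (hW : IsOpen W)
    (S : PathwiseSPT.Path T d) (hS : PathwiseSPT.IsCapitalization hT S)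
    (μ : PathwiseSPT.Path T d) (hμ : μ = PathwiseSPT.marketWeights S)
    (hμU : ∀ t, μ t ∈ U) (hcov : PathwiseSPT.HasCovariations P μ)
    (A : PathwiseSPT.Path T m) (hAc : Continuous A) (hA : PathwiseSPT.IsBV W A)
    (G : PathwiseSPT.Functional T d m)
    (hG : PathwiseSPT.IsRegular hT P U W μ A G)
    (hG_nonneg : ∀ t Y B, PathwiseSPT.IsCadlag U Y → PathwiseSPT.IsBV W B → 0 ≤ G t Y B)
    (hG_init : G (PathwiseSPT.t₀ hT) μ A = 1)
    (hbdd : (∃ κ : ℝ, ∀ t Y B, PathwiseSPT.IsCadlag U Y → PathwiseSPT.IsBV W B → G t Y B ≤ κ) ∨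
      ∃ L : Set (PathwiseSPT.Vec m), IsCompact L ∧ ∀ t, A t ∈ L)
    (Tstar : PathwiseSPT.Time T) (hTstar : 0 < (Tstar : ℝ))
    (ε : ℝ) (hε : 0 < ε) (hΓ : 1 + ε < PathwiseSPT.gammaFn hT P G μ A Tstar) :
    ∃ c : ℝ, 0 < c ∧
      PathwiseSPT.IsMultGenerator hT P U W μ A (PathwiseSPT.shifted G c) ∧
      PathwiseSPT.IsTradingStrategy hT P U W μ A
        (PathwiseSPT.multStrategy hT P (PathwiseSPT.shifted G c) μ A) ∧
      PathwiseSPT.IsStrongArbitrage hT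
        (PathwiseSPT.value (PathwiseSPT.multStrategy hT P (PathwiseSPT.shifted G c) μ A) μ A)
        Tstar ∧
      (Monotone (PathwiseSPT.gammaFn hT P G μ A) → ∀ t, Tstar ≤ t →
        PathwiseSPT.IsStrongArbitrage hT
          (PathwiseSPT.value (PathwiseSPT.multStrategy hT P (PathwiseSPT.shifted G c) μ A) μ A)
          t) := by
  subst hμ
  have hX := hS.continuous_marketWeights
  have hsum := hS.sum_marketWeights
  set X := PathwiseSPT.marketWeights S with hXdef
  have hXcad := PathwiseSPT.isCadlag_of_continuous hX hμU
  have hnonneg : ∀ t, 0 ≤ G t X A := fun t => hG_nonneg t X A hXcad hA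
  obtain ⟨R, hR, hexp⟩ := PathwiseSPT.exists_le_stieltjesIntegral hP hU hW hX hμU hcov hAc hA hG
    hnonneg
  have hRε : 0 ≤ R / ε := div_nonneg hR hε.le
  -- Any positive `c` with `R ≤ ε * c` would do; the `1` keeps it positive when `R = 0`.
  refine ⟨R / ε + 1, by positivity, ?_⟩
  set c := R / ε + 1 with hcdef
  have hc : 0 < c := by positivity
  have hc1 : 0 < 1 + c := by positivity
  have hRc : R ≤ ε * c := by
    rw [hcdef, mul_add, mul_div_cancel₀ R hε.ne']
    linarith
  have hreg : PathwiseSPT.IsRegular hT P U W X A (PathwiseSPT.shifted G c) := by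
    rw [PathwiseSPT.shifted_eq_affine G hc]
    exact hG.affine hP hU hW hX hμU hcov hAc hA _ _
  have hlow : ∀ t, c / (1 + c) ≤ PathwiseSPT.shifted G c t X A := fun t =>
    div_le_div_of_nonneg_right (by linarith [hnonneg t]) hc1.le
  have hpos : ∀ t, 0 < PathwiseSPT.shifted G c t X A := fun t => (div_pos hc hc1).trans_le (hlow t)
  have hval := PathwiseSPT.value_multStrategy hP hU hW hX hμU hcov hAc hA hreg hpos hsum
  -- Since `c` is the same for all `t`, this covers `Tstar` as well as, for monotone `Γ`, every
  -- later time.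
  have harb : ∀ t, 1 + ε < PathwiseSPT.gammaFn hT P G X A t → PathwiseSPT.IsStrongArbitrage hT
      (PathwiseSPT.value (PathwiseSPT.multStrategy hT P (PathwiseSPT.shifted G c) X A) X A) t := by
    intro t ht
    refine ⟨fun u _ => ?_, ?_⟩
    · rw [hval]
      exact mul_nonneg (Real.exp_pos _).le (hpos u).le
    · have h0 : PathwiseSPT.shifted G c (PathwiseSPT.t₀ hT) X A = 1 := by
        rw [PathwiseSPT.shifted, hG_init, div_self hc1.ne']
      rw [hval, hval, PathwiseSPT.expGamma_zero hP hU hW hX hμU hcov hAc hA hreg hpos, one_mul, h0]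
      have h1 := hexp c hc t
      have h2 : PathwiseSPT.gammaFn hT P G X A t / c - R / (c * c) =
          (PathwiseSPT.gammaFn hT P G X A t - R / c) / c := by
        field_simp
      have h3 : R / c ≤ ε := by rwa [div_le_iff₀ hc]
      have h4 : 1 / c < (PathwiseSPT.gammaFn hT P G X A t - R / c) / c :=
        div_lt_div_of_pos_right (by linarith) hc
      have h5 : 1 + 1 / c < PathwiseSPT.expGamma hT P (PathwiseSPT.shifted G c) X A t := by
        refine lt_of_lt_of_le ?_ (Real.add_one_le_exp _)
        linarith
      -- Here the threshold `1` for `Γ` originates: a growth factor `1 + 1 / c` exactly offsets the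
      -- lower bound `c / (1 + c)` of the shifted functional.
      have h6 : (1 + 1 / c) * (c / (1 + c)) = 1 := by field_simp; ring
      calc (1 : ℝ) = (1 + 1 / c) * (c / (1 + c)) := h6.symm
        _ < PathwiseSPT.expGamma hT P (PathwiseSPT.shifted G c) X A t * (c / (1 + c)) :=
            mul_lt_mul_of_pos_right h5 (div_pos hc hc1)
        _ ≤ _ := mul_le_mul_of_nonneg_left (hlow t) (Real.exp_pos _).le
  refine ⟨⟨hreg, fun t Y B hY hB => ?_, hpos, ⟨(1 + c) / c, fun t => ?_⟩, fun t => ?_⟩,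
    PathwiseSPT.isTradingStrategy_multStrategy hP hU hW hX hμU hcov hAc hA hreg hpos hsum,
    harb Tstar hΓ, fun hmono t ht => harb t (hΓ.trans_le (hmono ht))⟩
  · exact div_nonneg (add_nonneg (hG_nonneg t Y B hY hB) hc.le) hc1.le
  · rw [one_div, inv_le_comm₀ (hpos t) (div_pos hc1 hc), inv_div]
    exact hlow t
  · exact ⟨_, PathwiseSPT.hasItoIntegral_etaFunctional hP hU hW hX hμU hcov hAc hA hreg hpos t⟩
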